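/- Let $V\subseteq\mathbb R^n$ be open (the domain of local coordinates $x^\mu$ on a manifold $\mathscr M$, over which a vector bundle $E\to\mathscr M$ of rank $r$ has a frame). Let $\mathcal A=\mathscr C^\infty(T^*[2]E[1])$ be the graded algebra of polynomials in $p_\mu$ (degree $2$) and in the anticommuting variables $\xi^a,\zeta_a$ (degree $1$, $1\le a\le r$) with coefficients in $\mathscr C^\infty(V)$, with the Poisson bracket of degree $-2$ $$\{f,g\}=\frac{\partial f}{\partial x^\mu}\frac{\partial g}{\partial p_\mu}-\frac{\partial f}{\partial p_\mu}\frac{\partial g}{\partial x^\mu}+(-1)^{|f|}\Big(\frac{\partial f}{\partial \xi^a}\frac{\partial g}{\partial \zeta_a}+\frac{\partial f}{\partial \zeta_a}\frac{\partial g}{\partial \xi^a}\Big).$$ Put $\mathcal A_{\text{Lie-quasi}}=\{f : f|_{p=0,\zeta=0}=0\}$, $\mathcal A_{\text{quasi-Lie}}=\{f : f|_{p=0,\xi=0}=0\}$, $\mathcal A_{\rm Lie}=\mathcal A_{\text{Lie-quasi}}\cap\mathcal A_{\text{quasi-Lie}}$; these are graded subspaces closed under the bracket. For $\mathcal B$ equal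 to $\mathcal A$ or one of these, let $\mathsf{CE}(\mathcal B[2])$ be the Chevalley–Eilenberg cochains of the graded Lie algebra $\mathcal B[2]$ in the adjoint representation: in degree $D$, the families $(F_N)_{N\ge0}$ of graded antisymmetric $N$-linear maps $\mathcal B[2]^N\to\mathcal B[2]$ of internal degree $D-(N-1)$, with the Nijenhuis–Richardson bracket $[\cdot,\cdot]_{\mathsf{NR}}$ and the differential $\delta_{\mathsf S}=[\{\cdot,\cdot\},\cdot]_{\mathsf{NR}}$. A bi-directed graph has vertices $1,\dots,N$ and finitely many edges (loops and multiple edges allowed), each carrying a black arrow and a red arrow, parallel or opposite to each other. Let $\mathsf{Gra}_3^2(N)$ be the real span of such graphs (edges are bosonic, of degree $-2$). It is an operad for the partial compositions $\gamma\circ_i\gamma'$ that replace the vertex $i$ of $\gamma$ by $\gamma'$ and sum over all ways of reconnecting the ends of edges at $i$ to the vertices of $\gamma'$. For a set $o$ of colours let $\mathsf{fcGC}_3^{2|o}$ be the space of finite sums over $N\ge1$ of elements $\gamma\in\mathsf{Gra}_3^2(N)$ with $\gamma\cdot\sigma=\operatorname{sgn}(\sigma)\gamma$ for all $\sigma\in\mathbb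 S_N$ that are combinations of connected graphs without directed cycle of any colour in $o$. A graph with $N$ vertices and $k$ edges has degree $3(N-1)-2k$. The bracket is $[\gamma,\gamma']=\gamma\circ\gamma'-(-1)^{|\gamma||\gamma'|}\gamma'\circ\gamma$, where $\gamma\circ\gamma'$ is the signed sum of $\gamma\circ_1\gamma'$ over all unshuffles of the vertices, and $\delta=[\Upsilon_{\mathsf S},\cdot]$, where $\Upsilon_{\mathsf S}\in\mathsf{Gra}_3^2(2)$ is the sum of the two graphs with one edge, black arrow $1\to2$, minus the sum of the two graphs with one edge, black arrow $2\to1$. Let $\mathsf{Rep}^E_N(\gamma)(f_1\otimes\cdots\otimes f_N)=\mu_N\big(\prod_e\Delta_e(f_1\otimes\cdots\otimes f_N)\big)$ for a graph $\gamma$ with $N$ vertices, extended linearly, where $\mu_N$ is multiplication, the product is over the edges, and for an edge $e$ with black arrow $i\to j$ $$\Delta_e=\frac{\partial}{\partial x^\mu_{(i)}}\frac{\partial}{\partial p_\mu^{(j)}}\ \text{ if the red arrow is parallel},\qquad \Delta_e=\frac{\partial}{\partial \xi^a_{(i)}}\frac{\partial}{\partial \zeta_a^{(j)}}\ \text{ if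 it is opposite},$$ the index in parentheses being the tensor factor acted upon (with Koszul signs). **Proposition.** The spaces above are dg Lie algebras, and $\gamma\mapsto\mathsf{Rep}^E(\gamma)$, restricted to arguments in the subalgebra concerned (where it takes values in that subalgebra), defines morphisms of dg Lie algebras 1. $(\mathsf{fcGC}_3^{2},\delta,[\cdot,\cdot])\to(\mathsf{CE}(\mathcal A[2]),\delta_{\mathsf S},[\cdot,\cdot]_{\mathsf{NR}})$, with $o=\emptyset$; 2. $\mathsf{fcGC}_3^{2|\mathrm{black}}\to\mathsf{CE}(\mathcal A_{\text{Lie-quasi}}[2])$ and $\mathsf{fcGC}_3^{2|\mathrm{red}}\to\mathsf{CE}(\mathcal A_{\text{quasi-Lie}}[2])$, the two incarnations of $\mathsf{fcGC}_3^{2|1}$; 3. $\mathsf{fcGC}_3^{2|2}\to\mathsf{CE}(\mathcal A_{\rm Lie}[2])$, with $o=\{\mathrm{black},\mathrm{red}\}$. -/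

import Mathlib

open scoped TensorProduct ContDiff

noncomputable section

namespace LieBialgebroid

/-! ## Graded Lie data

A `ℤ`-graded real vector space is given by a family of subspaces (the homogeneous components) of
an ambient space; only elements of the components matter. -/

/-- The data of a (candidate) dg Lie algebra: homogeneous components `comp i`, the bracket
`bracket i j x y` of `x ∈ comp i` with `y ∈ comp j`, the differential `diff i x` of
`x ∈ comp i`. -/
structure DGLieData (X : Type) [AddCommGroup X] [Module ℝ X] where
  comp : ℤ → Submodule ℝ X
  bracket : ℤ → ℤ → X → X → X
  diff : ℤ → X → X

/-- The axioms of a dg Lie algebra, with bracket of degree `0` and differential of degree `1`.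
(Linearity in the second argument of the bracket follows from antisymmetry.) -/
structure DGLieData.IsDGLie {X : Type} [AddCommGroup X] [Module ℝ X] (L : DGLieData X) :
    Prop where
  bracket_mem : ∀ i j : ℤ, ∀ x ∈ L.comp i, ∀ y ∈ L.comp j, L.bracket i j x y ∈ L.comp (i + j)
  bracket_add : ∀ i j : ℤ, ∀ x ∈ L.comp i, ∀ x' ∈ L.comp i, ∀ y ∈ L.comp j,
    L.bracket i j (x + x') y = L.bracket i j x y + L.bracket i j x' y
  bracket_smul : ∀ i j : ℤ, ∀ c : ℝ, ∀ x ∈ L.comp i, ∀ y ∈ L.comp j,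
    L.bracket i j (c • x) y = c • L.bracket i j x y
  antisymm : ∀ i j : ℤ, ∀ x ∈ L.comp i, ∀ y ∈ L.comp j,
    L.bracket i j x y = -((i * j).negOnePow • L.bracket j i y x)
  jacobi : ∀ i j k : ℤ, ∀ x ∈ L.comp i, ∀ y ∈ L.comp j, ∀ z ∈ L.comp k,
    L.bracket i (j + k) x (L.bracket j k y z) =
      L.bracket (i + j) k (L.bracket i j x y) z +
        (i * j).negOnePow • L.bracket j (i + k) y (L.bracket i k x z)
  diff_mem : ∀ i : ℤ, ∀ x ∈ L.comp i, L.diff i x ∈ L.comp (i + 1)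
  diff_add : ∀ i : ℤ, ∀ x ∈ L.comp i, ∀ x' ∈ L.comp i,
    L.diff i (x + x') = L.diff i x + L.diff i x'
  diff_smul : ∀ i : ℤ, ∀ c : ℝ, ∀ x ∈ L.comp i, L.diff i (c • x) = c • L.diff i x
  diff_diff : ∀ i : ℤ, ∀ x ∈ L.comp i, L.diff (i + 1) (L.diff i x) = 0
  leibniz : ∀ i j : ℤ, ∀ x ∈ L.comp i, ∀ y ∈ L.comp j,
    L.diff (i + j) (L.bracket i j x y) =
      L.bracket (i + 1) j (L.diff i x) y + i.negOnePow • L.bracket i (j + 1) x (L.diff j y)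

/-- `φ` is a morphism of dg Lie algebras: a degree `0` linear map (one linear map for each
homogeneous component) commuting with the brackets and the differentials. -/
structure IsDGLieHom {X Y : Type} [AddCommGroup X] [Module ℝ X] [AddCommGroup Y] [Module ℝ Y]
    (L : DGLieData X) (L' : DGLieData Y) (φ : ∀ i : ℤ, L.comp i →ₗ[ℝ] L'.comp i) : Prop where
  map_bracket : ∀ (i j : ℤ) (x : L.comp i) (y : L.comp j) (z : L.comp (i + j)),
    (z : X) = L.bracket i j x y → (φ (i + j) z : Y) = L'.bracket i j (φ i x) (φ j y)
  map_diff : ∀ (i : ℤ) (x : L.comp i) (z : L.comp (i + 1)),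
    (z : X) = L.diff i x → (φ (i + 1) z : Y) = L'.diff i (φ i x)

/-! ## Signs of unshuffles

A subset `S` of `{1, …, n}` is the same thing as the unshuffle that moves the elements of `S`, in
increasing order, in front of those of the complement `Sᶜ`, in increasing order. -/

/-- The signature of the unshuffle `S`. -/
def unshuffleSign {n : ℕ} (S : Finset (Fin n)) : ℤˣ :=
  ∏ i ∈ Sᶜ, ∏ j ∈ S, if i < j then -1 else 1

/-- The Koszul sign of the unshuffle `S` acting on `x₁ ⊗ ⋯ ⊗ xₙ`, where `e i` says whether `xᵢ`
is odd. -/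
def koszulSign {n : ℕ} (S : Finset (Fin n)) (e : Fin n → Bool) : ℤˣ :=
  ∏ i ∈ Sᶜ, ∏ j ∈ S, if i < j ∧ e i = true ∧ e j = true then -1 else 1

/-! ## The Chevalley–Eilenberg complex and the Nijenhuis–Richardson bracket

Here `g` is a graded vector space with homogeneous components `G k` and with parity involution
`P` (so that `P x = (-1)ᵏ x` for `x ∈ G k`). -/

section ChevalleyEilenberg

variable {g : Type} [AddCommGroup g] [Module ℝ g]

/-- The even (`b = false`) and odd (`b = true`) part of an element of `g`. -/
def parityPart (P : g →ₗ[ℝ] g) (b : Bool) : g →ₗ[ℝ] g :=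
  (1 / 2 : ℝ) • (LinearMap.id + (if b then (-1 : ℝ) else 1) • P)

variable (g) in
/-- Families of multilinear maps `(F_N : g^N → g)`, `N ≥ 0`. -/
abbrev Cochain : Type :=
  ∀ N : ℕ, MultilinearMap ℝ (fun _ : Fin N => g) g

/-- The cochains of total degree `D` (in the adjoint representation): the `N`-ary component is a
graded antisymmetric map `g^N → g` of internal degree `D - (N - 1)`. -/
def ceComp (G : ℤ → Submodule ℝ g) (D : ℤ) : Submodule ℝ (Cochain g) where
  carrier := {F |
    (∀ (N : ℕ) (d : Fin N → ℤ) (x : Fin N → g), (∀ i, x i ∈ G (d i)) →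
      F N x ∈ G ((∑ i, d i) + (D - ((N : ℤ) - 1)))) ∧
    (∀ (N : ℕ) (i j : Fin N), (i : ℕ) + 1 = j → ∀ (a b : ℤ) (x : Fin N → g),
      x i ∈ G a → x j ∈ G b →
        F N (x ∘ Equiv.swap i j) = -((a * b).negOnePow • F N x))}
  add_mem' := by
    rintro F F' ⟨h1, h2⟩ ⟨h1', h2'⟩
    refine ⟨fun N d x hx => add_mem (h1 N d x hx) (h1' N d x hx),
      fun N i j hij a b x hi hj => ?_⟩
    simp only [Pi.add_apply, add_apply, h2 N i j hij a b x hi hj,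
      h2' N i j hij a b x hi hj, smul_add, neg_add]
  zero_mem' := ⟨fun _ _ _ _ => zero_mem _, fun _ _ _ _ _ _ _ _ _ => by simp⟩
  smul_mem' := by
    rintro c F ⟨h1, h2⟩
    refine ⟨fun N d x hx => Submodule.smul_mem _ c (h1 N d x hx),
      fun N i j hij a b x hi hj => ?_⟩
    simp only [Pi.smul_apply, smul_apply, h2 N i j hij a b x hi hj, smul_neg,
      smul_comm c]

/-- The map `x ↦ f (h (x_S), x_{Sᶜ})`. -/
def insertAt {n : ℕ} (S : Finset (Fin n))
    (f : MultilinearMap ℝ (fun _ : Fin (Sᶜ.card + 1) => g) g)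
    (h : MultilinearMap ℝ (fun _ : Fin S.card => g) g) :
    MultilinearMap ℝ (fun _ : Fin n => g) g :=
  (MultilinearMap.curryFinFinset ℝ g g rfl rfl).symm (f.curryLeft.compMultilinearMap h)

theorem insertAt_apply {n : ℕ} (S : Finset (Fin n))
    (f : MultilinearMap ℝ (fun _ : Fin (Sᶜ.card + 1) => g) g)
    (h : MultilinearMap ℝ (fun _ : Fin S.card => g) g) (x : Fin n → g) :
    insertAt S f h x =
      f (Fin.cons (h fun i => x (S.orderEmbOfFin rfl i)) fun i => x (Sᶜ.orderEmbOfFin rfl i)) := by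
  simp [insertAt]

/-- The composition `F ∘ H` of cochains, for `H` of total degree `j`. On homogeneous arguments,
`(F ∘ H)(x₁, …, xₙ) = ∑_S ± F(H(x_S), x_{Sᶜ})`, the sum running over all unshuffles `S`. The sign
is the product of the signature and the Koszul sign of `S`, and of `(-1)^(n - |S|)` if the
`|S|`-ary component of `H`, which has internal degree `j - (|S| - 1)`, is odd. -/
def nrComp (P : g →ₗ[ℝ] g) (j : ℤ) (F H : Cochain g) : Cochain g := fun n =>
  ∑ S : Finset (Fin n), ∑ e : Fin n → Bool,
    (unshuffleSign S * koszulSign S e *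
      ((Sᶜ.card : ℤ) * (j - ((S.card : ℤ) - 1))).negOnePow) •
        (insertAt S (F (Sᶜ.card + 1)) (H S.card)).compLinearMap fun i => parityPart P (e i)

/-- The Nijenhuis–Richardson bracket of cochains of total degrees `i` and `j`. -/
def nrBracket (P : g →ₗ[ℝ] g) (i j : ℤ) (F H : Cochain g) : Cochain g :=
  nrComp P j F H - (i * j).negOnePow • nrComp P i H F

/-- A bilinear map seen as a cochain. -/
def bilinCochain (b : g →ₗ[ℝ] g →ₗ[ℝ] g) : Cochain g
  | 2 => (LinearMap.compMultilinearMap b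
      (MultilinearMap.ofSubsingleton ℝ g g (0 : Fin 1) LinearMap.id)).uncurryRight
  | _ => 0

theorem bilinCochain_two (b : g →ₗ[ℝ] g →ₗ[ℝ] g) (x : Fin 2 → g) :
    bilinCochain b 2 x = b (x 0) (x 1) := rfl

/-- The Chevalley–Eilenberg dg Lie algebra `CE(g)` (in the adjoint representation) of a graded Lie
algebra `g` with bracket `b`: the cochains, with the Nijenhuis–Richardson bracket and the
differential `[b, ·]`. -/
def chevalleyEilenberg (G : ℤ → Submodule ℝ g) (P : g →ₗ[ℝ] g) (b : g →ₗ[ℝ] g →ₗ[ℝ] g) :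
    DGLieData (Cochain g) where
  comp := ceComp G
  bracket := nrBracket P
  diff i F := nrBracket P 1 i (bilinCochain b) F

end ChevalleyEilenberg
/-! ## Functions on `T*[2]E[1]` in local coordinates

`V` is an open subset of `ℝⁿ` (the domain of the coordinates `x^μ` of the base) over which the
bundle `E` has a frame, and `r` is the rank of `E`. -/

section Functions

variable {n : ℕ}

/-- The algebra `C^∞(V)` of smooth real functions on `V`. -/
def SmoothFun (V : TopologicalSpace.Opens (EuclideanSpace ℝ (Fin n))) :
    Subalgebra ℝ (V → ℝ) where
  carrier := {f | ContDiffOn ℝ ∞ (Function.extend Subtype.val f 0) V}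
  mul_mem' := by
    intro f h hf hh
    refine (ContDiffOn.mul hf hh).congr fun x hx => ?_
    have := Subtype.val_injective (p := fun y => y ∈ V)
    have e (k : V → ℝ) : Function.extend Subtype.val k 0 x = k ⟨x, hx⟩ :=
      this.extend_apply k 0 ⟨x, hx⟩
    simp only [e, Pi.mul_apply]
  add_mem' := by
    intro f h hf hh
    refine (ContDiffOn.add hf hh).congr fun x hx => ?_
    have := Subtype.val_injective (p := fun y => y ∈ V)
    have e (k : V → ℝ) : Function.extend Subtype.val k 0 x = k ⟨x, hx⟩ :=
      this.extend_apply k 0 ⟨x, hx⟩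
    simp only [e, Pi.add_apply]
  algebraMap_mem' := by
    intro c
    refine (contDiffOn_const (c := c)).congr fun x hx => ?_
    have := Subtype.val_injective (p := fun y => y ∈ V)
    exact this.extend_apply _ _ ⟨x, hx⟩

variable {V : TopologicalSpace.Opens (EuclideanSpace ℝ (Fin n))}

theorem differentiableAt_extend (f : SmoothFun V) (x : V) :
    DifferentiableAt ℝ (Function.extend Subtype.val f.1 0) (x : EuclideanSpace ℝ (Fin n)) :=
  (f.2.contDiffAt (V.isOpen.mem_nhds x.2)).differentiableAt (by simp)

/-- The partial derivative `∂/∂x^μ` of smooth functions. -/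
def smoothPartial (μ : Fin n) : SmoothFun V →ₗ[ℝ] SmoothFun V where
  toFun f := ⟨fun x => fderiv ℝ (Function.extend Subtype.val f.1 0) x
      (EuclideanSpace.single μ (1 : ℝ)), by
    have h : ContDiffOn ℝ ∞ (fun x => fderiv ℝ (Function.extend Subtype.val f.1 0) x
        (EuclideanSpace.single μ (1 : ℝ))) V :=
      (f.2.fderiv_of_isOpen V.isOpen (m := ∞) (by simp)).clm_apply contDiffOn_const
    refine h.congr fun x hx => ?_
    exact (Subtype.val_injective (p := fun y => y ∈ V)).extend_apply _ _ ⟨x, hx⟩⟩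
  map_add' f h := by
    ext x
    have e : Function.extend Subtype.val (f + h).1 0 =
        Function.extend Subtype.val f.1 0 + Function.extend Subtype.val h.1 0 := by
      have := Function.extend_add (Subtype.val : V → EuclideanSpace ℝ (Fin n)) f.1 h.1 0 0
      rw [add_zero] at this
      exact this
    simp only [e]
    rw [fderiv_add (differentiableAt_extend f x) (differentiableAt_extend h x)]
    rfl
  map_smul' c f := by
    ext x
    have e : Function.extend Subtype.val (c • f).1 0 =
        c • Function.extend Subtype.val f.1 0 := by
      have := Function.extend_smul c (Subtype.val : V → EuclideanSpace ℝ (Fin n)) f.1 0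
      rw [smul_zero] at this
      exact this
    simp only [e]
    rw [fderiv_const_smul (differentiableAt_extend f x)]
    rfl

/-- The space spanned by the odd coordinates: `ξ^a` is the basis vector with index `inl a`, and
`ζ_a` the one with index `inr a`. -/
abbrev OddSpan (r : ℕ) : Type := Fin r ⊕ Fin r → ℝ

/-- The algebra of functions of the graded manifold `T*[2]E[1]`: polynomials in the coordinates
`p_μ` (degree `2`) and in the anticommuting coordinates `ξ^a`, `ζ_a` (degree `1`), with
coefficients in the smooth functions of the coordinates `x^μ` (degree `0`). -/
def FunAlg (V : TopologicalSpace.Opens (EuclideanSpace ℝ (Fin n))) (r : ℕ) : Type :=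
  SmoothFun V ⊗[ℝ] (MvPolynomial (Fin n) ℝ ⊗[ℝ] ExteriorAlgebra ℝ (OddSpan r))

instance instRingFunAlg (V : TopologicalSpace.Opens (EuclideanSpace ℝ (Fin n))) (r : ℕ) :
    Ring (FunAlg V r) :=
  inferInstanceAs
    (Ring (SmoothFun V ⊗[ℝ] (MvPolynomial (Fin n) ℝ ⊗[ℝ] ExteriorAlgebra ℝ (OddSpan r))))

instance instAlgebraFunAlg (V : TopologicalSpace.Opens (EuclideanSpace ℝ (Fin n))) (r : ℕ) :
    Algebra ℝ (FunAlg V r) :=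
  inferInstanceAs
    (Algebra ℝ (SmoothFun V ⊗[ℝ] (MvPolynomial (Fin n) ℝ ⊗[ℝ] ExteriorAlgebra ℝ (OddSpan r))))

variable {r : ℕ}

/-- The functions of degree `k`. -/
def funComp (V : TopologicalSpace.Opens (EuclideanSpace ℝ (Fin n))) (r : ℕ) (k : ℤ) :
    Submodule ℝ (FunAlg V r) :=
  Submodule.span ℝ {a | ∃ (i j : ℕ) (f : SmoothFun V) (q : MvPolynomial (Fin n) ℝ)
    (w : ExteriorAlgebra ℝ (OddSpan r)), q.IsHomogeneous i ∧ w ∈ ⋀[ℝ]^j (OddSpan r) ∧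
      2 * (i : ℤ) + j = k ∧ a = f ⊗ₜ (q ⊗ₜ w)}

/-- The parity involution `f ↦ (-1)^|f| f`. -/
def parity : FunAlg V r →ₗ[ℝ] FunAlg V r :=
  TensorProduct.map LinearMap.id
    (TensorProduct.map LinearMap.id CliffordAlgebra.involute.toLinearMap)

/-- `∂/∂x^μ`. -/
def dx (μ : Fin n) : FunAlg V r →ₗ[ℝ] FunAlg V r :=
  TensorProduct.map (smoothPartial μ) LinearMap.id

/-- `∂/∂p_μ`. -/
def dp (μ : Fin n) : FunAlg V r →ₗ[ℝ] FunAlg V r :=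
  TensorProduct.map LinearMap.id
    (TensorProduct.map (MvPolynomial.pderiv μ).toLinearMap LinearMap.id)

/-- The (left) derivative with respect to an odd coordinate. -/
def dOdd (s : Fin r ⊕ Fin r) : FunAlg V r →ₗ[ℝ] FunAlg V r :=
  TensorProduct.map LinearMap.id (TensorProduct.map LinearMap.id
    (CliffordAlgebra.contractLeft (Q := (0 : QuadraticForm ℝ (OddSpan r)))
      (LinearMap.proj s : OddSpan r →ₗ[ℝ] ℝ)))

/-- `∂/∂ξ^a`. -/
def dxi (a : Fin r) : FunAlg V r →ₗ[ℝ] FunAlg V r := dOdd (Sum.inl a)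

/-- `∂/∂ζ_a`. -/
def dzeta (a : Fin r) : FunAlg V r →ₗ[ℝ] FunAlg V r := dOdd (Sum.inr a)

/-- The graded Poisson bracket
`{f, h} = ∂f/∂x^μ ∂h/∂p_μ - ∂f/∂p_μ ∂h/∂x^μ + (-1)^|f| (∂f/∂ξ^a ∂h/∂ζ_a + ∂f/∂ζ_a ∂h/∂ξ^a)`. -/
def poisson : FunAlg V r →ₗ[ℝ] FunAlg V r →ₗ[ℝ] FunAlg V r :=
  LinearMap.mk₂ ℝ (fun f h =>
      (∑ μ : Fin n, (dx μ f * dp μ h - dp μ f * dx μ h)) +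
      ∑ a : Fin r, (dxi a (parity f) * dzeta a h + dzeta a (parity f) * dxi a h))
    (fun f f' h => by
      simp only [map_add, add_mul, add_sub_add_comm, Finset.sum_add_distrib]; abel)
    (fun c f h => by
      simp only [map_smul, smul_mul_assoc, ← smul_sub, ← smul_add, ← Finset.smul_sum])
    (fun f h h' => by
      simp only [map_add, mul_add, add_sub_add_comm, Finset.sum_add_distrib]; abel)
    (fun c f h => by
      simp only [map_smul, mul_smul_comm, ← smul_sub, ← smul_add, ← Finset.smul_sum])

open Classical in
/-- The projection of the span of the odd coordinates that kills those outside of `T`. -/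
def killOdd {r : ℕ} (T : Set (Fin r ⊕ Fin r)) : OddSpan r →ₗ[ℝ] OddSpan r :=
  LinearMap.pi fun s => if s ∈ T then (LinearMap.proj s : OddSpan r →ₗ[ℝ] ℝ) else 0

/-- The substitution `p = 0` and `θ_s = 0` for the odd coordinates `θ_s` with `s ∉ T`. -/
def restrictTo (T : Set (Fin r ⊕ Fin r)) : FunAlg V r →ₐ[ℝ] FunAlg V r :=
  Algebra.TensorProduct.map (AlgHom.id ℝ _)
    (Algebra.TensorProduct.map (MvPolynomial.aeval fun _ => 0)
      (ExteriorAlgebra.map (killOdd T)))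

theorem restrictTo_tmul (T : Set (Fin r ⊕ Fin r)) (f : SmoothFun V) (q : MvPolynomial (Fin n) ℝ)
    (w : ExteriorAlgebra ℝ (OddSpan r)) :
    restrictTo T (f ⊗ₜ (q ⊗ₜ w) : FunAlg V r) = f ⊗ₜ ((MvPolynomial.aeval (fun _ => 0) q) ⊗ₜ
      (ExteriorAlgebra.map (killOdd T) w)) :=
  rfl

theorem funAlg_induction {C : FunAlg V r → Prop}
    (tmul : ∀ (f : SmoothFun V) (q : MvPolynomial (Fin n) ℝ)
      (w : ExteriorAlgebra ℝ (OddSpan r)), C (f ⊗ₜ (q ⊗ₜ w)))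
    (add : ∀ a b, C a → C b → C (a + b)) (a : FunAlg V r) : C a := by
  refine TensorProduct.induction_on a ?_ (fun f b => ?_) add
  · have := tmul 0 0 0
    rwa [TensorProduct.zero_tmul] at this
  · refine TensorProduct.induction_on b ?_ (fun q w => tmul f q w) (fun b b' h h' => ?_)
    · have := tmul f 0 0
      rwa [TensorProduct.zero_tmul] at this
    · rw [TensorProduct.tmul_add]
      exact add _ _ h h'

theorem restrictTo_parity (T : Set (Fin r ⊕ Fin r)) (a : FunAlg V r) :
    restrictTo T (parity a) = parity (restrictTo T a) := by
  induction a using funAlg_induction with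
  | add a b ha hb => simp only [map_add, ha, hb]
  | tmul f q w =>
    have h : (ExteriorAlgebra.map (killOdd T)) (CliffordAlgebra.involute w) =
        CliffordAlgebra.involute (ExteriorAlgebra.map (killOdd T) w) := by
      have : (ExteriorAlgebra.map (killOdd T)).comp CliffordAlgebra.involute =
          CliffordAlgebra.involute.comp (ExteriorAlgebra.map (killOdd T)) := by
        apply ExteriorAlgebra.hom_ext
        refine LinearMap.ext fun v => ?_
        have e : ExteriorAlgebra.map (killOdd T)
            (CliffordAlgebra.ι (0 : QuadraticForm ℝ (OddSpan r)) v) =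
            CliffordAlgebra.ι (0 : QuadraticForm ℝ (OddSpan r)) (killOdd T v) :=
          ExteriorAlgebra.map_apply_ι (killOdd T) v
        change ExteriorAlgebra.map (killOdd T) (CliffordAlgebra.involute
            (CliffordAlgebra.ι (0 : QuadraticForm ℝ (OddSpan r)) v)) =
          CliffordAlgebra.involute (ExteriorAlgebra.map (killOdd T)
            (CliffordAlgebra.ι (0 : QuadraticForm ℝ (OddSpan r)) v))
        rw [CliffordAlgebra.involute_ι, map_neg, e, CliffordAlgebra.involute_ι]
      exact DFunLike.congr_fun this w
    exact congrArg (fun z => (f ⊗ₜ ((MvPolynomial.aeval (fun _ => 0) q) ⊗ₜ z) :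
      SmoothFun V ⊗[ℝ] (MvPolynomial (Fin n) ℝ ⊗[ℝ] ExteriorAlgebra ℝ (OddSpan r)))) h

theorem restrictTo_dx (T : Set (Fin r ⊕ Fin r)) (μ : Fin n) (a : FunAlg V r) :
    restrictTo T (dx μ a) = dx μ (restrictTo T a) := by
  induction a using funAlg_induction with
  | add a b ha hb => simp only [map_add, ha, hb]
  | tmul f q w => rfl

theorem restrictTo_dOdd (T : Set (Fin r ⊕ Fin r)) {s : Fin r ⊕ Fin r} (hs : s ∈ T)
    (a : FunAlg V r) :
    restrictTo T (dOdd s a) = dOdd s (restrictTo T a) := by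
  induction a using funAlg_induction with
  | add a b ha hb => simp only [map_add, ha, hb]
  | tmul f q w =>
    have h : (ExteriorAlgebra.map (killOdd T))
        (CliffordAlgebra.contractLeft (Q := (0 : QuadraticForm ℝ (OddSpan r)))
          (LinearMap.proj s : OddSpan r →ₗ[ℝ] ℝ) w) =
        CliffordAlgebra.contractLeft (Q := (0 : QuadraticForm ℝ (OddSpan r)))
          (LinearMap.proj s : OddSpan r →ₗ[ℝ] ℝ) (ExteriorAlgebra.map (killOdd T) w) := by
      induction w using CliffordAlgebra.left_induction with
      | algebraMap c =>
        rw [CliffordAlgebra.contractLeft_algebraMap, map_zero, AlgHom.commutes]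
        exact (CliffordAlgebra.contractLeft_algebraMap (Q := (0 : QuadraticForm ℝ (OddSpan r)))
          (LinearMap.proj s) c).symm
      | add x y hx hy => simp only [map_add, hx, hy]
      | ι_mul x v hx =>
        have e : ExteriorAlgebra.map (killOdd T)
            (CliffordAlgebra.ι (0 : QuadraticForm ℝ (OddSpan r)) v) =
            CliffordAlgebra.ι (0 : QuadraticForm ℝ (OddSpan r)) (killOdd T v) :=
          ExteriorAlgebra.map_apply_ι (killOdd T) v
        have e' : (LinearMap.proj s : OddSpan r →ₗ[ℝ] ℝ) (killOdd T v) =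
            (LinearMap.proj s : OddSpan r →ₗ[ℝ] ℝ) v := by simp [killOdd, hs]
        rw [CliffordAlgebra.contractLeft_ι_mul, map_sub, map_smul, map_mul, map_mul, hx, e,
          CliffordAlgebra.contractLeft_ι_mul, e']
    exact congrArg (fun z => (f ⊗ₜ ((MvPolynomial.aeval (fun _ => 0) q) ⊗ₜ z) :
      SmoothFun V ⊗[ℝ] (MvPolynomial (Fin n) ℝ ⊗[ℝ] ExteriorAlgebra ℝ (OddSpan r)))) h

/-- A subspace of the algebra of functions that is stable under the parity involution (as every
graded subspace is) and under the graded Poisson bracket. -/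
structure PoissonSubspace (V : TopologicalSpace.Opens (EuclideanSpace ℝ (Fin n))) (r : ℕ) where
  space : Submodule ℝ (FunAlg V r)
  parity_mem : ∀ f ∈ space, parity f ∈ space
  poisson_mem : ∀ f ∈ space, ∀ h ∈ space, poisson f h ∈ space

variable (V r) in
/-- The whole algebra of functions. -/
def allFun : PoissonSubspace V r where
  space := ⊤
  parity_mem _ _ := trivial
  poisson_mem _ _ _ _ := trivial

variable (V r) in
/-- The subalgebra `A_Lie-quasi` of the functions `f` with `f = 0` on `p = 0, ζ = 0`. -/
def lieQuasi : PoissonSubspace V r where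
  space := LinearMap.ker (restrictTo (V := V) (Set.range Sum.inl)).toLinearMap
  parity_mem f hf := by
    have hf : restrictTo (Set.range Sum.inl) f = 0 := hf
    change restrictTo (Set.range Sum.inl) (parity f) = 0
    rw [restrictTo_parity, hf, map_zero]
  poisson_mem f hf h hh := by
    have hf : restrictTo (Set.range Sum.inl) f = 0 := hf
    have hh : restrictTo (Set.range Sum.inl) h = 0 := hh
    change restrictTo (Set.range Sum.inl) (poisson f h) = 0
    simp [poisson, restrictTo_dx, dxi, restrictTo_dOdd, restrictTo_parity, hf, hh]

variable (V r) in
/-- The subalgebra `A_quasi-Lie` of the functions `f` with `f = 0` on `p = 0, ξ = 0`. -/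
def quasiLie : PoissonSubspace V r where
  space := LinearMap.ker (restrictTo (V := V) (Set.range Sum.inr)).toLinearMap
  parity_mem f hf := by
    have hf : restrictTo (Set.range Sum.inr) f = 0 := hf
    change restrictTo (Set.range Sum.inr) (parity f) = 0
    rw [restrictTo_parity, hf, map_zero]
  poisson_mem f hf h hh := by
    have hf : restrictTo (Set.range Sum.inr) f = 0 := hf
    have hh : restrictTo (Set.range Sum.inr) h = 0 := hh
    change restrictTo (Set.range Sum.inr) (poisson f h) = 0
    simp [poisson, restrictTo_dx, dzeta, restrictTo_dOdd, restrictTo_parity, hf, hh]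

variable (V r) in
/-- The subalgebra `A_Lie`, the intersection of `A_Lie-quasi` and `A_quasi-Lie`. -/
def lieFun : PoissonSubspace V r where
  space := (lieQuasi V r).space ⊓ (quasiLie V r).space
  parity_mem f hf := ⟨(lieQuasi V r).parity_mem f hf.1, (quasiLie V r).parity_mem f hf.2⟩
  poisson_mem f hf h hh := ⟨(lieQuasi V r).poisson_mem f hf.1 h hh.1,
    (quasiLie V r).poisson_mem f hf.2 h hh.2⟩

/-- The graded Poisson bracket on a subspace. -/
def PoissonSubspace.bracket (B : PoissonSubspace V r) : B.space →ₗ[ℝ] B.space →ₗ[ℝ] B.space :=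
  LinearMap.mk₂ ℝ (fun f h => ⟨poisson f.1 h.1, B.poisson_mem f f.2 h h.2⟩)
    (fun f f' h => Subtype.ext (by simp)) (fun c f h => Subtype.ext (by simp))
    (fun f h h' => Subtype.ext (by simp)) (fun c f h => Subtype.ext (by simp))

/-- The dg Lie algebra `CE(B[2])`. The component of degree `k` of the suspension `B[2]` is the
component of degree `k + 2` of `B`. -/
def PoissonSubspace.ce (B : PoissonSubspace V r) : DGLieData (Cochain B.space) :=
  chevalleyEilenberg (fun k => (funComp V r (k + 2)).comap B.space.subtype)
    (parity.restrict B.parity_mem) B.bracket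

end Functions

/-! ## Bi-directed graphs

All constructions are in dimension `d = 3`: edges have degree `1 - d = -2` and are bosonic,
vertices are fermionic. -/

/-- The two colours of arrows carried by each edge. -/
inductive Colour
  | black
  | red

/-- A possible edge of a bi-directed graph with vertices `1, …, N`: the black arrow goes from `src`
to `tgt`; the red arrow is parallel to it if `aligned` is true, and opposite to it otherwise. -/
structure Edge (N : ℕ) where
  src : Fin N
  tgt : Fin N
  aligned : Bool

/-- The vertex at which the arrow of the given colour starts. -/
def Edge.tail {N : ℕ} (e : Edge N) : Colour → Fin N
  | .black => e.src
  | .red => if e.aligned then e.src else e.tgt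

/-- The vertex at which the arrow of the given colour ends. -/
def Edge.head {N : ℕ} (e : Edge N) : Colour → Fin N
  | .black => e.tgt
  | .red => if e.aligned then e.tgt else e.src

/-- The graph operad `Gra_3^2` in arity `N`. As edges are bosonic, a graph is determined by the
multiplicity of each possible edge (loops and multiple edges are allowed), that is, by a monomial
in the edges, of degree the number of edges of the graph. So `Gra_3^2(N)`, the space of linear
combinations of graphs, is the space of polynomials in the edges. -/
abbrev Gra (N : ℕ) : Type := MvPolynomial (Edge N) ℝ

/-- The graph `m` has no cycle made of arrows of colour `c`. -/
def IsOriented {N : ℕ} (c : Colour) (m : Edge N →₀ ℕ) : Prop :=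
  ∀ v : Fin N, ¬ Relation.TransGen (fun a b => ∃ e ∈ m.support, e.tail c = a ∧ e.head c = b) v v

/-- The graph `m` is connected. -/
def IsConnectedGraph {N : ℕ} (m : Edge N →₀ ℕ) : Prop :=
  ∀ v w : Fin N, Relation.EqvGen (fun a b => ∃ e ∈ m.support, e.src = a ∧ e.tgt = b) v w

/-- Relabelling of the vertices of graphs along `ι`. -/
def relabel {M N : ℕ} (ι : Fin M → Fin N) : Gra M →ₐ[ℝ] Gra N :=
  MvPolynomial.rename fun e => ⟨ι e.src, ι e.tgt, e.aligned⟩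

/-- Replacement of each vertex `v` of a graph by the set of vertices `π⁻¹(v)`: the sum over all ways
of reconnecting both ends of each edge. -/
def blowUp {M N : ℕ} (π : Fin N → Fin M) : Gra M →ₐ[ℝ] Gra N :=
  MvPolynomial.aeval fun e =>
    ∑ a with π a = e.src, ∑ b with π b = e.tgt, MvPolynomial.X ⟨a, b, e.aligned⟩

/-- The partial composition `γ ∘₁ γ'` of operads, with vertices relabelled by the unshuffle `S`:
the first vertex of `γ` is replaced by the graph `γ'`, the vertices of `γ'` become those of `S`, in
increasing order, and the other vertices of `γ` become those of `Sᶜ`, in increasing order. -/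
def insertGraph {N : ℕ} (S : Finset (Fin N)) (γ : Gra (Sᶜ.card + 1)) (γ' : Gra S.card) : Gra N :=
  blowUp (fun a => Sum.elim (fun _ => 0) Fin.succ ((finSumEquivOfFinset rfl rfl).symm a :
      Fin S.card ⊕ Fin Sᶜ.card)) γ *
    relabel (fun i => S.orderEmbOfFin rfl i) γ'

/-- The elements of degree `D` of the complex `fcGC_3^{2|o}` of connected bi-directed graphs without
cycles of any of the colours in `o`: finite sums over `N ≥ 1` of combinations of graphs with `N`
vertices and `k` edges, `3(N - 1) - 2k = D`, that are invariant under the symmetric group up to the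
signature. -/
def fcGCComp (o : Set Colour) (D : ℤ) : Submodule ℝ (∀ N : ℕ, Gra N) where
  carrier := {γ | γ 0 = 0 ∧ {N | γ N ≠ 0}.Finite ∧
    (∀ (N : ℕ) (σ : Equiv.Perm (Fin N)), relabel σ (γ N) = Equiv.Perm.sign σ • γ N) ∧
    ∀ (N : ℕ) (m : Edge N →₀ ℕ), (γ N).coeff m ≠ 0 →
      IsConnectedGraph m ∧ (∀ c ∈ o, IsOriented c m) ∧ 3 * ((N : ℤ) - 1) - 2 * m.degree = D}
  add_mem' := by
    rintro γ γ' ⟨h0, h1, h2, h3⟩ ⟨h0', h1', h2', h3'⟩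
    refine ⟨by simp [h0, h0'], (h1.union h1').subset fun N hN => ?_, fun N σ => ?_,
      fun N m hm => ?_⟩
    · by_contra h
      simp only [Set.mem_union, Set.mem_ofPred_eq, not_or, not_not] at h
      exact hN (by simp [h.1, h.2])
    · simp [h2, h2']
    · by_cases h : (γ N).coeff m = 0
      · exact h3' N m fun h' => hm (by simp [h, h'])
      · exact h3 N m h
  zero_mem' := ⟨rfl, by simp, fun _ _ => by simp, fun _ _ h => absurd (by simp) h⟩
  smul_mem' := by
    rintro c γ ⟨h0, h1, h2, h3⟩
    refine ⟨by simp [h0], h1.subset fun N hN h => hN (by simp [h]), fun N σ => ?_,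
      fun N m hm => h3 N m fun h => hm (by simp [h])⟩
    rw [Pi.smul_apply, map_smul, h2, smul_comm]

/-- The composition `γ ∘ γ'`, summing the (signed) partial compositions over all unshuffles. -/
def graphComp (γ γ' : ∀ N : ℕ, Gra N) : ∀ N : ℕ, Gra N := fun _ =>
  ∑ S, unshuffleSign S • insertGraph S (γ (Sᶜ.card + 1)) (γ' S.card)

/-- The Lie bracket of elements of degrees `i` and `j` of the graph complex. -/
def graphBracket (i j : ℤ) (γ γ' : ∀ N : ℕ, Gra N) : ∀ N : ℕ, Gra N :=
  graphComp γ γ' - (i * j).negOnePow • graphComp γ' γ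

/-- The Maurer–Cartan element: the sum, over both relative directions of the red arrow, of the
graph with one edge from `1` to `2`, minus the one with an edge from `2` to `1`. -/
def upsilon : ∀ N : ℕ, Gra N
  | 2 => ∑ s : Bool, (MvPolynomial.X ⟨0, 1, s⟩ - MvPolynomial.X ⟨1, 0, s⟩)
  | _ => 0

/-- The dg Lie algebra `fcGC_3^{2|o}` of connected bi-directed graphs, oriented with respect to
each of the colours in `o`. -/
def fcGC (o : Set Colour) : DGLieData (∀ N : ℕ, Gra N) where
  comp := fcGCComp o
  bracket := graphBracket
  diff i γ := graphBracket 1 i upsilon γ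

/-! ## The representation `Rep^E` -/

section Representation

variable {n : ℕ} {V : TopologicalSpace.Opens (EuclideanSpace ℝ (Fin n))} {r : ℕ}

/-- The operator `1 ⊗ ⋯ ⊗ D ⊗ ⋯ ⊗ 1` with an even operator `D` in the place `i`. -/
def evenAt {N : ℕ} (i : Fin N) (D : FunAlg V r →ₗ[ℝ] FunAlg V r) :
    Module.End ℝ (⨂[ℝ] _ : Fin N, FunAlg V r) :=
  PiTensorProduct.map fun j => if j = i then D else LinearMap.id

/-- The operator `1 ⊗ ⋯ ⊗ D ⊗ ⋯ ⊗ 1` with an odd operator `D` in the place `i`: by the Koszul sign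
rule, `f₁ ⊗ ⋯ ⊗ f_N` is sent to `(-1)^(|f₁| + ⋯ + |f_{i-1}|) f₁ ⊗ ⋯ ⊗ D f_i ⊗ ⋯ ⊗ f_N`. -/
def oddAt {N : ℕ} (i : Fin N) (D : FunAlg V r →ₗ[ℝ] FunAlg V r) :
    Module.End ℝ (⨂[ℝ] _ : Fin N, FunAlg V r) :=
  PiTensorProduct.map fun j => if j < i then parity else if j = i then D else LinearMap.id

variable (V r) in
/-- The operator `Δ_e` of an edge `e` with black arrow from `i` to `j`: it is
`∂/∂x^μ_(i) ∂/∂p_μ^(j)` if the red arrow is parallel to the black one, and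
`∂/∂ξ^a_(i) ∂/∂ζ_a^(j)` if it is opposite to it. -/
def edgeOp {N : ℕ} (e : Edge N) : Module.End ℝ (⨂[ℝ] _ : Fin N, FunAlg V r) :=
  if e.aligned then ∑ μ : Fin n, evenAt e.src (dx μ) * evenAt e.tgt (dp μ)
  else ∑ a : Fin r, oddAt e.src (dxi a) * oddAt e.tgt (dzeta a)

variable (V r) in
/-- The multiplication `f₁ ⊗ ⋯ ⊗ f_N ↦ f₁ ⋯ f_N`. -/
def mulMap (N : ℕ) : (⨂[ℝ] _ : Fin N, FunAlg V r) →ₗ[ℝ] FunAlg V r :=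
  PiTensorProduct.lift (MultilinearMap.mkPiAlgebraFin ℝ N (FunAlg V r))

variable (V r) in
/-- The action of a single graph: apply the operators `Δ_e` of all its edges, and multiply. (The
operators `Δ_e` commute, so that their order does not matter.) -/
def repGraph {N : ℕ} (m : Edge N →₀ ℕ) :
    MultilinearMap ℝ (fun _ : Fin N => FunAlg V r) (FunAlg V r) :=
  (mulMap V r N ∘ₗ ((Finsupp.toMultiset m).toList.map (edgeOp V r)).prod).compMultilinearMap
    (PiTensorProduct.tprod ℝ)

variable (V r) in
/-- The map `Rep^E_N` from `Gra_3^2(N)` to the `N`-ary operations on the algebra of functions. -/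
def rep (N : ℕ) :
    Gra N →ₗ[ℝ] MultilinearMap ℝ (fun _ : Fin N => FunAlg V r) (FunAlg V r) :=
  (MvPolynomial.basisMonomials (Edge N) ℝ).constr ℝ (repGraph V r)

/-- `Rep^E` restricts to the subspace `B` on the graphs of `fcGC_3^{2|o}` and induces a morphism of
dg Lie algebras `fcGC_3^{2|o} → CE(B[2])`. -/
def RepInduces (o : Set Colour) (B : PoissonSubspace V r) : Prop :=
  (fcGC o).IsDGLie ∧ B.ce.IsDGLie ∧
  ∃ φ : ∀ D : ℤ, (fcGC o).comp D →ₗ[ℝ] B.ce.comp D,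
    (∀ (D : ℤ) (γ : (fcGC o).comp D) (N : ℕ) (f : Fin N → B.space),
      (((φ D γ).1 N f : B.space) : FunAlg V r) = rep V r N (γ.1 N) fun i => (f i : FunAlg V r)) ∧
    IsDGLieHom (fcGC o) B.ce φ

end Representation

end LieBialgebroid
end

/-! Identities are proved for multilinear operations and then transported to graphs or to functions.
A graph acts on the tensor power of a supercommutative algebra by commuting operators, one for each
edge, followed by multiplication. By the Leibniz rule, a derivation of a product is the sum of the
derivations of its factors (`act_push`). This is exactly the sum over all reconnections of an edge
end when a graph is substituted for a vertex. Edges are bosonic, so the only signs are the signature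
and the Koszul sign of the unshuffle, as in the Nijenhuis–Richardson composition. Hence the action
turns composition of graphs into composition of cochains (`EdgeOps.rep_insertGraph`,
`EdgeOps.rep_graphComp`).

On homogeneous arguments the composition of cochains is a sum over unshuffles with commutation
factor `(-1)^(1 + |x||y|)`. In `(F ∘ H) ∘ K - F ∘ (H ∘ K)` there remain the terms in which `H` and
`K` fill two different arguments of `F`. These terms are graded symmetric in `H` and `K`
(`parallelComp_comm`), so the composition is graded pre-Lie and its commutator satisfies the Jacobi
identity (`nrBracket_jacobi`).

The Lie axioms for graphs are pulled back along a faithful representation, `modelOps n`. Its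
operators carry the edges themselves as coefficients and act on `t_1, …, t_n` by Euler fields `t_a
∂/∂t_a`. A graph combination `γ` with `n` vertices, applied to `t_1, …, t_n`, gives `γ t_1 ⋯ t_n`
(`modelOps_rep_injective`). There `Υ` becomes a skew biderivation built from commuting vector
fields, whose Jacobi identity gives `[Υ, Υ] = 0` (`graphBracket_upsilon`). On functions, `Υ` acts as
the Poisson bracket (`rep_upsilon`), so the Jacobi identity of the latter, and with it the
square-zero differential of `CE`, also follows from `[Υ, Υ] = 0`. Both dg structures come from a
Maurer–Cartan element (`DGLieData.isDGLie_of_maurerCartan`).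

Two geometric facts concern the colours. Connectedness and absence of cycles survive substitution: a
cycle either projects to a cycle of the outer graph or stays inside the inserted one
(`IsSubstitution.oriented`). And a graph without cycles of a colour has a vertex without incoming
arrows of that colour. At that vertex only derivatives commuting with the corresponding restriction
act, so that factor, and hence the product, still vanishes after restriction
(`restrictTo_repGraph`). -/

noncomputable section

namespace LieBialgebroid

/-! ## Signed sums over unshuffles of lists -/

section ShuffleSum

variable {X Y M : Type} [AddCommGroup M]

/-- The sign of moving `x` past all elements of `A`. -/
def listSign (χ : X → X → ℤˣ) (x : X) (A : List X) : ℤˣ := (A.map (χ x)).prod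

@[simp] theorem listSign_nil (χ : X → X → ℤˣ) (x : X) : listSign χ x [] = 1 := rfl

@[simp] theorem listSign_cons (χ : X → X → ℤˣ) (x a : X) (A : List X) :
    listSign χ x (a :: A) = χ x a * listSign χ x A := by simp [listSign]

theorem listSign_append (χ : X → X → ℤˣ) (x : X) (A B : List X) :
    listSign χ x (A ++ B) = listSign χ x A * listSign χ x B := by simp [listSign]

theorem listSign_perm (χ : X → X → ℤˣ) (x : X) {A B : List X} (h : A.Perm B) :
    listSign χ x A = listSign χ x B := (h.map _).prod_eq

/-- The sum of `Φ A B` over all unshuffles of a list into lists `A` and `B`, with the signs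
obtained from the commutation factor `χ`. -/
def shuffleSum (χ : X → X → ℤˣ) : List X → (List X → List X → M) → M
  | [], Φ => Φ [] []
  | x :: L, Φ => shuffleSum χ L (fun A B => Φ (x :: A) B) +
      shuffleSum χ L (fun A B => listSign χ x A • Φ A (x :: B))

variable (χ : X → X → ℤˣ)

@[simp] theorem shuffleSum_nil (Φ : List X → List X → M) : shuffleSum χ [] Φ = Φ [] [] := rfl

theorem shuffleSum_cons (x : X) (L : List X) (Φ : List X → List X → M) :
    shuffleSum χ (x :: L) Φ = shuffleSum χ L (fun A B => Φ (x :: A) B) +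
      shuffleSum χ L (fun A B => listSign χ x A • Φ A (x :: B)) := rfl

/-- Only pairs that jointly rearrange `L` occur, which makes relations between lengths and degrees
of the two blocks available under the sum. -/
theorem shuffleSum_congr {L : List X} {Φ Ψ : List X → List X → M}
    (h : ∀ A B, (A ++ B).Perm L → Φ A B = Ψ A B) : shuffleSum χ L Φ = shuffleSum χ L Ψ := by
  induction L generalizing Φ Ψ with
  | nil => exact h [] [] (by simp)
  | cons x L ih =>
    rw [shuffleSum_cons, shuffleSum_cons]
    congr 1
    · exact ih fun A B hAB => h _ _ (by simpa using hAB)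
    · exact ih fun A B hAB => by rw [h A (x :: B) (List.perm_middle.trans (hAB.cons x))]

theorem shuffleSum_add (L : List X) (Φ Ψ : List X → List X → M) :
    shuffleSum χ L (fun A B => Φ A B + Ψ A B) = shuffleSum χ L Φ + shuffleSum χ L Ψ := by
  induction L generalizing Φ Ψ with
  | nil => rfl
  | cons x L ih => simp only [shuffleSum_cons, smul_add, ih]; abel

theorem shuffleSum_map {M' : Type} [AddCommGroup M'] (f : M →+ M') (L : List X)
    (Φ : List X → List X → M) :
    f (shuffleSum χ L Φ) = shuffleSum χ L (fun A B => f (Φ A B)) := by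
  induction L generalizing Φ with
  | nil => rfl
  | cons x L ih => simp only [shuffleSum_cons, map_add, ih, Units.smul_def, map_zsmul]

theorem shuffleSum_smul (u : ℤˣ) (L : List X) (Φ : List X → List X → M) :
    u • shuffleSum χ L Φ = shuffleSum χ L (fun A B => u • Φ A B) :=
  shuffleSum_map χ (DistribSMul.toAddMonoidHom M u) L Φ

theorem shuffleSum_list_map (y : Y → X) (L : List Y) (Φ : List X → List X → M) :
    shuffleSum χ (L.map y) Φ =
      shuffleSum (fun a b => χ (y a) (y b)) L (fun A B => Φ (A.map y) (B.map y)) := by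
  induction L generalizing Φ with
  | nil => rfl
  | cons x L ih =>
    simp only [List.map_cons, shuffleSum_cons, ih]
    congr 2
    funext A B
    simp [listSign, Function.comp_def]

/-- Coassociativity of unshuffles: both sides distribute `L` over three blocks. The sign of passing
a block is multiplicative and invariant under permutations of the block, so it does not depend on
the order of the two splittings. -/
theorem shuffleSum_assoc (L : List X) (Φ : List X → List X → List X → M) :
    shuffleSum χ L (fun A D => shuffleSum χ A (fun B C => Φ B C D)) =
      shuffleSum χ L (fun B D => shuffleSum χ D (fun C D => Φ B C D)) := by
  induction L generalizing Φ with
  | nil => rfl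
  | cons x L ih =>
    have e : ∀ A, ∀ Ψ : List X → List X → M, listSign χ x A • shuffleSum χ A Ψ =
        shuffleSum χ A (fun B C => listSign χ x B • listSign χ x C • Ψ B C) := fun A Ψ => by
      rw [shuffleSum_smul]
      exact shuffleSum_congr χ fun B C h => by
        rw [← listSign_perm χ x h, listSign_append, mul_smul]
    simp only [shuffleSum_cons, shuffleSum_add, smul_add, e, ih, add_assoc]
    simp only [shuffleSum_smul]

/-- The sign of moving the list `A` past the list `B`. -/
def crossSign (A B : List X) : ℤˣ := (A.map fun a => listSign χ a B).prod

theorem crossSign_cons_left (x : X) (A B : List X) :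
    crossSign χ (x :: A) B = listSign χ x B * crossSign χ A B := by simp [crossSign]

theorem crossSign_cons_right (hχ : ∀ x y, χ x y = χ y x) (x : X) (A B : List X) :
    crossSign χ A (x :: B) = listSign χ x A * crossSign χ A B := by
  induction A with
  | nil => simp [crossSign]
  | cons a A ih =>
    rw [crossSign_cons_left, crossSign_cons_left, ih, listSign_cons, listSign_cons, hχ a x]
    simp only [mul_assoc, mul_left_comm, mul_comm]

/-- Graded cocommutativity of unshuffles: exchanging the two blocks costs the sign of moving one
past the other. -/
theorem shuffleSum_comm (hχ : ∀ x y, χ x y = χ y x) (L : List X) (Φ : List X → List X → M) :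
    shuffleSum χ L Φ = shuffleSum χ L (fun A B => crossSign χ A B • Φ B A) := by
  induction L generalizing Φ with
  | nil => simp [crossSign]
  | cons x L ih =>
    rw [shuffleSum_cons, shuffleSum_cons, add_comm]
    congr 1
    · rw [ih]
      simp only [crossSign_cons_left, ← mul_smul, mul_comm]
    · rw [ih]
      simp only [crossSign_cons_right χ hχ, ← mul_smul, ← mul_assoc, Int.units_mul_self, one_mul]

/-- If `x` and `y` land in the same block, the hypotheses apply. If they land in different blocks,
the swap matches terms whose unshuffle signs differ by `χ x y`. -/
theorem shuffleSum_swap (hχ : ∀ x y, χ x y = χ y x) (x y : X) (L L' : List X)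
    (Φ : List X → List X → M)
    (h1 : ∀ A A' B, Φ (A ++ x :: y :: A') B = χ x y • Φ (A ++ y :: x :: A') B)
    (h2 : ∀ A B B', Φ A (B ++ x :: y :: B') = χ x y • Φ A (B ++ y :: x :: B')) :
    shuffleSum χ (L ++ x :: y :: L') Φ = χ x y • shuffleSum χ (L ++ y :: x :: L') Φ := by
  have hu : χ x y * χ x y = 1 := Int.units_mul_self _
  induction L generalizing Φ with
  | nil =>
    simp only [List.nil_append, shuffleSum_cons, listSign_cons, smul_add, shuffleSum_smul,
      ← shuffleSum_add]
    refine shuffleSum_congr χ fun A B _ => ?_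
    have e1 := h1 [] A B
    have e2 := h2 A [] B
    simp only [List.nil_append] at e1 e2
    rw [e1, e2, hχ y x]
    simp only [← mul_smul, ← mul_assoc, hu, one_mul]
    rw [show listSign χ y A * listSign χ x A * χ x y = χ x y * listSign χ x A * listSign χ y A by
      ac_rfl]
    abel
  | cons z L ih =>
    rw [List.cons_append, List.cons_append, shuffleSum_cons, shuffleSum_cons, smul_add]
    congr 1
    · exact ih _ (fun A A' B => h1 (z :: A) A' B) fun A B B' => h2 (z :: A) B B'
    · refine ih _ (fun A A' B => ?_) fun A B B' => ?_
      · rw [h1, smul_comm, listSign_perm χ z (List.Perm.append_left A (List.Perm.swap y x A'))]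
      · have := h2 A (z :: B) B'
        simp only [List.cons_append] at this
        rw [this, smul_comm]

/-- The sign of an unshuffle of a linearly ordered set. -/
def shuffleSign {ι : Type} [LinearOrder ι] (χ : ι → ι → ℤˣ) (S T : Finset ι) : ℤˣ :=
  ∏ i ∈ T, ∏ j ∈ S, if i < j then χ i j else 1

/-- Induction on the smallest index. Placed in the front block it creates no inversion; placed in
the back block it is inverted with every element of `S`, which produces the sign in the recursion.
-/
theorem sum_powerset_eq_shuffleSum {ι : Type} [LinearOrder ι] (χ : ι → ι → ℤˣ) (I : List ι)
    (hI : I.Pairwise (· < ·)) (Φ : List ι → List ι → M) :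
    ∑ S ∈ I.toFinset.powerset, shuffleSign χ S (I.toFinset \ S) •
      Φ (I.filter (· ∈ S)) (I.filter (· ∉ S)) = shuffleSum χ I Φ := by
  induction I generalizing Φ with
  | nil => simp [shuffleSign]
  | cons i I ih =>
    obtain ⟨hi, hI⟩ := List.pairwise_cons.1 hI
    have hn : i ∉ I.toFinset := fun h => lt_irrefl i (hi i (List.mem_toFinset.1 h))
    rw [List.toFinset_cons, Finset.sum_powerset_insert hn, shuffleSum_cons, ← ih hI, ← ih hI,
      add_comm]
    congr 1 <;> refine Finset.sum_congr rfl fun S hS => ?_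
    all_goals
      have hS := Finset.mem_powerset.1 hS
      have hiS : i ∉ S := fun h => hn (hS h)
    · have e1 : insert i I.toFinset \ insert i S = I.toFinset \ S := by
        ext a; simp only [Finset.mem_sdiff, Finset.mem_insert]
        constructor
        · rintro ⟨h | h, h'⟩ <;> simp_all
        · rintro ⟨h, h'⟩
          refine ⟨Or.inr h, ?_⟩
          rintro (rfl | h'')
          · exact hn h
          · exact h' h''
      have e2 : shuffleSign χ (insert i S) (I.toFinset \ S) =
          shuffleSign χ S (I.toFinset \ S) := by
        refine Finset.prod_congr rfl fun a ha => ?_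
        rw [Finset.prod_insert hiS, if_neg, one_mul]
        exact (hi a (List.mem_toFinset.1 (Finset.mem_sdiff.1 ha).1)).asymm
      rw [e1, e2]
      have e3 : I.filter (· ∈ insert i S) = I.filter (· ∈ S) :=
        List.filter_congr fun a ha => by
          have : a ≠ i := fun h => hn (h ▸ List.mem_toFinset.2 ha)
          simp [this]
      have e4 : I.filter (· ∉ insert i S) = I.filter (· ∉ S) :=
        List.filter_congr fun a ha => by
          have : a ≠ i := fun h => hn (h ▸ List.mem_toFinset.2 ha)
          simp [this]
      simp only [List.filter_cons, Finset.mem_insert, true_or, decide_true, if_true, not_true,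
        decide_false, Bool.false_eq_true, if_false] at e3 e4 ⊢
      rw [e3, e4]
    · have e1 : insert i I.toFinset \ S = insert i (I.toFinset \ S) :=
        Finset.insert_sdiff_of_notMem _ hiS
      have e2 : shuffleSign χ S (insert i (I.toFinset \ S)) =
          listSign χ i (I.filter (· ∈ S)) * shuffleSign χ S (I.toFinset \ S) := by
        rw [shuffleSign, Finset.prod_insert (by simp [hn]), shuffleSign]
        congr 1
        have : (I.filter (· ∈ S)).toFinset = S := by
          ext a; simpa using fun h => List.mem_toFinset.1 (hS h)
        rw [listSign, ← List.prod_toFinset _ ((hI.imp fun h => h.ne).filter _), this]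
        exact Finset.prod_congr rfl fun a ha => if_pos (hi a (List.mem_toFinset.1 (hS ha)))
      rw [e1, e2]
      simp only [List.filter_cons, hiS, decide_false, not_false_eq_true, decide_true, if_true,
        Bool.false_eq_true, if_false]
      rw [← mul_smul, mul_comm]

theorem filter_finRange_eq_ofFn {n : ℕ} (S : Finset (Fin n)) :
    (List.finRange n).filter (· ∈ S) = List.ofFn fun i => S.orderEmbOfFin rfl i := by
  refine List.Perm.eq_of_pairwise (le := (· < ·)) ?_ ?_ ?_ ?_
  · intro a b _ _ h h'; exact absurd h h'.asymm
  · exact (List.pairwise_lt_finRange n).filter _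
  · rw [List.pairwise_ofFn]
    intro i j hij
    exact (S.orderEmbOfFin rfl).strictMono hij
  · refine (List.perm_ext_iff_of_nodup ((List.nodup_finRange n).filter _) ?_).2 fun a => ?_
    · exact List.nodup_ofFn.2 (S.orderEmbOfFin rfl).injective
    · have : a ∈ Set.range (S.orderEmbOfFin rfl) ↔ a ∈ S := by simp
      simp only [List.mem_filter, List.mem_finRange, true_and, decide_eq_true_eq, List.mem_ofFn,
        Set.mem_range] at this ⊢
      exact this.symm

/-- The bridge from sums over subsets of `Fin n`, as in `nrComp`, to the recursive sums, for which
associativity and symmetry are short inductions. -/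
theorem sum_finset_eq_shuffleSum {n : ℕ} (x : Fin n → X) (Φ : List X → List X → M) :
    ∑ S : Finset (Fin n), shuffleSign (fun i j => χ (x i) (x j)) S Sᶜ •
      Φ (List.ofFn fun i => x (S.orderEmbOfFin rfl i))
        (List.ofFn fun i => x (Sᶜ.orderEmbOfFin rfl i)) = shuffleSum χ (List.ofFn x) Φ := by
  have h := sum_powerset_eq_shuffleSum (fun i j => χ (x i) (x j)) (List.finRange n)
    (List.pairwise_lt_finRange n) (fun A B => Φ (A.map x) (B.map x))
  rw [← shuffleSum_list_map, ← List.ofFn_eq_map] at h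
  rw [← h, List.toFinset_finRange, Finset.powerset_univ]
  refine Finset.sum_congr rfl fun S _ => ?_
  have e : (List.finRange n).filter (· ∉ S) = List.ofFn fun i => Sᶜ.orderEmbOfFin rfl i := by
    rw [← filter_finRange_eq_ofFn]
    simp
  rw [filter_finRange_eq_ofFn, e, ← Finset.compl_eq_univ_sdiff, List.map_ofFn, List.map_ofFn]
  rfl

end ShuffleSum

/-! ## Graded antisymmetric cochains on lists of homogeneous elements -/

theorem multilinear_eq_of_span {n : ℕ} {g h : Type} [AddCommGroup g] [Module ℝ g] [AddCommGroup h]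
    [Module ℝ h] (f f' : MultilinearMap ℝ (fun _ : Fin n => g) h) (s : Fin n → Set g)
    (hs : ∀ x : Fin n → g, (∀ k, x k ∈ s k) → f x = f' x) (x : Fin n → g)
    (hx : ∀ k, x k ∈ Submodule.span ℝ (s k)) : f x = f' x := by
  -- `T` is the set of places where arbitrary elements of the span are already allowed; it grows by
  -- one place at a time.
  have key : ∀ (T : Finset (Fin n)) (x : Fin n → g), (∀ k ∈ T, x k ∈ Submodule.span ℝ (s k)) →
      (∀ k ∉ T, x k ∈ s k) → f x = f' x := by
    intro T
    induction T using Finset.induction_on with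
    | empty => exact fun x _ h => hs x fun k => h k (by simp)
    | insert k T hk ih =>
      intro x hT hTc
      have : ∀ y ∈ Submodule.span ℝ (s k),
          f (Function.update x k y) = f' (Function.update x k y) := by
        intro y hy
        induction hy using Submodule.span_induction with
        | mem y hy =>
          refine ih _ (fun l hl => ?_) fun l hl => ?_
          · have : l ≠ k := fun h => hk (h ▸ hl)
            rw [Function.update_of_ne this]
            exact hT l (Finset.mem_insert_of_mem hl)
          · by_cases h : l = k
            · subst h; simpa using hy
            · rw [Function.update_of_ne h]
              exact hTc l (by simp [h, hl])
        | zero => rw [f.map_update_zero, f'.map_update_zero]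
        | add y z _ _ hy hz => rw [f.map_update_add, f'.map_update_add, hy, hz]
        | smul c y _ hy => rw [f.map_update_smul, f'.map_update_smul, hy]
      have := this (x k) (hT k (Finset.mem_insert_self k T))
      rwa [Function.update_eq_self] at this
  exact key Finset.univ x (fun k _ => hx k) fun k hk => absurd (Finset.mem_univ k) hk

section Lists

variable {g : Type} [AddCommGroup g] [Module ℝ g] (G : ℤ → Submodule ℝ g)

/-- Homogeneous elements, together with their degree. -/
abbrev Tagged : Type := Σ d : ℤ, G d

variable {G}

/-- The underlying element of a homogeneous element. -/
def tagVal (x : Tagged G) : g := x.2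

theorem tagVal_mem (x : Tagged G) : tagVal x ∈ G x.1 := x.2.2

/-- The commutation factor of graded antisymmetric maps. -/
def tagSign (x y : Tagged G) : ℤˣ := (1 + x.1 * y.1).negOnePow

theorem tagSign_comm (x y : Tagged G) : tagSign x y = tagSign y x := by
  rw [tagSign, tagSign, mul_comm]

theorem tagSign_smul (x y : Tagged G) (z : g) :
    tagSign x y • z = -((x.1 * y.1).negOnePow • z) := by
  rw [tagSign, Int.negOnePow_add, mul_smul]
  simp

/-- The total degree of a list of homogeneous elements. -/
def listDeg (L : List (Tagged G)) : ℤ := (L.map Sigma.fst).sum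

@[simp] theorem listDeg_nil : listDeg ([] : List (Tagged G)) = 0 := rfl

@[simp] theorem listDeg_cons (x : Tagged G) (L : List (Tagged G)) :
    listDeg (x :: L) = x.1 + listDeg L := by simp [listDeg]

@[simp] theorem listDeg_append (L L' : List (Tagged G)) :
    listDeg (L ++ L') = listDeg L + listDeg L' := by simp [listDeg]

theorem listDeg_perm {L L' : List (Tagged G)} (h : L.Perm L') : listDeg L = listDeg L' :=
  (h.map _).sum_eq

theorem listSign_tagSign (x : Tagged G) (A : List (Tagged G)) :
    listSign tagSign x A = ((A.length : ℤ) + x.1 * listDeg A).negOnePow := by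
  induction A with
  | nil => simp
  | cons a A ih =>
    rw [listSign_cons, ih, tagSign, ← Int.negOnePow_add]
    congr 1
    simp only [List.length_cons, listDeg_cons]
    push_cast
    ring

theorem crossSign_tagSign (A B : List (Tagged G)) :
    crossSign tagSign A B =
      ((A.length : ℤ) * B.length + listDeg A * listDeg B).negOnePow := by
  induction A with
  | nil => simp [crossSign]
  | cons a A ih =>
    rw [crossSign_cons_left, ih, listSign_tagSign, ← Int.negOnePow_add]
    congr 1
    simp only [List.length_cons, listDeg_cons]
    push_cast
    ring

/-- The value of a cochain on a list of homogeneous elements. -/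
def evalList (F : Cochain g) (L : List (Tagged G)) : g :=
  F L.length fun i => tagVal (L.get i)

/-- The value of a cochain on a list of elements of which all but the first are homogeneous, as a
linear map in the first one. -/
def evalHead (F : Cochain g) (L : List (Tagged G)) : g →ₗ[ℝ] g where
  toFun y := F (L.length + 1) (Fin.cons y fun i => tagVal (L.get i))
  map_add' y z := (F (L.length + 1)).cons_add _ y z
  map_smul' c y := (F (L.length + 1)).cons_smul _ c y

theorem evalHead_eq (F : Cochain g) (L : List (Tagged G)) (y : Tagged G) :
    evalHead F L (tagVal y) = evalList F (y :: L) := by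
  change F (L.length + 1) _ = F (L.length + 1) _
  congr 1
  funext i
  refine Fin.cases rfl (fun i => rfl) i

theorem evalList_eq (F : Cochain g) {n : ℕ} (L : List (Tagged G)) (h : L.length = n) :
    evalList F L = F n fun i => tagVal (L.get (i.cast h.symm)) := by
  subst h; rfl

theorem evalList_ofFn (F : Cochain g) {n : ℕ} (x : Fin n → Tagged G) :
    evalList F (List.ofFn x) = F n fun i => tagVal (x i) := by
  rw [evalList_eq F _ List.length_ofFn]
  congr 1
  funext i
  simp

theorem evalHead_ofFn (F : Cochain g) {n : ℕ} (x : Fin n → Tagged G) (y : g) :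
    evalHead F (List.ofFn x) y = F (n + 1) (Fin.cons y fun i => tagVal (x i)) := by
  have : ∀ (L : List (Tagged G)) (h : L.length = n), evalHead F L y =
      F (n + 1) (Fin.cons y fun i => tagVal (L.get (i.cast h.symm))) := by
    rintro L rfl; rfl
  rw [this _ List.length_ofFn]
  congr 2
  funext i
  simp

theorem listDeg_ofFn {n : ℕ} (x : Fin n → Tagged G) :
    listDeg (List.ofFn x) = ∑ i, (x i).1 := by
  simp [listDeg, List.map_ofFn, List.sum_ofFn]

variable {F H K : Cochain g} {i j k : ℤ}

theorem evalList_mem (hF : F ∈ ceComp G i) (L : List (Tagged G)) :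
    evalList F L ∈ G (listDeg L + (i - ((L.length : ℤ) - 1))) := by
  have := hF.1 L.length (fun k => (L.get k).1) (fun k => tagVal (L.get k)) fun k => (L.get k).2.2
  rw [← listDeg_ofFn L.get, List.ofFn_get] at this
  exact this

/-- Graded antisymmetry in adjacent arguments, in the form that feeds `shuffleSum_swap`. -/
theorem evalList_swap (hF : F ∈ ceComp G i) (x y : Tagged G) (A B : List (Tagged G)) :
    evalList F (A ++ x :: y :: B) = tagSign x y • evalList F (A ++ y :: x :: B) := by
  have hl : (A ++ x :: y :: B).length = (A ++ y :: x :: B).length := by simp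
  have h0 : A.length < (A ++ y :: x :: B).length := by simp
  have h1 : A.length + 1 < (A ++ y :: x :: B).length := by simp
  have := hF.2 (A ++ y :: x :: B).length ⟨A.length, h0⟩ ⟨A.length + 1, h1⟩ rfl y.1 x.1
    (fun k => tagVal ((A ++ y :: x :: B).get k))
    (by simpa using tagVal_mem y)
    (by simpa [List.getElem_append] using tagVal_mem x)
  rw [tagSign_smul, mul_comm x.1]
  refine Eq.trans ?_ this
  rw [evalList_eq F _ hl]
  congr 1
  funext k
  obtain ⟨k, hk⟩ := k
  simp only [Function.comp_apply]
  by_cases e0 : k = A.length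
  · subst e0
    rw [Equiv.swap_apply_left]
    simp
  by_cases e1 : k = A.length + 1
  · subst e1
    rw [Equiv.swap_apply_right]
    simp
  rw [Equiv.swap_apply_of_ne_of_ne (by simpa using e0) (by simpa using e1)]
  have : (A ++ x :: y :: B)[k]'(hl ▸ hk) = (A ++ y :: x :: B)[k] := by
    simp only [List.getElem_append, List.getElem_cons]
    split_ifs
    · rfl
    · omega
    · omega
    · rfl
  simp only [List.get_eq_getElem, Fin.val_cast, this]

theorem ofFn_swap {X : Type} {n : ℕ} (x : Fin n → X) (i j : Fin n) (hij : (i : ℕ) + 1 = j) :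
    ∃ A B : List X, List.ofFn x = A ++ x i :: x j :: B ∧
      List.ofFn (x ∘ Equiv.swap i j) = A ++ x j :: x i :: B := by
  obtain ⟨j, hj⟩ := j
  obtain ⟨i, hi⟩ := i
  obtain rfl : i + 1 = j := hij
  refine ⟨(List.ofFn x).take i, (List.ofFn x).drop (i + 2), ?_, ?_⟩
  · refine List.ext_getElem (by simp; omega) fun k h1 h2 => ?_
    simp only [List.getElem_append, List.getElem_cons, List.getElem_take, List.getElem_drop,
      List.length_take, List.length_ofFn, List.getElem_ofFn]
    split_ifs <;> congr 2 <;> omega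
  · refine List.ext_getElem (by simp; omega) fun k h1 h2 => ?_
    have hmin : min i n = i := by omega
    simp only [List.getElem_append, List.getElem_cons, List.getElem_take, List.getElem_drop,
      List.length_take, List.length_ofFn, List.getElem_ofFn, Function.comp_apply, hmin]
    have hk : k < n := by simpa using h1
    by_cases e0 : k = i
    · subst e0
      rw [Equiv.swap_apply_left, dif_neg (by omega), dif_pos (by omega)]
    by_cases e1 : k = i + 1
    · subst e1
      rw [Equiv.swap_apply_right, dif_neg (by omega), dif_neg (by omega), dif_pos (by omega)]
    rw [Equiv.swap_apply_of_ne_of_ne (by simpa using e0) (by simpa using e1)]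
    split_ifs <;> first | omega | rfl | (congr 2; omega)

/-- The list version of the homogeneous value of a cochain. -/
def evalTagged (hF : F ∈ ceComp G i) (L : List (Tagged G)) : Tagged G :=
  ⟨listDeg L + (i - ((L.length : ℤ) - 1)), evalList F L, evalList_mem hF L⟩

/-- The inner value is itself homogeneous, so iterated compositions can again be evaluated on lists
of homogeneous elements. -/
theorem evalHead_evalList (hH : H ∈ ceComp G j) (A B : List (Tagged G)) :
    evalHead F B (evalList H A) = evalList F (evalTagged hH A :: B) :=
  evalHead_eq F B (evalTagged hH A)

end Lists

/-! ## The Nijenhuis–Richardson bracket -/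

section NijenhuisRichardson

variable {g : Type} [AddCommGroup g] [Module ℝ g]

/-- The subspaces `G k` span `g`, and `P` is their parity involution. -/
structure IsParityGrading (G : ℤ → Submodule ℝ g) (P : g →ₗ[ℝ] g) : Prop where
  parity : ∀ k : ℤ, ∀ x ∈ G k, P x = k.negOnePow • x
  span : ⨆ k, G k = ⊤

variable {G : ℤ → Submodule ℝ g} {P : g →ₗ[ℝ] g}

theorem IsParityGrading.mem_span (hG : IsParityGrading G P) (x : g) :
    x ∈ Submodule.span ℝ {y : g | ∃ k, y ∈ G k} := by
  have : x ∈ ⨆ k, G k := hG.span ▸ Submodule.mem_top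
  rw [Submodule.iSup_eq_span] at this
  refine Submodule.span_mono ?_ this
  intro y hy
  simpa using hy

theorem cochain_ext (hG : IsParityGrading G P) {F F' : Cochain g}
    (h : ∀ L : List (Tagged G), evalList F L = evalList F' L) : F = F' := by
  funext n
  refine MultilinearMap.ext fun x => multilinear_eq_of_span _ _
    (fun _ => {y : g | ∃ k, y ∈ G k}) (fun x hx => ?_) x fun k => hG.mem_span _
  choose d hd using hx
  have := h (List.ofFn fun i => (⟨d i, x i, hd i⟩ : Tagged G))
  rwa [evalList_ofFn, evalList_ofFn] at this

theorem IsParityGrading.parityPart (hG : IsParityGrading G P) (b : Bool) (x : Tagged G) :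
    parityPart P b (tagVal x) = if b = decide (Odd x.1) then tagVal x else 0 := by
  have h := hG.parity x.1 (tagVal x) x.2.2
  have h2 : (2⁻¹ : ℝ) • tagVal x + (2⁻¹ : ℝ) • tagVal x = tagVal x := by
    rw [← add_smul]; norm_num
  rcases Int.even_or_odd x.1 with hx | hx
  · rw [Int.negOnePow_even _ hx, one_smul] at h
    have hx' : ¬ Odd x.1 := Int.not_odd_iff_even.2 hx
    cases b
    · simp only [LieBialgebroid.parityPart, hx']
      simp [h, h2]
    · simp only [LieBialgebroid.parityPart, hx']
      simp [h]
  · rw [Int.negOnePow_odd _ hx] at h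
    cases b
    · simp only [LieBialgebroid.parityPart, hx]
      simp [h]
    · simp only [LieBialgebroid.parityPart, hx]
      simp [h, h2]

/-- Each inversion contributes `-1` to the signature and `(-1)^(|x||y|)` to the Koszul sign; their
product is the single factor `tagSign`. -/
theorem unshuffleSign_mul_koszulSign {n : ℕ} (S : Finset (Fin n)) (x : Fin n → Tagged G) :
    unshuffleSign S * koszulSign S (fun i => decide (Odd (x i).1)) =
      shuffleSign (fun i j => tagSign (x i) (x j)) S Sᶜ := by
  simp only [unshuffleSign, koszulSign, shuffleSign, ← Finset.prod_mul_distrib]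
  refine Finset.prod_congr rfl fun i _ => Finset.prod_congr rfl fun j _ => ?_
  by_cases hij : i < j
  · simp only [hij, if_true, true_and, decide_eq_true_eq, tagSign, Int.negOnePow_add,
      Int.negOnePow_one]
    congr 1
    split_ifs with h
    · rw [Int.negOnePow_odd _ (h.1.mul h.2)]
    · rw [Int.negOnePow_even]
      rw [← Int.not_odd_iff_even, Int.odd_mul]
      exact h
  · simp [hij]

/-- Of the sum over parity patterns only the pattern of true parities survives on homogeneous
arguments, since any other one projects some argument to zero. -/
theorem evalList_nrComp (hG : IsParityGrading G P) (j : ℤ) (F H : Cochain g)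
    (L : List (Tagged G)) :
    evalList (nrComp P j F H) L = shuffleSum tagSign L fun A B =>
      ((B.length : ℤ) * (j - ((A.length : ℤ) - 1))).negOnePow • evalHead F B (evalList H A) := by
  obtain ⟨n, x, rfl⟩ : ∃ n, ∃ x : Fin n → Tagged G, L = List.ofFn x :=
    ⟨_, L.get, (List.ofFn_get L).symm⟩
  rw [evalList_ofFn, ← sum_finset_eq_shuffleSum, nrComp]
  simp only [sum_apply, smul_apply,
    MultilinearMap.compLinearMap_apply]
  refine Finset.sum_congr rfl fun S _ => ?_
  rw [Finset.sum_eq_single fun i => decide (Odd (x i).1)]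
  · rw [unshuffleSign_mul_koszulSign, mul_smul, List.length_ofFn, List.length_ofFn,
      evalList_ofFn, evalHead_ofFn, insertAt_apply]
    simp only [hG.parityPart, if_true]
  · intro e _ he
    obtain ⟨k, hk⟩ := Function.ne_iff.1 he
    rw [MultilinearMap.map_coord_zero _ k, smul_zero]
    rw [hG.parityPart, if_neg hk]
  · exact fun h => absurd (Finset.mem_univ _) h

theorem shuffleSum_mem {X M : Type} [AddCommGroup M] [Module ℝ M] (χ : X → X → ℤˣ) (L : List X)
    (Φ : List X → List X → M) (p : Submodule ℝ M)
    (h : ∀ A B, (A ++ B).Perm L → Φ A B ∈ p) : shuffleSum χ L Φ ∈ p := by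
  induction L generalizing Φ with
  | nil => exact h [] [] (by simp)
  | cons x L ih =>
    rw [shuffleSum_cons]
    refine add_mem (ih _ fun A B hAB => h _ _ (by simpa using hAB)) (ih _ fun A B hAB => ?_)
    rw [Units.smul_def]
    exact zsmul_mem (h A (x :: B) (List.perm_middle.trans (hAB.cons x))) _

variable {F H K : Cochain g} {i j k : ℤ}

theorem nrComp_mem (hG : IsParityGrading G P) (hF : F ∈ ceComp G i) (hH : H ∈ ceComp G j) :
    nrComp P j F H ∈ ceComp G (i + j) := by
  refine ⟨fun N d x hx => ?_, fun N k l hkl a b x hk hl => ?_⟩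
  · let y : Fin N → Tagged G := fun i => ⟨d i, x i, hx i⟩
    have e := evalList_nrComp hG j F H (List.ofFn y)
    rw [evalList_ofFn] at e
    change nrComp P j F H N x = _ at e
    rw [e]
    refine shuffleSum_mem _ _ _ _ fun A B hAB => ?_
    rw [Units.smul_def]
    refine zsmul_mem ?_ _
    have := evalList_mem hF (evalTagged hH A :: B)
    rw [← evalHead_eq] at this
    -- The blocks share out all arguments, so their lengths add up to `N` and their degrees to `∑
    -- d`; the extra `1` in the length comes from the slot filled by `H`.
    have e' : listDeg (evalTagged hH A :: B) +
        (i - (((evalTagged hH A :: B).length : ℕ) - 1 : ℤ)) =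
          ∑ i, d i + (i + j - ((N : ℤ) - 1)) := ?_
    · rw [← e']; exact this
    have h1 := listDeg_perm hAB
    have h2 := hAB.length_eq
    rw [listDeg_ofFn, listDeg_append] at h1
    rw [List.length_ofFn, List.length_append] at h2
    change _ = ∑ i, d i at h1
    simp only [listDeg_cons, evalTagged, List.length_cons]
    rw [← h1, ← h2]
    push_cast
    ring
  · have hne : k ≠ l := fun h => by subst h; omega
    let f : MultilinearMap ℝ (fun _ : Fin N => g) g :=
      (nrComp P j F H N).domDomCongr (Equiv.swap k l)
    let f' : MultilinearMap ℝ (fun _ : Fin N => g) g :=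
      -((a * b).negOnePow • nrComp P j F H N)
    -- Antisymmetry is required with arbitrary elements in the places other than `k` and `l`. These
    -- are reduced to homogeneous ones by multilinearity, keeping the degrees `a` and `b` in the two
    -- swapped places.
    let s : Fin N → Set g := fun m => if m = k then G a else if m = l then G b else
      {y | ∃ k, y ∈ G k}
    refine multilinear_eq_of_span f f' s (fun x hx => ?_) x fun m => ?_
    · have hxk : x k ∈ G a := by simpa [s] using hx k
      have hxl : x l ∈ G b := by simpa [s, hne.symm] using hx l
      have : ∀ m, ∃ d, x m ∈ G d ∧ (m = k → d = a) ∧ (m = l → d = b) := by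
        intro m
        by_cases h1 : m = k
        · subst h1
          exact ⟨a, hxk, fun _ => rfl, fun h => absurd h hne⟩
        by_cases h2 : m = l
        · subst h2
          exact ⟨b, hxl, fun h => absurd h h1, fun _ => rfl⟩
        · obtain ⟨d, hd⟩ : ∃ k, x m ∈ G k := by simpa [s, h1, h2] using hx m
          exact ⟨d, hd, fun h => absurd h h1, fun h => absurd h h2⟩
      choose d hd hdk hdl using this
      let y : Fin N → Tagged G := fun m => ⟨d m, x m, hd m⟩
      obtain ⟨A, B, e1, e2⟩ := ofFn_swap y k l hkl
      have h1 := evalList_ofFn (nrComp P j F H) y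
      have h2 := evalList_ofFn (nrComp P j F H) (y ∘ Equiv.swap k l)
      have h3 : tagSign (y l) (y k) • evalList (nrComp P j F H) (List.ofFn y) =
          f' x := by
        rw [tagSign_smul, h1, mul_comm]
        change -((d k * d l).negOnePow • nrComp P j F H N x) = _
        rw [hdk k rfl, hdl l rfl]
        rfl
      change nrComp P j F H N (fun m => x (Equiv.swap k l m)) = f' x
      refine h2.symm.trans (Eq.trans ?_ h3)
      rw [e2, e1, evalList_nrComp hG, evalList_nrComp hG]
      refine shuffleSum_swap _ tagSign_comm _ _ _ _ _ (fun C C' D => ?_) fun C D D' => ?_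
      · rw [evalList_swap hH, Units.smul_def (tagSign _ _) (evalList _ _), map_zsmul,
          ← Units.smul_def, smul_comm]
        simp
      · rw [evalHead_evalList hH, evalHead_evalList hH]
        have := evalList_swap hF (y l) (y k) (evalTagged hH C :: D) D'
        simp only [List.cons_append] at this
        rw [this, smul_comm]
        simp
    · by_cases h1 : m = k
      · subst h1
        exact Submodule.subset_span (by simpa [s] using hk)
      by_cases h2 : m = l
      · subst h2
        exact Submodule.subset_span (by simpa [s, h1] using hl)
      · simpa [s, h1, h2] using hG.mem_span (x m)

end NijenhuisRichardson

/-! ## The Lie axioms of the Nijenhuis–Richardson bracket -/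

section NijenhuisRichardson

variable {g : Type} [AddCommGroup g] [Module ℝ g] {G : ℤ → Submodule ℝ g} {P : g →ₗ[ℝ] g}
  {F H K : Cochain g} {i j k : ℤ}

/-- The part of `(F ∘ H) ∘ K` in which the values of `H` and `K` are both arguments of `F`. -/
def parallelComp (F : Cochain g) (hH : H ∈ ceComp G j) (hK : K ∈ ceComp G k)
    (L : List (Tagged G)) : g :=
  shuffleSum tagSign L fun A B => shuffleSum tagSign B fun C D =>
    (((C.length : ℤ) + D.length) * (k - ((A.length : ℤ) - 1)) +
      ((D.length : ℤ) + 1) * (j - ((C.length : ℤ) - 1)) + C.length +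
      (listDeg A + (k - ((A.length : ℤ) - 1))) * listDeg C).negOnePow •
        evalList F (evalTagged hH C :: evalTagged hK A :: D)

/-- The value of `K` is the first argument of `F ∘ H`, and there it is passed either to `H` or
directly to `F`. The first case gives `F ∘ (H ∘ K)`, the second is `parallelComp`. -/
theorem evalList_nrComp_nrComp (hG : IsParityGrading G P) (hH : H ∈ ceComp G j)
    (hK : K ∈ ceComp G k) (L : List (Tagged G)) :
    evalList (nrComp P k (nrComp P j F H) K) L =
      evalList (nrComp P (j + k) F (nrComp P k H K)) L + parallelComp F hH hK L := by
  rw [evalList_nrComp hG, evalList_nrComp hG]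
  simp only [evalList_nrComp hG k H K]
  have e : ∀ A D : List (Tagged G), ∀ u : ℤˣ,
      u • evalHead F D (shuffleSum tagSign A fun B C =>
        ((C.length : ℤ) * (k - ((B.length : ℤ) - 1))).negOnePow • evalHead H C (evalList K B)) =
      shuffleSum tagSign A fun B C => u •
        ((C.length : ℤ) * (k - ((B.length : ℤ) - 1))).negOnePow •
          evalList F (⟨_, evalList H (evalTagged hK B :: C),
            evalList_mem hH (evalTagged hK B :: C)⟩ :: D) := by
    intro A D u
    have := shuffleSum_map tagSign (evalHead F D).toAddMonoidHom A fun B C =>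
        ((C.length : ℤ) * (k - ((B.length : ℤ) - 1))).negOnePow • evalHead H C (evalList K B)
    simp only [LinearMap.toAddMonoidHom_coe] at this
    rw [this, shuffleSum_smul]
    refine shuffleSum_congr _ fun B C _ => ?_
    have h := evalHead_eq F D (⟨_, evalList H (evalTagged hK B :: C),
      evalList_mem hH (evalTagged hK B :: C)⟩ : Tagged G)
    rw [evalHead_evalList hK, Units.smul_def (Int.negOnePow _) (evalList _ _), map_zsmul, ← h]
    rfl
  simp only [e]
  have e2 : (shuffleSum tagSign L fun A D => shuffleSum tagSign A fun B C =>
      ((D.length : ℤ) * (j + k - ((A.length : ℤ) - 1))).negOnePow •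
        ((C.length : ℤ) * (k - ((B.length : ℤ) - 1))).negOnePow •
          evalList F (⟨_, evalList H (evalTagged hK B :: C),
            evalList_mem hH (evalTagged hK B :: C)⟩ :: D)) =
      shuffleSum tagSign L fun A D => shuffleSum tagSign A fun B C =>
      ((D.length : ℤ) * (j + k - ((B.length : ℤ) + C.length - 1))).negOnePow •
        ((C.length : ℤ) * (k - ((B.length : ℤ) - 1))).negOnePow •
          evalList F (⟨_, evalList H (evalTagged hK B :: C),
            evalList_mem hH (evalTagged hK B :: C)⟩ :: D) := by
    refine shuffleSum_congr _ fun A D _ => shuffleSum_congr _ fun B C h => ?_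
    have := h.length_eq
    rw [List.length_append] at this
    rw [← this]
    push_cast
    rfl
  rw [e2, shuffleSum_assoc, parallelComp, ← shuffleSum_add]
  refine shuffleSum_congr _ fun A B hAB => ?_
  -- The value of `K` heads the list to be unshuffled, so the two terms of the recursion are
  -- precisely the nested and the parallel case.
  rw [evalHead_evalList hK, evalList_nrComp hG, shuffleSum_cons, smul_add, shuffleSum_smul,
    shuffleSum_smul]
  congr 1
  · refine shuffleSum_congr _ fun C D h => ?_
    have h := h.length_eq
    rw [List.length_append] at h
    rw [evalHead_evalList hH, ← mul_smul, ← mul_smul, ← Int.negOnePow_add, ← Int.negOnePow_add]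
    congr 1
    rw [Int.negOnePow_eq_iff, ← h]
    push_cast [List.length_cons]
    exact ⟨C.length * 0, by ring⟩
  · refine shuffleSum_congr _ fun C D h => ?_
    have h := h.length_eq
    rw [List.length_append] at h
    rw [evalHead_evalList hH, listSign_tagSign, ← mul_smul, ← mul_smul, ← Int.negOnePow_add,
      ← Int.negOnePow_add]
    congr 1
    rw [Int.negOnePow_eq_iff, ← h]
    push_cast [List.length_cons, evalTagged]
    exact ⟨0, by ring⟩

/-- After reassociation both sides are sums over three blocks. Exchanging the blocks of `H` and `K`
and swapping the two leading arguments of `F` produces signs that combine to `(-1)^(jk)`. -/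
theorem parallelComp_comm (hF : F ∈ ceComp G i) (hH : H ∈ ceComp G j)
    (hK : K ∈ ceComp G k) (L : List (Tagged G)) :
    parallelComp F hH hK L = (j * k).negOnePow • parallelComp F hK hH L := by
  rw [parallelComp, parallelComp, ← shuffleSum_assoc, ← shuffleSum_assoc, shuffleSum_smul]
  refine shuffleSum_congr _ fun A D _ => ?_
  rw [shuffleSum_comm tagSign tagSign_comm A, shuffleSum_smul]
  refine shuffleSum_congr _ fun B C _ => ?_
  have := evalList_swap hF (evalTagged hH B) (evalTagged hK C) [] D
  simp only [List.nil_append] at this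
  rw [this, tagSign, crossSign_tagSign]
  simp only [← mul_smul, ← Int.negOnePow_add]
  congr 1
  rw [Int.negOnePow_eq_iff]
  simp only [evalTagged]
  generalize (B.length : ℤ) = b
  generalize (C.length : ℤ) = c
  generalize (D.length : ℤ) = d
  generalize listDeg B = x
  generalize listDeg C = y
  -- The difference of the sign exponents is a polynomial in seven integers; its evenness depends
  -- only on their parities and is checked case by case.
  simp only [Int.even_sub, Int.even_add, Int.even_mul, Int.not_even_one]
  by_cases h1 : Even b <;> by_cases h2 : Even c <;> by_cases h3 : Even d <;>
    by_cases h4 : Even x <;> by_cases h5 : Even y <;> by_cases h6 : Even j <;>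
    by_cases h7 : Even k <;> simp only [h1, h2, h3, h4, h5, h6, h7] <;> decide

/-- The graded right pre-Lie identity: the associator is the parallel part, which is symmetric in
its last two entries. -/
theorem nrComp_associator (hG : IsParityGrading G P) (hF : F ∈ ceComp G i)
    (hH : H ∈ ceComp G j) (hK : K ∈ ceComp G k) :
    nrComp P k (nrComp P j F H) K - nrComp P (j + k) F (nrComp P k H K) =
      (j * k).negOnePow •
        (nrComp P j (nrComp P k F K) H - nrComp P (j + k) F (nrComp P j K H)) := by
  refine cochain_ext hG fun L => ?_
  have h1 := evalList_nrComp_nrComp (F := F) hG hH hK L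
  have h2 := evalList_nrComp_nrComp (F := F) hG hK hH L
  rw [add_comm k j] at h2
  have e : ∀ F F' : Cochain g, evalList (F - F') L = evalList F L - evalList F' L :=
    fun _ _ => rfl
  have e' : ∀ (u : ℤˣ) (F : Cochain g), evalList (u • F) L = u • evalList F L :=
    fun _ _ => rfl
  rw [e, e', e, h1, h2, add_sub_cancel_left, add_sub_cancel_left]
  exact parallelComp_comm hF hH hK L

theorem insertAt_add_left {n : ℕ} (S : Finset (Fin n))
    (f f' : MultilinearMap ℝ (fun _ : Fin (Sᶜ.card + 1) => g) g)
    (h : MultilinearMap ℝ (fun _ : Fin S.card => g) g) :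
    insertAt S (f + f') h = insertAt S f h + insertAt S f' h := by
  ext x; simp [insertAt_apply]

theorem insertAt_add_right {n : ℕ} (S : Finset (Fin n))
    (f : MultilinearMap ℝ (fun _ : Fin (Sᶜ.card + 1) => g) g)
    (h h' : MultilinearMap ℝ (fun _ : Fin S.card => g) g) :
    insertAt S f (h + h') = insertAt S f h + insertAt S f h' := by
  ext x; simp [insertAt_apply, f.cons_add]

theorem insertAt_smul_left {n : ℕ} (S : Finset (Fin n)) (c : ℝ)
    (f : MultilinearMap ℝ (fun _ : Fin (Sᶜ.card + 1) => g) g)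
    (h : MultilinearMap ℝ (fun _ : Fin S.card => g) g) :
    insertAt S (c • f) h = c • insertAt S f h := by
  ext x; simp [insertAt_apply]

theorem insertAt_smul_right {n : ℕ} (S : Finset (Fin n)) (c : ℝ)
    (f : MultilinearMap ℝ (fun _ : Fin (Sᶜ.card + 1) => g) g)
    (h : MultilinearMap ℝ (fun _ : Fin S.card => g) g) :
    insertAt S f (c • h) = c • insertAt S f h := by
  ext x; simp [insertAt_apply, f.cons_smul]

variable (P) in
/-- The composition of cochains as a bilinear map. -/
def nrCompBilin (j : ℤ) : Cochain g →ₗ[ℝ] Cochain g →ₗ[ℝ] Cochain g :=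
  LinearMap.mk₂ ℝ (nrComp P j)
    (fun F F' H => by
      funext n
      simp only [nrComp, Pi.add_apply, ← Finset.sum_add_distrib, ← smul_add, insertAt_add_left]
      rfl)
    (fun c F H => by
      funext n
      simp only [nrComp, Pi.smul_apply, Finset.smul_sum, smul_comm c, insertAt_smul_left]
      rfl)
    (fun F H H' => by
      funext n
      simp only [nrComp, Pi.add_apply, ← Finset.sum_add_distrib, ← smul_add, insertAt_add_right]
      rfl)
    (fun c F H => by
      funext n
      simp only [nrComp, Pi.smul_apply, Finset.smul_sum, smul_comm c, insertAt_smul_right]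
      rfl)

theorem nrCompBilin_apply (j : ℤ) (F H : Cochain g) : nrCompBilin P j F H = nrComp P j F H := rfl

theorem nrBracket_mem (hG : IsParityGrading G P) (hF : F ∈ ceComp G i) (hH : H ∈ ceComp G j) :
    nrBracket P i j F H ∈ ceComp G (i + j) := by
  refine sub_mem (nrComp_mem hG hF hH) ?_
  rw [Units.smul_def]
  have := nrComp_mem hG hH hF
  rw [add_comm] at this
  exact zsmul_mem this _

theorem nrBracket_add_left (F F' H : Cochain g) :
    nrBracket P i j (F + F') H = nrBracket P i j F H + nrBracket P i j F' H := by
  simp only [nrBracket, ← nrCompBilin_apply, map_add, LinearMap.add_apply, smul_add]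
  abel

theorem nrBracket_smul_left (c : ℝ) (F H : Cochain g) :
    nrBracket P i j (c • F) H = c • nrBracket P i j F H := by
  simp only [nrBracket, ← nrCompBilin_apply, map_smul, LinearMap.smul_apply, smul_sub,
    smul_comm c]

theorem nrBracket_antisymm (F H : Cochain g) :
    nrBracket P i j F H = -((i * j).negOnePow • nrBracket P j i H F) := by
  simp only [nrBracket, smul_sub, ← mul_smul, mul_comm j i, Int.units_mul_self, one_smul, neg_sub]

theorem nrBracket_jacobi (hG : IsParityGrading G P) (hF : F ∈ ceComp G i)
    (hH : H ∈ ceComp G j) (hK : K ∈ ceComp G k) :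
    nrBracket P i (j + k) F (nrBracket P j k H K) =
      nrBracket P (i + j) k (nrBracket P i j F H) K +
        (i * j).negOnePow • nrBracket P j (i + k) H (nrBracket P i k F K) := by
  have a1 := nrComp_associator hG hF hH hK
  have a2 := nrComp_associator hG hH hF hK
  have a3 := nrComp_associator hG hK hF hH
  simp only [← nrCompBilin_apply] at a1 a2 a3
  simp only [nrBracket, ← nrCompBilin_apply, map_sub, LinearMap.sub_apply, mul_add, add_mul,
    Int.negOnePow_add, Units.smul_def, map_zsmul, LinearMap.smul_apply] at a1 a2 a3 ⊢
  have hu : ∀ u : ℤˣ, (u : ℤ) = 1 ∨ (u : ℤ) = -1 := fun u => by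
    rcases Int.units_eq_one_or u with h | h <;> simp [h]
  push_cast
  simp only [mul_comm j i]
  have h1 := hu (i * j).negOnePow
  have h2 := hu (i * k).negOnePow
  have h3 := hu (j * k).negOnePow
  generalize ((i * j).negOnePow : ℤ) = s at *
  generalize ((i * k).negOnePow : ℤ) = t at *
  generalize ((j * k).negOnePow : ℤ) = u at *
  -- Once the three signs are fixed, the Jacobi identity is a combination with coefficients `±1` of
  -- the associator identities with `F`, `H` and `K` in the outer position.
  rcases h1 with rfl | rfl <;> rcases h2 with rfl | rfl <;> rcases h3 with rfl | rfl <;> first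
  | linear_combination (norm := module) (-1 : ℤ) • a1 + (1 : ℤ) • a2 - (1 : ℤ) • a3
  | linear_combination (norm := module) (-1 : ℤ) • a1 + (1 : ℤ) • a2 + (1 : ℤ) • a3
  | linear_combination (norm := module) (-1 : ℤ) • a1 - (1 : ℤ) • a2 - (1 : ℤ) • a3
  | linear_combination (norm := module) (-1 : ℤ) • a1 - (1 : ℤ) • a2 + (1 : ℤ) • a3

end NijenhuisRichardson

/-! ## Tensor powers of a commutative algebra -/

section PiTensor

set_option linter.unusedSectionVars false

variable {ι κ : Type} [Fintype ι] [DecidableEq ι] [Fintype κ] [DecidableEq κ]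
  {C : Type} [CommRing C] [Algebra ℝ C] {B : Type} [CommRing B] [Algebra ℝ B]

/-- The algebra homomorphism from a tensor power induced by homomorphisms of the factors. -/
def piLift (f : ι → C →ₐ[ℝ] B) : (⨂[ℝ] _ : ι, C) →ₐ[ℝ] B :=
  PiTensorProduct.liftAlgHom
    ((MultilinearMap.mkPiAlgebra ℝ ι B).compLinearMap fun i => (f i).toLinearMap)
    (by simp) (fun x y => by simp [Finset.prod_mul_distrib])

@[simp] theorem piLift_tprod (f : ι → C →ₐ[ℝ] B) (c : ι → C) :
    piLift f (PiTensorProduct.tprod ℝ c) = ∏ i, f i (c i) := by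
  simp [piLift, PiTensorProduct.liftAlgHom]

theorem tprod_eq_prod_single (c : ι → C) : PiTensorProduct.tprod ℝ c =
    ∏ i, PiTensorProduct.singleAlgHom (R := ℝ) (A := fun _ : ι => C) i (c i) := by
  have := map_prod (PiTensorProduct.tprodMonoidHom (R := ℝ) (A := fun _ : ι => C))
    (fun i => Pi.mulSingle i (c i)) Finset.univ
  rw [Finset.univ_prod_mulSingle] at this
  exact this

@[simp] theorem piLift_single (f : ι → C →ₐ[ℝ] B) (i : ι) (c : C) :
    piLift f (PiTensorProduct.singleAlgHom i c) = f i c := by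
  rw [show PiTensorProduct.singleAlgHom (R := ℝ) (A := fun _ : ι => C) i c =
    PiTensorProduct.tprod ℝ (Pi.mulSingle i c) from rfl, piLift_tprod,
    Finset.prod_eq_single i]
  · simp
  · intro j _ hj; simp [hj]
  · simp

/-- A derivation acting on the tensor factor `i`. -/
def derivAt (i : ι) (D : Derivation ℝ C C) : Derivation ℝ (⨂[ℝ] _ : ι, C) (⨂[ℝ] _ : ι, C) :=
  Derivation.mk' (PiTensorProduct.map (Function.update (fun _ => LinearMap.id) i D.toLinearMap))
    (by
      have e : ∀ c : ι → C, PiTensorProduct.map (Function.update (fun _ => LinearMap.id) i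
          D.toLinearMap) (PiTensorProduct.tprod ℝ c) =
          PiTensorProduct.tprod ℝ (Function.update c i (D (c i))) := by
        intro c
        rw [PiTensorProduct.map_tprod]
        congr 1
        funext j
        by_cases h : j = i
        · subst h; simp
        · simp [h]
      intro a b
      induction a using PiTensorProduct.induction_on with
      | add a a' ha ha' =>
        rw [add_mul, map_add, map_add, ha, ha']
        simp only [smul_eq_mul]; ring
      | smul_tprod r c =>
        induction b using PiTensorProduct.induction_on with
        | add b b' hb hb' =>
          rw [mul_add, map_add, map_add, hb, hb']
          simp only [smul_eq_mul]; ring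
        | smul_tprod r' c' =>
          simp only [smul_eq_mul, map_smul, smul_mul_assoc, mul_smul_comm,
            PiTensorProduct.tprod_mul_tprod, e]
          rw [smul_comm r r', ← smul_add, ← smul_add]
          congr 2
          have e1 : c * Function.update c' i (D (c' i)) =
              Function.update (c * c') i (c i * D (c' i)) := by
            funext j; by_cases h : j = i
            · subst h; simp
            · simp [h]
          have e2 : c' * Function.update c i (D (c i)) =
              Function.update (c * c') i (c' i * D (c i)) := by
            funext j; by_cases h : j = i
            · subst h; simp
            · simp [h, mul_comm]
          rw [e1, e2, ← MultilinearMap.map_update_add]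
          simp)

theorem derivAt_tprod (i : ι) (D : Derivation ℝ C C) (c : ι → C) :
    derivAt i D (PiTensorProduct.tprod ℝ c) =
      PiTensorProduct.tprod ℝ (Function.update c i (D (c i))) := by
  change PiTensorProduct.map _ _ = _
  rw [PiTensorProduct.map_tprod]
  congr 1
  funext j
  by_cases h : j = i
  · subst h; simp
  · simp [h]

theorem derivAt_single (i k : ι) (D : Derivation ℝ C C) (c : C) :
    derivAt i D (PiTensorProduct.singleAlgHom k c) =
      if k = i then PiTensorProduct.singleAlgHom i (D c) else 0 := by
  rw [show PiTensorProduct.singleAlgHom (R := ℝ) (A := fun _ : ι => C) k c =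
    PiTensorProduct.tprod ℝ (Pi.mulSingle k c) from rfl, derivAt_tprod]
  split_ifs with h
  · subst h
    change _ = PiTensorProduct.tprod ℝ (Pi.mulSingle k (D c) : ι → C)
    congr 1
    funext j
    by_cases h : j = k
    · subst h; simp
    · simp [h]
  · refine MultilinearMap.map_coord_zero _ i ?_
    have : i ≠ k := fun h' => h h'.symm
    simp [this]

/-- The elements supported in one tensor factor generate the algebra, and a derivation along a
homomorphism is determined by its values on generators. -/
theorem derivation_along_ext (h : (⨂[ℝ] _ : ι, C) →ₐ[ℝ] B)
    (d d' : (⨂[ℝ] _ : ι, C) →ₗ[ℝ] B)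
    (hd : ∀ a b, d (a * b) = d a * h b + h a * d b)
    (hd' : ∀ a b, d' (a * b) = d' a * h b + h a * d' b)
    (hs : ∀ (i : ι) (c : C), d (PiTensorProduct.singleAlgHom i c) =
      d' (PiTensorProduct.singleAlgHom i c)) : d = d' := by
  have h1 : ∀ e : (⨂[ℝ] _ : ι, C) →ₗ[ℝ] B,
      (∀ a b, e (a * b) = e a * h b + h a * e b) → e 1 = 0 := by
    intro e he
    have := he 1 1
    simpa using this
  refine PiTensorProduct.ext (MultilinearMap.ext fun c => ?_)
  simp only [LinearMap.compMultilinearMap_apply, tprod_eq_prod_single]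
  induction (Finset.univ : Finset ι) using Finset.induction_on with
  | empty => rw [Finset.prod_empty, h1 d hd, h1 d' hd']
  | insert i T hi ih => rw [Finset.prod_insert hi, hd, hd', hs, ih]

/-- Contracting along `π` multiplies the factors of each fibre, so a derivation of the factor `k`
distributes over the fibre. Both sides are derivations along the contraction and agree on
generators. -/
theorem derivAt_piLift (π : ι → κ) (k : κ) (D : Derivation ℝ C C) (a : ⨂[ℝ] _ : ι, C) :
    derivAt k D (piLift (fun i => PiTensorProduct.singleAlgHom (R := ℝ) (A := fun _ => C) (π i)) a)
      = ∑ i with π i = k,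
        piLift (fun i => PiTensorProduct.singleAlgHom (R := ℝ) (A := fun _ => C) (π i))
          (derivAt i D a) := by
  set h := piLift (fun i => PiTensorProduct.singleAlgHom (R := ℝ) (A := fun _ => C) (π i))
  have := derivation_along_ext h ((derivAt k D).toLinearMap ∘ₗ h.toLinearMap)
    (∑ i with π i = k, h.toLinearMap ∘ₗ (derivAt i D).toLinearMap)
    (fun a b => by simp; ring) (fun a b => by
      simp only [LinearMap.sum_apply, LinearMap.comp_apply, Finset.sum_mul, Finset.mul_sum,
        ← Finset.sum_add_distrib]
      refine Finset.sum_congr rfl fun i _ => ?_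
      simp; ring)
    (fun i c => by
      simp only [LinearMap.sum_apply, LinearMap.comp_apply]
      change derivAt k D (h (PiTensorProduct.singleAlgHom i c)) =
        ∑ i' with π i' = k, h (derivAt i' D (PiTensorProduct.singleAlgHom i c))
      simp only [derivAt_single, apply_ite h, map_zero]
      rw [Finset.sum_ite_eq]
      simp only [h, piLift_single, derivAt_single, Finset.mem_filter, Finset.mem_univ, true_and]
      split_ifs with hik
      · rw [hik]
      · rfl)
  have := LinearMap.congr_fun this a
  simpa using this

theorem derivAt_comm (i j : ι) (D D' : Derivation ℝ C C) (h : ∀ c, D (D' c) = D' (D c))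
    (a : ⨂[ℝ] _ : ι, C) : derivAt i D (derivAt j D' a) = derivAt j D' (derivAt i D a) := by
  induction a using PiTensorProduct.induction_on with
  | add a b ha hb => simp only [map_add, ha, hb]
  | smul_tprod r c =>
    simp only [Derivation.map_smul, derivAt_tprod]
    congr 2
    by_cases hij : i = j
    · subst hij; simp [h]
    · rw [Function.update_of_ne hij, Function.update_of_ne (Ne.symm hij),
        Function.update_comm hij]

end PiTensor

/-! ## Exterior algebras -/

section Exterior

variable {W W' : Type} [AddCommGroup W] [Module ℝ W] [AddCommGroup W'] [Module ℝ W']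

/-- The contraction of the exterior algebra with a linear form. -/
def contr (φ : Module.Dual ℝ W) : ExteriorAlgebra ℝ W →ₗ[ℝ] ExteriorAlgebra ℝ W :=
  CliffordAlgebra.contractLeft (Q := (0 : QuadraticForm ℝ W)) φ

/-- The parity involution of the exterior algebra. -/
def invol : ExteriorAlgebra ℝ W →ₐ[ℝ] ExteriorAlgebra ℝ W :=
  CliffordAlgebra.involute (Q := (0 : QuadraticForm ℝ W))

theorem exterior_induction {p : ExteriorAlgebra ℝ W → Prop}
    (algebraMap : ∀ c, p (algebraMap ℝ _ c)) (add : ∀ x y, p x → p y → p (x + y))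
    (ι_mul : ∀ x v, p x → p (ExteriorAlgebra.ι ℝ v * x)) (x : ExteriorAlgebra ℝ W) : p x :=
  CliffordAlgebra.left_induction (Q := (0 : QuadraticForm ℝ W)) algebraMap add ι_mul x

@[simp] theorem contr_algebraMap (φ : Module.Dual ℝ W) (c : ℝ) :
    contr φ (algebraMap ℝ _ c) = 0 :=
  CliffordAlgebra.contractLeft_algebraMap (Q := (0 : QuadraticForm ℝ W)) φ c

theorem contr_ι_mul (φ : Module.Dual ℝ W) (v : W) (x : ExteriorAlgebra ℝ W) :
    contr φ (ExteriorAlgebra.ι ℝ v * x) = φ v • x - ExteriorAlgebra.ι ℝ v * contr φ x :=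
  CliffordAlgebra.contractLeft_ι_mul (Q := (0 : QuadraticForm ℝ W)) φ v x

@[simp] theorem invol_ι (v : W) : invol (ExteriorAlgebra.ι ℝ v) = -ExteriorAlgebra.ι ℝ v :=
  CliffordAlgebra.involute_ι (Q := (0 : QuadraticForm ℝ W)) v

theorem contr_mul (φ : Module.Dual ℝ W) (x y : ExteriorAlgebra ℝ W) :
    contr φ (x * y) = contr φ x * y + invol x * contr φ y := by
  induction x using exterior_induction with
  | algebraMap c =>
    rw [contr_algebraMap, zero_mul, zero_add, AlgHom.commutes, ← Algebra.smul_def,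
      ← Algebra.smul_def, map_smul]
  | add x x' hx hx' => simp only [add_mul, map_add, hx, hx']; abel
  | ι_mul x v hx =>
    rw [mul_assoc, contr_ι_mul, hx, contr_ι_mul, map_mul, invol_ι]
    simp only [mul_add, sub_mul, smul_mul_assoc, neg_mul, mul_assoc]
    abel

theorem contr_comm (φ ψ : Module.Dual ℝ W) (x : ExteriorAlgebra ℝ W) :
    contr φ (contr ψ x) = -contr ψ (contr φ x) :=
  CliffordAlgebra.contractLeft_comm (Q := (0 : QuadraticForm ℝ W)) φ ψ x

theorem contr_map (f : W →ₗ[ℝ] W') (φ : Module.Dual ℝ W') (x : ExteriorAlgebra ℝ W) :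
    contr φ (ExteriorAlgebra.map f x) = ExteriorAlgebra.map f (contr (φ ∘ₗ f) x) := by
  induction x using exterior_induction with
  | algebraMap c => rw [AlgHom.commutes, contr_algebraMap, contr_algebraMap, map_zero]
  | add x x' hx hx' => simp only [map_add, hx, hx']
  | ι_mul x v hx =>
    rw [map_mul, ExteriorAlgebra.map_apply_ι, contr_ι_mul, contr_ι_mul, hx, map_sub, map_smul,
      map_mul, ExteriorAlgebra.map_apply_ι]
    rfl

theorem contr_add (φ ψ : Module.Dual ℝ W) (x : ExteriorAlgebra ℝ W) :
    contr (φ + ψ) x = contr φ x + contr ψ x := by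
  simp [contr]

theorem contr_zero (x : ExteriorAlgebra ℝ W) :
    contr (0 : Module.Dual ℝ W) x = 0 := by
  simp [contr]

theorem contr_sum {ι : Type} (s : Finset ι) (φ : ι → Module.Dual ℝ W) (x : ExteriorAlgebra ℝ W) :
    contr (∑ i ∈ s, φ i) x = ∑ i ∈ s, contr (φ i) x := by
  classical
  induction s using Finset.induction_on with
  | empty => simp [contr_zero]
  | insert i s hi ih => rw [Finset.sum_insert hi, Finset.sum_insert hi, contr_add, ih]

theorem invol_map (f : W →ₗ[ℝ] W') (x : ExteriorAlgebra ℝ W) :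
    invol (ExteriorAlgebra.map f x) = ExteriorAlgebra.map f (invol x) := by
  have : (invol (W := W')).comp (ExteriorAlgebra.map f) = (ExteriorAlgebra.map f).comp invol := by
    refine ExteriorAlgebra.hom_ext (LinearMap.ext fun v => ?_)
    simp
  exact DFunLike.congr_fun this x

theorem invol_invol (x : ExteriorAlgebra ℝ W) : invol (invol x) = x :=
  CliffordAlgebra.involute_involute (Q := (0 : QuadraticForm ℝ W)) x

theorem ι_mul_comm (v : W) (x : ExteriorAlgebra ℝ W) :
    ExteriorAlgebra.ι ℝ v * x = invol x * ExteriorAlgebra.ι ℝ v := by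
  induction x using exterior_induction with
  | algebraMap c => rw [AlgHom.commutes, Algebra.commutes]
  | add x x' hx hx' => simp only [mul_add, map_add, add_mul, hx, hx']
  | ι_mul x w hx =>
    have h : ExteriorAlgebra.ι ℝ v * ExteriorAlgebra.ι ℝ w =
        -(ExteriorAlgebra.ι ℝ w * ExteriorAlgebra.ι ℝ v) :=
      eq_neg_of_add_eq_zero_left (ExteriorAlgebra.ι_add_mul_swap v w)
    rw [← mul_assoc, h, neg_mul, mul_assoc, hx, map_mul, invol_ι, neg_mul, neg_mul, mul_assoc]

theorem mul_comm_of_even {y : ExteriorAlgebra ℝ W} (hy : invol y = y) (x : ExteriorAlgebra ℝ W) :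
    x * y = y * x := by
  induction x using exterior_induction with
  | algebraMap c => exact Algebra.commutes _ _
  | add x x' hx hx' => simp only [mul_add, add_mul, hx, hx']
  | ι_mul x v hx => rw [mul_assoc, hx, ← mul_assoc, ι_mul_comm, hy, mul_assoc]

theorem mul_comm_of_odd {y : ExteriorAlgebra ℝ W} (hy : invol y = -y) (x : ExteriorAlgebra ℝ W) :
    x * y = y * invol x := by
  induction x using exterior_induction with
  | algebraMap c => rw [AlgHom.commutes, Algebra.commutes]
  | add x x' hx hx' => simp only [mul_add, map_add, add_mul, hx, hx']
  | ι_mul x v hx =>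
    rw [mul_assoc, hx, ← mul_assoc, ι_mul_comm, hy, map_mul, invol_ι]
    simp only [neg_mul, mul_neg, mul_assoc]

end Exterior

/-! ## Super algebras -/

section SuperAlg

/-- The supercommutative algebra of polynomials in odd coordinates with coefficients in `B`. -/
abbrev SuperAlg (B U : Type) [CommRing B] [Algebra ℝ B] [AddCommGroup U] [Module ℝ U] : Type :=
  B ⊗[ℝ] ExteriorAlgebra ℝ U

/-- Even derivations of the coefficients, and odd derivatives with respect to odd coordinates. -/
inductive SiteOp (B U : Type) [CommRing B] [Algebra ℝ B] [AddCommGroup U] [Module ℝ U] : Type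
  | even (D : Derivation ℝ B B)
  | odd (φ : Module.Dual ℝ U)

variable {B B' B'' U U' U'' : Type} [CommRing B] [Algebra ℝ B] [AddCommGroup U] [Module ℝ U]
  [CommRing B'] [Algebra ℝ B'] [AddCommGroup U'] [Module ℝ U']
  [CommRing B''] [Algebra ℝ B''] [AddCommGroup U''] [Module ℝ U'']

/-- The parity involution. -/
def sparity : SuperAlg B U →ₐ[ℝ] SuperAlg B U :=
  Algebra.TensorProduct.map (AlgHom.id ℝ B) invol

@[simp] theorem sparity_tmul (b : B) (w : ExteriorAlgebra ℝ U) :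
    sparity (b ⊗ₜ[ℝ] w) = b ⊗ₜ[ℝ] invol w := rfl

/-- The action of a derivation on a super algebra. -/
def SiteOp.act : SiteOp B U → Module.End ℝ (SuperAlg B U)
  | .even D => TensorProduct.map D.toLinearMap LinearMap.id
  | .odd φ => TensorProduct.map LinearMap.id (contr φ)

@[simp] theorem act_even (D : Derivation ℝ B B) (b : B) (w : ExteriorAlgebra ℝ U) :
    (SiteOp.even (U := U) D).act (b ⊗ₜ[ℝ] w) = D b ⊗ₜ[ℝ] w := rfl

@[simp] theorem act_odd (φ : Module.Dual ℝ U) (b : B) (w : ExteriorAlgebra ℝ U) :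
    (SiteOp.odd (B := B) φ).act (b ⊗ₜ[ℝ] w) = b ⊗ₜ[ℝ] contr φ w := rfl

/-- The automorphism that appears in the Leibniz rule. -/
def SiteOp.twist : SiteOp B U → SuperAlg B U →ₐ[ℝ] SuperAlg B U
  | .even _ => AlgHom.id ℝ _
  | .odd _ => sparity

/-- Whether a derivation is odd. -/
def SiteOp.isOdd : SiteOp B U → Bool
  | .even _ => false
  | .odd _ => true

theorem superAlg_induction {p : SuperAlg B U → Prop} (add : ∀ x y, p x → p y → p (x + y))
    (tmul : ∀ b w, p (b ⊗ₜ[ℝ] w)) (x : SuperAlg B U) : p x := by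
  induction x using TensorProduct.induction_on with
  | zero => simpa using tmul 0 0
  | tmul b w => exact tmul b w
  | add x y hx hy => exact add x y hx hy

theorem SiteOp.act_mul (o : SiteOp B U) (x y : SuperAlg B U) :
    o.act (x * y) = o.act x * y + o.twist x * o.act y := by
  induction x using superAlg_induction with
  | add x x' hx hx' => simp only [add_mul, map_add, hx, hx']; abel
  | tmul b w =>
    induction y using superAlg_induction with
    | add y y' hy hy' => simp only [mul_add, map_add, hy, hy']; abel
    | tmul b' w' =>
      cases o with
      | even D =>
        simp only [Algebra.TensorProduct.tmul_mul_tmul, act_even, SiteOp.twist, AlgHom.id_apply,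
          Derivation.leibniz, smul_eq_mul, TensorProduct.add_tmul]
        rw [add_comm, mul_comm b' (D b)]
      | odd φ =>
        simp only [Algebra.TensorProduct.tmul_mul_tmul, act_odd, SiteOp.twist, sparity_tmul,
          contr_mul, TensorProduct.tmul_add]

theorem SiteOp.act_one (o : SiteOp B U) : o.act 1 = 0 := by
  have := o.act_mul 1 1
  simpa using this

theorem sparity_sparity (x : SuperAlg B U) : sparity (sparity x) = x := by
  induction x using superAlg_induction with
  | add x x' hx hx' => simp only [map_add, hx, hx']
  | tmul b w => rw [sparity_tmul, sparity_tmul, invol_invol]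

theorem super_mul_comm (x y : SuperAlg B U) (b : Bool)
    (hy : sparity y = if b then -y else y) :
    x * y = y * (if b then sparity x else x) := by
  -- A homogeneous `y` is half of `y ± sparity y`. This expression is linear in an arbitrary `y`, so
  -- the claim can be checked on pure tensors, whether homogeneous or not.
  have key : ∀ (w : ExteriorAlgebra ℝ U) (c : B) (y : SuperAlg B U),
      (c ⊗ₜ[ℝ] w) * (y + (if b then (-1 : ℝ) else 1) • sparity y) =
        (y + (if b then (-1 : ℝ) else 1) • sparity y) *
          (c ⊗ₜ[ℝ] (if b then invol w else w)) := by
    intro w c y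
    induction y using superAlg_induction with
    | add y y' hy hy' =>
      have e : ∀ s : ℝ, y + y' + s • sparity (y + y') =
          (y + s • sparity y) + (y' + s • sparity y') := fun s => by
        rw [map_add, smul_add]; abel
      rw [e, mul_add, add_mul, hy, hy']
    | tmul c' w' =>
      rw [sparity_tmul, ← TensorProduct.tmul_smul, ← TensorProduct.tmul_add,
        Algebra.TensorProduct.tmul_mul_tmul, Algebra.TensorProduct.tmul_mul_tmul, mul_comm c]
      congr 1
      cases b
      · simp only [Bool.false_eq_true, if_false, one_smul]
        exact mul_comm_of_even (by rw [map_add, invol_invol, add_comm]) w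
      · simp only [if_true]
        exact mul_comm_of_odd (by
          rw [map_add, map_smul, invol_invol, neg_add, neg_smul, neg_smul, one_smul, one_smul,
            neg_neg, add_comm]) w
  have hy' : y = (2⁻¹ : ℝ) • (y + (if b then (-1 : ℝ) else 1) • sparity y) := by
    rw [hy]
    have h2 : (2⁻¹ : ℝ) • y + (2⁻¹ : ℝ) • y = y := by rw [← add_smul]; norm_num
    cases b <;> simp [h2]
  induction x using superAlg_induction with
  | add x x' hx hx' =>
    rw [add_mul, hx, hx', ← mul_add]
    split_ifs <;> simp
  | tmul c w =>
    rw [hy', mul_smul_comm, key, smul_mul_assoc]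
    split_ifs <;> simp

/-- The homomorphism of super algebras induced by a homomorphism of the coefficients and a linear
map of the odd coordinates. -/
def superMap (f : B →ₐ[ℝ] B') (h : U →ₗ[ℝ] U') : SuperAlg B U →ₐ[ℝ] SuperAlg B' U' :=
  Algebra.TensorProduct.map f (ExteriorAlgebra.map h)

@[simp] theorem superMap_tmul (f : B →ₐ[ℝ] B') (h : U →ₗ[ℝ] U') (b : B)
    (w : ExteriorAlgebra ℝ U) :
    superMap f h (b ⊗ₜ[ℝ] w) = f b ⊗ₜ[ℝ] ExteriorAlgebra.map h w := rfl

theorem superMap_superMap (f : B →ₐ[ℝ] B') (h : U →ₗ[ℝ] U') (f' : B' →ₐ[ℝ] B'')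
    (h' : U' →ₗ[ℝ] U'') (x : SuperAlg B U) :
    superMap f' h' (superMap f h x) = superMap (f'.comp f) (h' ∘ₗ h) x := by
  induction x using superAlg_induction with
  | add x x' hx hx' => simp only [map_add, hx, hx']
  | tmul b w =>
    rw [superMap_tmul, superMap_tmul, superMap_tmul, ← ExteriorAlgebra.map_comp_map]
    rfl

theorem superMap_id (x : SuperAlg B U) : superMap (AlgHom.id ℝ B) LinearMap.id x = x := by
  rw [superMap, ExteriorAlgebra.map_id, Algebra.TensorProduct.map_id]
  rfl

theorem sparity_superMap (f : B →ₐ[ℝ] B') (h : U →ₗ[ℝ] U') (x : SuperAlg B U) :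
    sparity (superMap f h x) = superMap f h (sparity x) := by
  induction x using superAlg_induction with
  | add x x' hx hx' => simp only [map_add, hx, hx']
  | tmul b w => rw [superMap_tmul, sparity_tmul, sparity_tmul, superMap_tmul, invol_map]

/-- The commutation condition on a pair of derivations (odd derivatives always anticommute). -/
def SiteOp.Compatible : SiteOp B U → SiteOp B U → Prop
  | .even D, .even D' => ∀ b, D (D' b) = D' (D b)
  | _, _ => True

theorem SiteOp.act_comm (o o' : SiteOp B U) (h : o.Compatible o') :
    o.act * o'.act = (if o.isOdd && o'.isOdd then (-1 : ℤˣ) else 1) • (o'.act * o.act) := by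
  refine LinearMap.ext fun x => ?_
  induction x using superAlg_induction with
  | add x x' hx hx' => simp only [map_add, hx, hx']
  | tmul b w =>
    cases o <;> cases o'
    · rename_i D D'
      simp only [isOdd, Bool.and_self, Bool.false_eq_true, if_false, one_smul, Module.End.mul_apply,
        act_even]
      rw [h b]
    · simp [isOdd]
    · simp [isOdd]
    · simp only [isOdd, Bool.and_self, if_true, Module.End.mul_apply, act_odd,
        LinearMap.smul_apply]
      rw [contr_comm, TensorProduct.tmul_neg, Units.smul_def]
      simp

end SuperAlg

/-! ## Tensor powers of super algebras -/

section TensorAlg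

set_option linter.unusedSectionVars false

variable {ι κ ν : Type} [Fintype ι] [DecidableEq ι] [Fintype κ] [DecidableEq κ] [Fintype ν]
  [DecidableEq ν] {C : Type} [CommRing C] [Algebra ℝ C] {W : Type} [AddCommGroup W] [Module ℝ W]

variable (ι C W) in
/-- The tensor power of a super algebra. -/
abbrev TensorAlg : Type := SuperAlg (⨂[ℝ] _ : ι, C) (ι → W)

/-- A derivation acting on the tensor factor `i`. -/
def SiteOp.at (i : ι) : SiteOp C W → SiteOp (⨂[ℝ] _ : ι, C) (ι → W)
  | .even D => .even (derivAt i D)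
  | .odd φ => .odd (φ ∘ₗ LinearMap.proj i)

@[simp] theorem SiteOp.isOdd_at (i : ι) (o : SiteOp C W) : (o.at i).isOdd = o.isOdd := by
  cases o <;> rfl

theorem SiteOp.compatible_at (i j : ι) {o o' : SiteOp C W} (h : o.Compatible o') :
    (o.at i).Compatible (o'.at j) := by
  cases o <;> cases o'
  · exact derivAt_comm i j _ _ h
  all_goals trivial

/-- The sum of the coordinates over the fibres of a map. -/
def pushCoord (W : Type) [AddCommGroup W] [Module ℝ W] (π : ι → κ) : (ι → W) →ₗ[ℝ] (κ → W) :=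
  LinearMap.pi fun k => ∑ i with π i = k, LinearMap.proj i

theorem pushCoord_single (π : ι → κ) (i : ι) (w : W) :
    pushCoord W π (Pi.single i w) = Pi.single (π i) w := by
  funext k
  simp only [pushCoord, LinearMap.pi_apply, LinearMap.sum_apply, LinearMap.proj_apply,
    Pi.single_apply, Finset.sum_ite_eq', Finset.mem_filter, Finset.mem_univ, true_and]
  simp [eq_comm]

variable (C W) in
/-- The homomorphism of tensor powers induced by a map of the index sets. -/
def push (π : ι → κ) : TensorAlg ι C W →ₐ[ℝ] TensorAlg κ C W :=
  superMap (piLift fun i => PiTensorProduct.singleAlgHom (R := ℝ) (A := fun _ => C) (π i))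
    (pushCoord W π)

variable (C W) in
/-- The inclusion of the tensor factor `i`. -/
def incl (i : ι) : SuperAlg C W →ₐ[ℝ] TensorAlg ι C W :=
  superMap (PiTensorProduct.singleAlgHom (R := ℝ) (A := fun _ => C) i) (LinearMap.single ℝ (fun _ => W) i)

variable (ι C W) in
/-- The multiplication of all tensor factors. -/
def mulAll : TensorAlg ι C W →ₐ[ℝ] SuperAlg C W :=
  superMap (piLift fun _ => AlgHom.id ℝ C) (∑ i, LinearMap.proj i)

theorem piHom_ext {B : Type} [CommRing B] [Algebra ℝ B] {f f' : (⨂[ℝ] _ : ι, C) →ₐ[ℝ] B}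
    (h : ∀ (i : ι) (c : C), f (PiTensorProduct.singleAlgHom i c) =
      f' (PiTensorProduct.singleAlgHom i c)) : f = f' :=
  PiTensorProduct.algHom_ext fun i => AlgHom.ext fun c => h i c

theorem push_incl (π : ι → κ) (i : ι) (x : SuperAlg C W) :
    push C W π (incl C W i x) = incl C W (π i) x := by
  rw [push, incl, superMap_superMap, incl]
  congr 1
  · congr 1
    · ext c; simp only [AlgHom.comp_apply, piLift_single]
    · ext w : 1
      exact pushCoord_single π i w

theorem mulAll_incl (i : ι) (x : SuperAlg C W) : mulAll ι C W (incl C W i x) = x := by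
  rw [mulAll, incl, superMap_superMap]
  conv_rhs => rw [← superMap_id x]
  congr 1
  · congr 1
    · ext c; simp only [AlgHom.comp_apply, piLift_single]
    · ext w : 1
      simp [Pi.single_apply]

theorem linearMap_pi_ext {V' : Type} [AddCommGroup V'] [Module ℝ V'] {f f' : (ι → W) →ₗ[ℝ] V'}
    (h : ∀ i w, f (Pi.single i w) = f' (Pi.single i w)) : f = f' :=
  LinearMap.pi_ext h

theorem mulAll_push (π : ι → κ) (x : TensorAlg ι C W) : mulAll κ C W (push C W π x) =
    mulAll ι C W x := by
  rw [mulAll, push, superMap_superMap, mulAll]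
  congr 1
  · congr 1
    · exact piHom_ext fun i c => by simp only [AlgHom.comp_apply, piLift_single]
    · refine linearMap_pi_ext fun i w => ?_
      rw [LinearMap.comp_apply, pushCoord_single]
      simp [Pi.single_apply]

theorem push_push (π : ι → κ) (π' : κ → ν) (x : TensorAlg ι C W) :
    push C W π' (push C W π x) = push C W (π' ∘ π) x := by
  rw [push, push, superMap_superMap, push]
  congr 1
  · congr 1
    · exact piHom_ext fun i c => by simp only [AlgHom.comp_apply, piLift_single, Function.comp]
    · refine linearMap_pi_ext fun i w => ?_
      rw [LinearMap.comp_apply, pushCoord_single, pushCoord_single, pushCoord_single]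
      rfl

/-- Contracting all factors to one place amounts to multiplying them; in this way the product formed
by an inserted graph becomes one argument of the outer graph. -/
theorem push_const (k : κ) (x : TensorAlg ι C W) :
    push C W (fun _ => k) x = incl C W k (mulAll ι C W x) := by
  rw [push, mulAll, incl, superMap_superMap]
  congr 1
  · congr 1
    · exact piHom_ext fun i c => by simp only [AlgHom.comp_apply, piLift_single, AlgHom.id_apply]
    · refine linearMap_pi_ext fun i w => ?_
      rw [LinearMap.comp_apply, pushCoord_single]
      simp [Pi.single_apply]

theorem sparity_incl (i : ι) (x : SuperAlg C W) :
    sparity (incl C W i x) = incl C W i (sparity x) := sparity_superMap _ _ _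

theorem twist_incl (o : SiteOp C W) (i k : ι) (x : SuperAlg C W) :
    (o.at i).twist (incl C W k x) = incl C W k (o.twist x) := by
  cases o
  · rfl
  · exact sparity_incl k x

/-- The Leibniz rule for contraction of tensor factors, for even and odd derivatives alike. It is
the analytic counterpart of reconnecting an edge end at `k` to all the vertices that replace `k`. -/
theorem act_push (π : ι → κ) (k : κ) (o : SiteOp C W) (x : TensorAlg ι C W) :
    (o.at k).act (push C W π x) = ∑ i with π i = k, push C W π ((o.at i).act x) := by
  induction x using superAlg_induction with
  | add x x' hx hx' => simp only [map_add, hx, hx', Finset.sum_add_distrib]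
  | tmul c w =>
    cases o with
    | even D =>
      simp only [push, superMap_tmul, SiteOp.at, act_even, derivAt_piLift,
        TensorProduct.sum_tmul]
    | odd φ =>
      simp only [push, superMap_tmul, SiteOp.at, act_odd, contr_map, ← TensorProduct.tmul_sum]
      have h : (φ ∘ₗ LinearMap.proj k) ∘ₗ pushCoord W π =
          ∑ i with π i = k, φ ∘ₗ LinearMap.proj i := by
        refine LinearMap.ext fun w => ?_
        simp [pushCoord]
      rw [← map_sum, ← contr_sum, h]

theorem act_incl (i k : ι) (o : SiteOp C W) (x : SuperAlg C W) :
    (o.at i).act (incl C W k x) = if k = i then incl C W i (o.act x) else 0 := by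
  induction x using superAlg_induction with
  | add x x' hx hx' =>
    simp only [map_add, hx, hx']
    split_ifs <;> simp
  | tmul c w =>
    cases o with
    | even D =>
      simp only [incl, superMap_tmul, SiteOp.at, act_even, derivAt_single]
      split_ifs with h
      · rw [h]
      · simp
    | odd φ =>
      simp only [incl, superMap_tmul, SiteOp.at, act_odd, contr_map]
      split_ifs with h
      · subst h
        congr 4
        refine LinearMap.ext fun w => ?_
        simp
      · have : (φ ∘ₗ LinearMap.proj i) ∘ₗ LinearMap.single ℝ (fun _ : ι => W) k = 0 := by
          refine LinearMap.ext fun w => ?_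
          have : i ≠ k := fun h' => h h'.symm
          simp [this]
        rw [this, contr_zero, map_zero, TensorProduct.tmul_zero]

end TensorAlg

/-! ## The action of graphs on super algebras -/

section CommAeval

variable {σ A : Type} [Ring A] [Algebra ℝ A]

/-- The evaluation of a polynomial at commuting elements of a noncommutative algebra. -/
def commAeval (f : σ → A) (h : ∀ i j, f i * f j = f j * f i) : MvPolynomial σ ℝ →ₐ[ℝ] A :=
  -- Polynomial evaluation needs a commutative target; the subalgebra generated by the commuting
  -- elements provides one.
  letI : CommSemiring (Algebra.adjoin ℝ (Set.range f)) :=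
    { (Algebra.adjoin ℝ (Set.range f)).toSemiring with
      mul_comm := (Algebra.isMulCommutative_adjoin ℝ
        (by rintro _ ⟨i, rfl⟩ _ ⟨j, rfl⟩; exact h i j)).is_comm.comm }
  (Algebra.adjoin ℝ (Set.range f)).val.comp
    (MvPolynomial.aeval fun i => (⟨f i, Algebra.subset_adjoin ⟨i, rfl⟩⟩ :
      Algebra.adjoin ℝ (Set.range f)))

@[simp] theorem commAeval_X (f : σ → A) (h : ∀ i j, f i * f j = f j * f i) (i : σ) :
    commAeval f h (MvPolynomial.X i) = f i := by
  simp [commAeval]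

end CommAeval

/-! ### Signs of reordering products of supercommuting elements -/

section ReorderProduct

variable {A : Type} [Ring A] {ι : Type}

theorem mul_list_prod_of_commute (χ : ι → ι → ℤˣ) (y : ι → A) (i : ι) (L : List ι)
    (h : ∀ j ∈ L, y i * y j = χ i j • (y j * y i)) :
    y i * (L.map y).prod = listSign χ i L • ((L.map y).prod * y i) := by
  induction L with
  | nil => simp
  | cons j L ih =>
    rw [List.map_cons, List.prod_cons, ← mul_assoc, h j (by simp), smul_mul_assoc, mul_assoc,
      ih fun k hk => h k (by simp [hk]), listSign_cons, mul_smul, mul_smul_comm, mul_assoc]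

theorem list_prod_eq_shuffleSign [LinearOrder ι] (χ : ι → ι → ℤˣ) (y : ι → A)
    (h : ∀ i j, y i * y j = χ i j • (y j * y i)) (S : Finset ι) (I : List ι)
    (hI : I.Pairwise (· < ·)) :
    (I.map y).prod = shuffleSign χ {i ∈ I.toFinset | i ∈ S} {i ∈ I.toFinset | i ∉ S} •
      (((I.filter (· ∈ S)).map y).prod * ((I.filter (· ∉ S)).map y).prod) := by
  induction I with
  | nil => simp [shuffleSign]
  | cons i I ih =>
    obtain ⟨hi, hI⟩ := List.pairwise_cons.1 hI
    have hn : i ∉ I.toFinset := fun h => lt_irrefl i (hi i (List.mem_toFinset.1 h))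
    rw [List.map_cons, List.prod_cons, ih hI, List.toFinset_cons, Finset.filter_insert,
      Finset.filter_insert]
    by_cases hiS : i ∈ S
    · simp only [hiS, if_true, not_true, if_false, List.filter_cons, decide_true, decide_false,
        Bool.false_eq_true, List.map_cons, List.prod_cons]
      rw [mul_smul_comm, ← mul_assoc]
      congr 1
      refine Finset.prod_congr rfl fun a ha => ?_
      rw [Finset.prod_insert (by simp [hn]), if_neg, one_mul]
      exact (hi a (List.mem_toFinset.1 (Finset.mem_filter.1 ha).1)).asymm
    · simp only [hiS, if_false, not_false_eq_true, if_true, List.filter_cons, decide_true,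
        decide_false, Bool.false_eq_true, List.map_cons, List.prod_cons]
      rw [mul_smul_comm, ← mul_assoc, mul_list_prod_of_commute χ y i _ fun j _ => h i j,
        smul_mul_assoc, mul_assoc, ← mul_smul, mul_comm]
      congr 1
      rw [shuffleSign, shuffleSign, Finset.prod_insert (by simp [hn])]
      congr 1
      rw [listSign, ← List.prod_toFinset _ ((hI.imp fun h => h.ne).filter _)]
      have : (I.filter (· ∈ S)).toFinset = {i ∈ I.toFinset | i ∈ S} := by ext; simp
      rw [this]
      refine Finset.prod_congr rfl fun a ha => (if_pos ?_).symm
      exact hi a (List.mem_toFinset.1 (Finset.mem_filter.1 ha).1)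

/-- The Koszul sign of an unshuffle is the sign produced by sorting an actual product of
supercommuting elements. -/
theorem ofFn_prod_eq_koszulSign {n : ℕ} (y : Fin n → A) (e : Fin n → Bool)
    (h : ∀ i j, y i * y j = (if e i = true ∧ e j = true then (-1 : ℤˣ) else 1) • (y j * y i))
    (S : Finset (Fin n)) :
    (List.ofFn y).prod = koszulSign S e •
      ((List.ofFn fun i => y (S.orderEmbOfFin rfl i)).prod *
        (List.ofFn fun i => y (Sᶜ.orderEmbOfFin rfl i)).prod) := by
  have := list_prod_eq_shuffleSign _ y h S (List.finRange n) (List.pairwise_lt_finRange n)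
  rw [← List.ofFn_eq_map] at this
  have e' : (List.finRange n).filter (· ∉ S) = List.ofFn fun i => Sᶜ.orderEmbOfFin rfl i := by
    rw [← filter_finRange_eq_ofFn]
    simp
  rw [this, filter_finRange_eq_ofFn, e', List.map_ofFn, List.map_ofFn]
  congr 1
  have h1 : ({i ∈ (List.finRange n).toFinset | i ∈ S} : Finset (Fin n)) = S := by ext; simp
  have h2 : ({i ∈ (List.finRange n).toFinset | i ∉ S} : Finset (Fin n)) = Sᶜ := by ext; simp
  rw [h1, h2, shuffleSign, koszulSign]
  refine Finset.prod_congr rfl fun i _ => Finset.prod_congr rfl fun j _ => ?_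
  by_cases hij : i < j <;> simp [hij]

end ReorderProduct

/-- The data of the operators attached to the edges of graphs: sums of products of a derivation
acting at the source and of one acting at the target. -/
structure EdgeOps (C W : Type) [CommRing C] [Algebra ℝ C] [AddCommGroup W] [Module ℝ W] where
  K : Bool → Type
  fintype : ∀ s, Fintype (K s)
  fst : ∀ s, K s → SiteOp C W
  snd : ∀ s, K s → SiteOp C W
  isOdd_eq : ∀ s k, (fst s k).isOdd = (snd s k).isOdd
  fst_fst : ∀ s k s' k', (fst s k).Compatible (fst s' k')
  fst_snd : ∀ s k s' k', (fst s k).Compatible (snd s' k')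
  snd_fst : ∀ s k s' k', (snd s k).Compatible (fst s' k')
  snd_snd : ∀ s k s' k', (snd s k).Compatible (snd s' k')

attribute [instance] EdgeOps.fintype

namespace EdgeOps

variable {C W : Type} [CommRing C] [Algebra ℝ C] [AddCommGroup W] [Module ℝ W] (E : EdgeOps C W)

/-- The operator of an edge. -/
def edge {N : ℕ} (e : Edge N) : Module.End ℝ (TensorAlg (Fin N) C W) :=
  ∑ k, ((E.fst e.aligned k).at e.src).act * ((E.snd e.aligned k).at e.tgt).act

/-- Four exchanges with the same sign cancel. This is why edges built from two odd derivatives are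
still bosonic. -/
theorem mul_mul_comm_of_sign {A : Type} [Ring A] {a b c d : A} (s : ℤˣ)
    (h1 : a * c = s • (c * a)) (h2 : a * d = s • (d * a)) (h3 : b * c = s • (c * b))
    (h4 : b * d = s • (d * b)) : a * b * (c * d) = c * d * (a * b) := by
  have hs : s * s = 1 := Int.units_mul_self s
  calc a * b * (c * d) = a * (b * c) * d := by simp only [mul_assoc]
    _ = s • ((a * c) * (b * d)) := by
      rw [h3]; simp only [mul_smul_comm, smul_mul_assoc, mul_assoc]
    _ = s • s • s • (c * (a * d) * b) := by
      rw [h1, h4]; simp only [mul_smul_comm, smul_mul_assoc, mul_assoc]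
    _ = c * d * (a * b) := by
      rw [h2]
      simp only [mul_smul_comm, smul_mul_assoc, mul_assoc, ← mul_smul, hs, one_smul]

theorem edge_comm {N : ℕ} (e e' : Edge N) : E.edge e * E.edge e' = E.edge e' * E.edge e := by
  rw [edge, edge, Finset.sum_mul_sum, Finset.sum_mul_sum, Finset.sum_comm]
  refine Finset.sum_congr rfl fun k _ => Finset.sum_congr rfl fun l _ => ?_
  refine mul_mul_comm_of_sign (if (E.fst e.aligned l).isOdd && (E.fst e'.aligned k).isOdd
    then (-1 : ℤˣ) else 1) ?_ ?_ ?_ ?_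
  · rw [SiteOp.act_comm _ _ (SiteOp.compatible_at _ _ (E.fst_fst _ _ _ _))]
    simp
  · rw [SiteOp.act_comm _ _ (SiteOp.compatible_at _ _ (E.fst_snd _ _ _ _))]
    simp [E.isOdd_eq]
  · rw [SiteOp.act_comm _ _ (SiteOp.compatible_at _ _ (E.snd_fst _ _ _ _))]
    simp [E.isOdd_eq]
  · rw [SiteOp.act_comm _ _ (SiteOp.compatible_at _ _ (E.snd_snd _ _ _ _))]
    simp [E.isOdd_eq]

/-- The action of graphs on the tensor powers. -/
def rho {N : ℕ} : Gra N →ₐ[ℝ] Module.End ℝ (TensorAlg (Fin N) C W) :=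
  commAeval E.edge E.edge_comm

@[simp] theorem rho_X {N : ℕ} (e : Edge N) : E.rho (MvPolynomial.X e) = E.edge e :=
  commAeval_X _ _ e

theorem edge_apply {N : ℕ} (e : Edge N) (x : TensorAlg (Fin N) C W) :
    E.edge e x = ∑ k, ((E.fst e.aligned k).at e.src).act
      (((E.snd e.aligned k).at e.tgt).act x) := by
  simp [edge, LinearMap.sum_apply]

/-- Applying `act_push` to both ends of each edge: acting after contraction is acting before it with
all ways of reconnecting the edge ends. -/
theorem rho_push {M N : ℕ} (π : Fin N → Fin M) (γ : Gra M) (x : TensorAlg (Fin N) C W) :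
    E.rho γ (push C W π x) = push C W π (E.rho (blowUp π γ) x) := by
  induction γ using MvPolynomial.induction_on generalizing x with
  | C r =>
    simp only [← MvPolynomial.algebraMap_eq, AlgHom.commutes, Module.algebraMap_end_apply,
      map_smul]
  | add p q hp hq => simp only [map_add, LinearMap.add_apply, hp, hq]
  | mul_X p e hp =>
    rw [map_mul, map_mul, map_mul, Module.End.mul_apply, Module.End.mul_apply, rho_X]
    have : E.edge e (push C W π x) =
        push C W π (E.rho (blowUp π (MvPolynomial.X e)) x) := by
      rw [blowUp, MvPolynomial.aeval_X]
      simp only [map_sum, rho_X, LinearMap.sum_apply, edge_apply, act_push]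
      conv_lhs => rw [Finset.sum_comm]
      conv_rhs => rw [Finset.sum_comm]
      exact Finset.sum_congr rfl fun b _ => Finset.sum_comm
    rw [this, hp]

theorem act_push_of_injective {M N : ℕ} {ι : Fin M → Fin N} (hι : Function.Injective ι)
    (k : Fin M) (o : SiteOp C W) (x : TensorAlg (Fin M) C W) :
    (o.at (ι k)).act (push C W ι x) = push C W ι ((o.at k).act x) := by
  rw [act_push]
  have : ({i | ι i = ι k} : Finset (Fin M)) = {k} := by
    ext i; simp [hι.eq_iff]
  rw [this, Finset.sum_singleton]

/-- The edges of an inserted graph act only on the factors in the image of `ι`, for which `z` is a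
constant, so only the first term of each Leibniz rule survives. -/
theorem rho_relabel_mul {M N : ℕ} {ι : Fin M → Fin N} (hι : Function.Injective ι) (γ : Gra M)
    (y : TensorAlg (Fin M) C W) (z : TensorAlg (Fin N) C W)
    (hz : ∀ (k : Fin M) (o : SiteOp C W), (o.at (ι k)).act z = 0) :
    E.rho (relabel ι γ) (push C W ι y * z) = push C W ι (E.rho γ y) * z := by
  induction γ using MvPolynomial.induction_on generalizing y with
  | C r =>
    simp only [← MvPolynomial.algebraMap_eq, AlgHom.commutes, Module.algebraMap_end_apply,
      map_smul, smul_mul_assoc]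
  | add p q hp hq => simp only [map_add, LinearMap.add_apply, hp, hq, add_mul]
  | mul_X p e hp =>
    rw [map_mul (relabel ι), map_mul E.rho, map_mul E.rho, Module.End.mul_apply, Module.End.mul_apply, rho_X]
    have : E.rho (relabel ι (MvPolynomial.X e)) (push C W ι y * z) =
        push C W ι (E.edge e y) * z := by
      rw [relabel, MvPolynomial.rename_X, rho_X]
      simp only [edge_apply, SiteOp.act_mul, hz, mul_zero, add_zero, act_push_of_injective hι,
        map_sum, Finset.sum_mul]
    rw [this, hp]

variable (C W) in
/-- The product of the arguments, each in its own tensor factor. -/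
def prodIncl (N : ℕ) : MultilinearMap ℝ (fun _ : Fin N => SuperAlg C W) (TensorAlg (Fin N) C W) :=
  (MultilinearMap.mkPiAlgebraFin ℝ N (TensorAlg (Fin N) C W)).compLinearMap
    fun i => (incl C W i).toLinearMap

theorem prodIncl_apply {N : ℕ} (f : Fin N → SuperAlg C W) :
    prodIncl C W N f = (List.ofFn fun i => incl C W i (f i)).prod := rfl

theorem prodIncl_cons {N : ℕ} (y : SuperAlg C W) (f : Fin N → SuperAlg C W) :
    prodIncl C W (N + 1) (Fin.cons y f) =
      incl C W 0 y * (List.ofFn fun i => incl C W i.succ (f i)).prod := by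
  rw [prodIncl_apply, List.ofFn_succ, List.prod_cons]
  rfl

theorem push_prodIncl {M N : ℕ} (π : Fin M → Fin N) (f : Fin M → SuperAlg C W) :
    push C W π (prodIncl C W M f) = (List.ofFn fun i => incl C W (π i) (f i)).prod := by
  rw [prodIncl_apply, map_list_prod, List.map_ofFn]
  congr 2
  funext i
  exact push_incl π i (f i)

theorem act_list_prod_eq_zero {N : ℕ} (o : SiteOp C W) (i : Fin N)
    (L : List (TensorAlg (Fin N) C W)) (h : ∀ y ∈ L, (o.at i).act y = 0) :
    (o.at i).act L.prod = 0 := by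
  induction L with
  | nil => exact SiteOp.act_one _
  | cons y L ih =>
    rw [List.prod_cons, SiteOp.act_mul, h y (by simp), ih fun z hz => h z (by simp [hz])]
    simp

/-- The action of graphs by multilinear operations. -/
def rep (N : ℕ) :
    Gra N →ₗ[ℝ] MultilinearMap ℝ (fun _ : Fin N => SuperAlg C W) (SuperAlg C W) where
  toFun γ := ((mulAll (Fin N) C W).toLinearMap ∘ₗ E.rho γ).compMultilinearMap (prodIncl C W N)
  map_add' γ γ' := by ext f; simp
  map_smul' c γ := by ext f; simp

theorem rep_apply {N : ℕ} (γ : Gra N) (f : Fin N → SuperAlg C W) :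
    E.rep N γ f = mulAll (Fin N) C W (E.rho γ (prodIncl C W N f)) := rfl

/-- `x` is even (if `b = false`) or odd (if `b = true`). -/
def HasParity (x : SuperAlg C W) (b : Bool) : Prop := sparity x = if b then -x else x

theorem HasParity.incl_mul_incl {N : ℕ} {x y : SuperAlg C W} {b b' : Bool} (hx : HasParity x b)
    (hy : HasParity y b') (i j : Fin N) :
    incl C W i x * incl C W j y =
      (if b = true ∧ b' = true then (-1 : ℤˣ) else 1) • (incl C W j y * incl C W i x) := by
  rw [super_mul_comm (incl C W i x) (incl C W j y) b' (by
    rw [sparity_incl, hy]; split_ifs <;> simp), sparity_incl, hx]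
  cases b <;> cases b' <;> simp [Units.smul_def]

/-- Compatibility with operadic composition: the edges of `γ'` see only the arguments in `S`, and
those of `γ` see the product of these arguments as a single one. The Koszul sign comes from bringing
the arguments in `S` to the front. -/
theorem rep_insertGraph {N : ℕ} (S : Finset (Fin N)) (γ : Gra (Sᶜ.card + 1)) (γ' : Gra S.card)
    (x : Fin N → SuperAlg C W) (e : Fin N → Bool) (hx : ∀ i, HasParity (x i) (e i)) :
    E.rep N (insertGraph S γ γ') x =
      koszulSign S e • insertAt S (E.rep _ γ) (E.rep _ γ') x := by
  set π : Fin N → Fin (Sᶜ.card + 1) := fun a => Sum.elim (fun _ => 0) Fin.succ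
    ((finSumEquivOfFinset rfl rfl).symm a : Fin S.card ⊕ Fin Sᶜ.card) with hπ
  have h1 : ∀ i, π (S.orderEmbOfFin rfl i) = 0 := fun i => by
    rw [hπ]
    simp only
    rw [← finSumEquivOfFinset_inl rfl rfl, Equiv.symm_apply_apply]
    rfl
  have h2 : ∀ i, π (Sᶜ.orderEmbOfFin rfl i) = i.succ := fun i => by
    rw [hπ]
    simp only
    rw [← finSumEquivOfFinset_inr rfl rfl, Equiv.symm_apply_apply]
    rfl
  have hp := ofFn_prod_eq_koszulSign (fun i => incl C W i (x i)) e
    (fun i j => (hx i).incl_mul_incl (hx j) i j) S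
  rw [← prodIncl_apply, ← push_prodIncl (fun i => S.orderEmbOfFin rfl i)
    (fun i => x (S.orderEmbOfFin rfl i))] at hp
  set z : TensorAlg (Fin N) C W :=
    (List.ofFn fun i => incl C W (Sᶜ.orderEmbOfFin rfl i) (x (Sᶜ.orderEmbOfFin rfl i))).prod
    with hz
  have hz0 : ∀ (k : Fin S.card) (o : SiteOp C W),
      (o.at (S.orderEmbOfFin rfl k)).act z = 0 := by
    intro k o
    refine act_list_prod_eq_zero o _ _ fun y hy => ?_
    obtain ⟨i, rfl⟩ := List.mem_ofFn.1 hy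
    rw [act_incl, if_neg]
    intro h
    have h3 := Finset.orderEmbOfFin_mem S rfl k
    rw [← h] at h3
    exact Finset.mem_compl.1 (Finset.orderEmbOfFin_mem Sᶜ rfl i) h3
  rw [rep_apply, insertGraph, map_mul, Module.End.mul_apply, hp, Units.smul_def, map_zsmul,
    rho_relabel_mul E (S.orderEmbOfFin rfl).injective γ' _ z hz0, map_zsmul, map_zsmul,
    ← Units.smul_def]
  congr 1
  -- The total product does not change if `S` is first contracted to the vertex `0`, and moving this
  -- contraction past the outer edges undoes their blow-up. The inner factor is then pushed to one
  -- place, as in `push_const`.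
  rw [← mulAll_push π, ← rho_push, map_mul, push_push, insertAt_apply, rep_apply]
  congr 2
  have h3 : π ∘ (fun i => S.orderEmbOfFin rfl i) = fun _ => 0 := funext h1
  rw [h3, push_const, prodIncl_cons, rep_apply]
  congr 1
  rw [hz, map_list_prod, List.map_ofFn]
  congr 2
  funext i
  simp only [Function.comp_apply, push_incl, h2]

theorem rep_comp_swap {N : ℕ} (γ : Gra N) (i j : Fin N) (hij : (i : ℕ) + 1 = j)
    (x : Fin N → SuperAlg C W) {a b : Bool} (hi : HasParity (x i) a) (hj : HasParity (x j) b) :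
    E.rep N γ (x ∘ Equiv.swap i j) = (if a = true ∧ b = true then (-1 : ℤˣ) else 1) •
      E.rep N (relabel (Equiv.swap i j) γ) x := by
  have h := rho_relabel_mul E (Equiv.swap i j).injective γ (prodIncl C W N (x ∘ Equiv.swap i j)) 1
    (fun _ _ => SiteOp.act_one _)
  rw [mul_one, mul_one] at h
  rw [rep_apply, ← mulAll_push (Equiv.swap i j), ← h, push_prodIncl, rep_apply]
  have hp : (List.ofFn fun k => incl C W (Equiv.swap i j k) ((x ∘ Equiv.swap i j) k)).prod =
      (if a = true ∧ b = true then (-1 : ℤˣ) else 1) • prodIncl C W N x := by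
    obtain ⟨A, B, e1, e2⟩ := ofFn_swap (fun k => incl C W k (x k)) i j hij
    rw [prodIncl_apply, e1]
    refine (congrArg List.prod e2).trans ?_
    simp only [List.prod_append, List.prod_cons]
    rw [← mul_assoc (incl C W j (x j)), hj.incl_mul_incl hi]
    simp only [smul_mul_assoc, mul_smul_comm, mul_assoc, and_comm]
  rw [hp, Units.smul_def, map_zsmul, map_zsmul, ← Units.smul_def]

theorem hasParity_parityPart (b : Bool) (x : SuperAlg C W) :
    HasParity (parityPart (sparity (B := C) (U := W)).toLinearMap b x) b := by
  cases b <;> simp [HasParity, parityPart, sparity_sparity, add_comm]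

theorem sum_parityPart {g : Type} [AddCommGroup g] [Module ℝ g] (P : g →ₗ[ℝ] g) (x : g) :
    ∑ b, parityPart P b x = x := by
  rw [Fintype.sum_bool]
  change (1 / 2 : ℝ) • (x + (-1 : ℝ) • P x) + (1 / 2 : ℝ) • (x + (1 : ℝ) • P x) = x
  module

theorem insertAt_zero {g : Type} [AddCommGroup g] [Module ℝ g] {n : ℕ} (S : Finset (Fin n))
    (f : MultilinearMap ℝ (fun _ : Fin (Sᶜ.card + 1) => g) g) : insertAt S f 0 = 0 := by
  have := insertAt_smul_right S 0 f 0
  rwa [zero_smul, zero_smul] at this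

/-- The parity hypothesis says that the inserted operations have even internal degree, so the
additional sign in `nrComp` is trivial. -/
theorem rep_graphComp (j : ℤ) (γ γ' : ∀ N, Gra N)
    (hγ' : ∀ M, γ' M ≠ 0 → Even (j - ((M : ℤ) - 1))) :
    (fun N => E.rep N (graphComp γ γ' N)) =
      nrComp (sparity (B := C) (U := W)).toLinearMap j (fun N => E.rep N (γ N))
        (fun N => E.rep N (γ' N)) := by
  funext n
  refine MultilinearMap.ext fun x => ?_
  have hu : ∀ (u : ℤˣ) (p : Gra n), E.rep n (u • p) = u • E.rep n p := fun u p => by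
    rw [Units.smul_def, map_zsmul, Units.smul_def]
  simp only [graphComp, nrComp, map_sum, hu, sum_apply, smul_apply,
    MultilinearMap.compLinearMap_apply]
  refine Finset.sum_congr rfl fun S _ => ?_
  -- Splitting every argument into its even and odd part reproduces the sum over parity patterns in
  -- `nrComp`.
  have hx : x = fun i => ∑ b, parityPart (sparity (B := C) (U := W)).toLinearMap b (x i) :=
    funext fun i => (sum_parityPart _ _).symm
  conv_lhs => rw [hx]
  rw [MultilinearMap.map_sum, Finset.smul_sum]
  refine Finset.sum_congr rfl fun e _ => ?_
  rw [rep_insertGraph E S _ _ _ e fun i => hasParity_parityPart _ _]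
  by_cases h0 : γ' S.card = 0
  · rw [h0, map_zero, insertAt_zero]; simp
  · have := hγ' _ h0
    rw [Int.negOnePow_even _ (this.mul_left _), mul_one, mul_smul]

end EdgeOps

/-! ## The representation on functions in terms of super algebras -/

section Representation

variable {n : ℕ} {V : TopologicalSpace.Opens (EuclideanSpace ℝ (Fin n))} {r : ℕ}

theorem extend_smoothFun_eventuallyEq (F : EuclideanSpace ℝ (Fin n) → ℝ) (x : V) :
    Function.extend Subtype.val (fun y : V => F y) 0 =ᶠ[nhds (x : EuclideanSpace ℝ (Fin n))] F := by
  filter_upwards [V.isOpen.mem_nhds x.2] with y hy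
  exact (Subtype.val_injective (p := fun y => y ∈ V)).extend_apply _ _ ⟨y, hy⟩

theorem smoothPartial_apply (μ : Fin n) (f : SmoothFun V) (x : V) :
    (smoothPartial μ f).1 x = fderiv ℝ (Function.extend Subtype.val f.1 0) x
      (EuclideanSpace.single μ (1 : ℝ)) := rfl

theorem smoothPartial_mul (μ : Fin n) (f h : SmoothFun V) :
    smoothPartial μ (f * h) = f * smoothPartial μ h + h * smoothPartial μ f := by
  ext x
  have e : Function.extend Subtype.val (f * h).1 0 =
      Function.extend Subtype.val f.1 0 * Function.extend Subtype.val h.1 0 := by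
    have := Function.extend_mul (Subtype.val : V → EuclideanSpace ℝ (Fin n)) f.1 h.1 0 0
    rw [mul_zero] at this
    exact this
  have ex : ∀ k : V → ℝ, Function.extend Subtype.val k 0 (x : EuclideanSpace ℝ (Fin n)) = k x :=
    fun k => (Subtype.val_injective (p := fun y => y ∈ V)).extend_apply _ _ x
  change (smoothPartial μ (f * h)).1 x =
    f.1 x * (smoothPartial μ h).1 x + h.1 x * (smoothPartial μ f).1 x
  rw [smoothPartial_apply, e, fderiv_mul (differentiableAt_extend f x) (differentiableAt_extend h x),
    ex, ex]
  rfl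

theorem smoothPartial_comm (μ ν : Fin n) (f : SmoothFun V) :
    smoothPartial μ (smoothPartial ν f) = smoothPartial ν (smoothPartial μ f) := by
  ext x
  set F := Function.extend Subtype.val f.1 0 with hF
  have hc : ContDiffAt ℝ ∞ F (x : EuclideanSpace ℝ (Fin n)) :=
    f.2.contDiffAt (V.isOpen.mem_nhds x.2)
  have key : ∀ μ ν : Fin n, (smoothPartial μ (smoothPartial ν f)).1 x =
      fderiv ℝ (fderiv ℝ F) x (EuclideanSpace.single μ (1 : ℝ))
        (EuclideanSpace.single ν (1 : ℝ)) := by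
    intro μ ν
    rw [smoothPartial_apply]
    -- The extension by zero of the derivative and the derivative of the extension need only agree
    -- near `x`, since differentiation is local.
    have h1 : Function.extend Subtype.val (smoothPartial ν f).1 0
        =ᶠ[nhds (x : EuclideanSpace ℝ (Fin n))]
        fun y => fderiv ℝ F y (EuclideanSpace.single ν (1 : ℝ)) :=
      extend_smoothFun_eventuallyEq
        (fun y => fderiv ℝ F y (EuclideanSpace.single ν (1 : ℝ))) x
    have hd : DifferentiableAt ℝ (fderiv ℝ F) (x : EuclideanSpace ℝ (Fin n)) :=
      (hc.fderiv_right (m := ∞) (by simp)).differentiableAt (by simp)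
    rw [h1.fderiv_eq, fderiv_clm_apply hd (differentiableAt_const _)]
    simp
  change (smoothPartial μ (smoothPartial ν f)).1 x = (smoothPartial ν (smoothPartial μ f)).1 x
  rw [key, key]
  exact (hc.isSymmSndFDerivAt (by
    rw [minSmoothness_of_isRCLikeNormedField]
    exact ENat.LEInfty.out)) _ _

variable (V) in
/-- The functions of the even coordinates. -/
abbrev EvenFun : Type := SmoothFun V ⊗[ℝ] MvPolynomial (Fin n) ℝ

/-- The extension of a derivation to a tensor product. -/
def derivTensor {A B : Type} [CommRing A] [Algebra ℝ A] [CommRing B] [Algebra ℝ B]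
    (D : A →ₗ[ℝ] A) (D' : B →ₗ[ℝ] B) (h : ∀ a b c d : _,
      TensorProduct.map D D' ((a * b) ⊗ₜ[ℝ] (c * d)) =
        (a ⊗ₜ[ℝ] c) * TensorProduct.map D D' (b ⊗ₜ d) +
          (b ⊗ₜ[ℝ] d) * TensorProduct.map D D' (a ⊗ₜ c)) :
    Derivation ℝ (A ⊗[ℝ] B) (A ⊗[ℝ] B) :=
  Derivation.mk' (TensorProduct.map D D') (by
    intro x y
    induction x using TensorProduct.induction_on with
    | zero => simp
    | add x x' hx hx' => rw [add_mul, map_add, map_add, hx, hx']; simp only [smul_eq_mul]; ring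
    | tmul a c =>
      induction y using TensorProduct.induction_on with
      | zero => simp
      | add y y' hy hy' => rw [mul_add, map_add, map_add, hy, hy']; simp only [smul_eq_mul]; ring
      | tmul b d =>
        rw [Algebra.TensorProduct.tmul_mul_tmul, smul_eq_mul, smul_eq_mul]
        exact h a b c d)

theorem derivTensor_apply {A B : Type} [CommRing A] [Algebra ℝ A] [CommRing B] [Algebra ℝ B]
    (D : A →ₗ[ℝ] A) (D' : B →ₗ[ℝ] B) (h) (x : A ⊗[ℝ] B) :
    derivTensor D D' h x = TensorProduct.map D D' x := rfl

/-- `∂/∂x^μ` on functions of the even coordinates. -/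
def evenDx (μ : Fin n) : Derivation ℝ (EvenFun V) (EvenFun V) :=
  derivTensor (smoothPartial μ) LinearMap.id (by
    intro a b c d
    simp only [TensorProduct.map_tmul, smoothPartial_mul, LinearMap.id_apply,
      Algebra.TensorProduct.tmul_mul_tmul, TensorProduct.add_tmul]
    rw [mul_comm d c])

/-- `∂/∂p_μ` on functions of the even coordinates. -/
def evenDp (μ : Fin n) : Derivation ℝ (EvenFun V) (EvenFun V) :=
  derivTensor LinearMap.id (MvPolynomial.pderiv μ).toLinearMap (by
    intro a b c d
    simp only [TensorProduct.map_tmul, LinearMap.id_apply,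
      Algebra.TensorProduct.tmul_mul_tmul]
    rw [mul_comm b a, ← TensorProduct.tmul_add]
    congr 1
    exact (MvPolynomial.pderiv μ).leibniz c d)

theorem evenDx_comm (μ ν : Fin n) (x : EvenFun V) :
    evenDx μ (evenDx ν x) = evenDx ν (evenDx μ x) := by
  simp only [evenDx, derivTensor_apply]
  induction x using TensorProduct.induction_on with
  | zero => simp
  | add x y hx hy => simp only [map_add, hx, hy]
  | tmul a b => simp only [TensorProduct.map_tmul, LinearMap.id_apply, smoothPartial_comm μ ν]

/-- The commutator of two derivations is a derivation, hence vanishes if it kills the variables. -/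
theorem derivation_comm_of_X {σ R : Type} [CommRing R]
    (D D' : Derivation R (MvPolynomial σ R) (MvPolynomial σ R))
    (h : ∀ i, D (D' (MvPolynomial.X i)) = D' (D (MvPolynomial.X i))) (q : MvPolynomial σ R) :
    D (D' q) = D' (D q) := by
  have : ⁅D, D'⁆ = 0 := MvPolynomial.derivation_ext fun i => by
    rw [Derivation.commutator_apply, h, sub_self, Derivation.coe_zero, Pi.zero_apply]
  have := DFunLike.congr_fun this q
  rw [Derivation.commutator_apply] at this
  exact sub_eq_zero.1 this

theorem pderiv_comm {σ R : Type} [CommRing R] (μ ν : σ) (q : MvPolynomial σ R) :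
    MvPolynomial.pderiv μ (MvPolynomial.pderiv ν q) =
      MvPolynomial.pderiv ν (MvPolynomial.pderiv μ q) := by
  classical
  refine derivation_comm_of_X _ _ (fun i => ?_) q
  simp only [MvPolynomial.pderiv_X, Pi.single_apply]
  split_ifs <;> simp

theorem evenDp_comm (μ ν : Fin n) (x : EvenFun V) :
    evenDp μ (evenDp ν x) = evenDp ν (evenDp μ x) := by
  simp only [evenDp, derivTensor_apply]
  induction x using TensorProduct.induction_on with
  | zero => simp
  | add x y hx hy => simp only [map_add, hx, hy]
  | tmul a b =>
    simp only [TensorProduct.map_tmul, LinearMap.id_apply]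
    congr 1
    exact pderiv_comm μ ν b

theorem evenDx_evenDp (μ ν : Fin n) (x : EvenFun V) :
    evenDx μ (evenDp ν x) = evenDp ν (evenDx μ x) := by
  simp only [evenDx, evenDp, derivTensor_apply]
  induction x using TensorProduct.induction_on with
  | zero => simp
  | add x y hx hy => simp only [map_add, hx, hy]
  | tmul a b => simp only [TensorProduct.map_tmul, LinearMap.id_apply]

/-- The indices of the sum in the operator of an edge. -/
def edgeIndex (n r : ℕ) : Bool → Type
  | true => Fin n
  | false => Fin r

instance (n r : ℕ) : ∀ s, Fintype (edgeIndex n r s)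
  | true => inferInstanceAs (Fintype (Fin n))
  | false => inferInstanceAs (Fintype (Fin r))

variable (V r) in
/-- The operators attached to the edges in the representation on functions. -/
def funEdgeOps : EdgeOps (EvenFun V) (OddSpan r) where
  K := edgeIndex n r
  fintype := inferInstance
  fst
    | true, μ => .even (evenDx (show Fin n from μ))
    | false, a => .odd (LinearMap.proj (Sum.inl (show Fin r from a)))
  snd
    | true, μ => .even (evenDp (show Fin n from μ))
    | false, a => .odd (LinearMap.proj (Sum.inr (show Fin r from a)))
  isOdd_eq
    | true, _ => rfl
    | false, _ => rfl
  fst_fst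
    | true, μ, true, ν => evenDx_comm (show Fin n from μ) (show Fin n from ν)
    | true, _, false, _ => trivial
    | false, _, true, _ => trivial
    | false, _, false, _ => trivial
  fst_snd
    | true, μ, true, ν => evenDx_evenDp (show Fin n from μ) (show Fin n from ν)
    | true, _, false, _ => trivial
    | false, _, true, _ => trivial
    | false, _, false, _ => trivial
  snd_fst
    | true, μ, true, ν => fun x => (evenDx_evenDp (show Fin n from ν) (show Fin n from μ) x).symm
    | true, _, false, _ => trivial
    | false, _, true, _ => trivial
    | false, _, false, _ => trivial
  snd_snd
    | true, μ, true, ν => evenDp_comm (show Fin n from μ) (show Fin n from ν)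
    | true, _, false, _ => trivial
    | false, _, true, _ => trivial
    | false, _, false, _ => trivial

variable (V r) in
/-- The algebra of functions as a super algebra. -/
def toSuper : FunAlg V r ≃ₐ[ℝ] SuperAlg (EvenFun V) (OddSpan r) :=
  (Algebra.TensorProduct.assoc ℝ ℝ ℝ (SmoothFun V) (MvPolynomial (Fin n) ℝ)
    (ExteriorAlgebra ℝ (OddSpan r))).symm

theorem toSuper_parity (x : FunAlg V r) :
    toSuper V r (parity x) = sparity (toSuper V r x) := by
  induction x using funAlg_induction with
  | add a b ha hb => simp only [map_add, ha, hb]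
  | tmul f q w => rfl

theorem toSuper_dx (μ : Fin n) (x : FunAlg V r) :
    toSuper V r (dx μ x) = (SiteOp.even (evenDx μ)).act (toSuper V r x) := by
  induction x using funAlg_induction with
  | add a b ha hb => simp only [map_add, ha, hb]
  | tmul f q w => rfl

theorem toSuper_dp (μ : Fin n) (x : FunAlg V r) :
    toSuper V r (dp μ x) = (SiteOp.even (evenDp μ)).act (toSuper V r x) := by
  induction x using funAlg_induction with
  | add a b ha hb => simp only [map_add, ha, hb]
  | tmul f q w => rfl

theorem toSuper_dOdd (s : Fin r ⊕ Fin r) (x : FunAlg V r) :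
    toSuper V r (dOdd s x) = (SiteOp.odd (LinearMap.proj s)).act (toSuper V r x) := by
  induction x using funAlg_induction with
  | add a b ha hb => simp only [map_add, ha, hb]
  | tmul f q w => rfl

end Representation

/-! ### Derivatives of products of tensor factors, with Koszul signs -/

namespace EdgeOps

variable {C W : Type} [CommRing C] [Algebra ℝ C] [AddCommGroup W] [Module ℝ W]

/-- Moving an odd derivative to the place `i` twists all factors to its left by the parity
involution. This matches the sign convention of `oddAt`. -/
theorem act_list_prod {N : ℕ} (o : SiteOp C W) (i : Fin N) (f : Fin N → SuperAlg C W)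
    (I : List (Fin N)) (hI : I.Pairwise (· < ·)) :
    (o.at i).act ((I.map fun k => incl C W k (f k)).prod) =
      if i ∈ I then (I.map fun k => incl C W k (if k < i then o.twist (f k) else
        if k = i then o.act (f k) else f k)).prod else 0 := by
  induction I with
  | nil => simpa using SiteOp.act_one _
  | cons k I ih =>
    obtain ⟨hk, hI⟩ := List.pairwise_cons.1 hI
    rw [List.map_cons, List.prod_cons, SiteOp.act_mul, ih hI, act_incl, twist_incl,
      List.map_cons, List.prod_cons]
    by_cases h : k = i
    · subst h
      have : k ∉ I := fun h => lt_irrefl k (hk k h)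
      simp only [this, if_false, mul_zero, add_zero, if_true, List.mem_cons, true_or, lt_irrefl]
      congr 2
      refine List.map_congr_left fun l hl => ?_
      rw [if_neg (hk l hl).asymm, if_neg (hk l hl).ne']
    · simp only [h, if_false, zero_mul, zero_add, List.mem_cons, Ne.symm h, false_or]
      by_cases hi : i ∈ I
      · simp only [hi, hk i hi, if_true]
      · simp only [hi, if_false, mul_zero]

theorem act_prodIncl {N : ℕ} (o : SiteOp C W) (i : Fin N) (f : Fin N → SuperAlg C W) :
    (o.at i).act (prodIncl C W N f) = prodIncl C W N (fun k => if k < i then o.twist (f k) else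
      if k = i then o.act (f k) else f k) := by
  rw [prodIncl_apply, prodIncl_apply, List.ofFn_eq_map, List.ofFn_eq_map,
    act_list_prod o i f _ (List.pairwise_lt_finRange N), if_pos (List.mem_finRange i)]

end EdgeOps

/-! ### Comparison of the action on functions with the action on super algebras -/

section Representation

variable {n : ℕ} {V : TopologicalSpace.Opens (EuclideanSpace ℝ (Fin n))} {r : ℕ}

variable (V r) in
/-- The map from tensor powers of the algebra of functions to tensor powers of super algebras. -/
def toTensor (N : ℕ) :
    (⨂[ℝ] _ : Fin N, FunAlg V r) →ₗ[ℝ] TensorAlg (Fin N) (EvenFun V) (OddSpan r) :=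
  PiTensorProduct.lift ((EdgeOps.prodIncl (EvenFun V) (OddSpan r) N).compLinearMap
    fun _ => (toSuper V r).toLinearMap)

theorem toTensor_tprod {N : ℕ} (f : Fin N → FunAlg V r) :
    toTensor V r N (PiTensorProduct.tprod ℝ f) =
      EdgeOps.prodIncl (EvenFun V) (OddSpan r) N fun i => toSuper V r (f i) := by
  rw [toTensor, PiTensorProduct.lift.tprod]
  rfl

theorem toTensor_mulMap {N : ℕ} (x : ⨂[ℝ] _ : Fin N, FunAlg V r) :
    toSuper V r (mulMap V r N x) =
      mulAll (Fin N) (EvenFun V) (OddSpan r) (toTensor V r N x) := by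
  induction x using PiTensorProduct.induction_on with
  | add x y hx hy => simp only [map_add, hx, hy]
  | smul_tprod c f =>
    simp only [map_smul, toTensor_tprod]
    congr 1
    rw [mulMap, PiTensorProduct.lift.tprod, MultilinearMap.mkPiAlgebraFin_apply, map_list_prod,
      EdgeOps.prodIncl_apply, map_list_prod, List.map_ofFn, List.map_ofFn]
    congr 2
    funext i
    exact (mulAll_incl i _).symm

theorem toTensor_evenAt {N : ℕ} (i : Fin N) (d : FunAlg V r →ₗ[ℝ] FunAlg V r)
    (D : Derivation ℝ (EvenFun V) (EvenFun V))
    (h : ∀ x, toSuper V r (d x) = (SiteOp.even D).act (toSuper V r x))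
    (x : ⨂[ℝ] _ : Fin N, FunAlg V r) :
    toTensor V r N (evenAt i d x) = ((SiteOp.even D).at i).act (toTensor V r N x) := by
  induction x using PiTensorProduct.induction_on with
  | add x y hx hy => simp only [map_add, hx, hy]
  | smul_tprod c f =>
    simp only [map_smul]
    congr 1
    rw [evenAt, PiTensorProduct.map_tprod, toTensor_tprod, toTensor_tprod, EdgeOps.act_prodIncl]
    congr 1
    funext k
    by_cases hk : k = i
    · subst hk; simp [h]
    · simp [hk, SiteOp.twist]

theorem toTensor_oddAt {N : ℕ} (i : Fin N) (d : FunAlg V r →ₗ[ℝ] FunAlg V r)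
    (φ : Module.Dual ℝ (OddSpan r))
    (h : ∀ x, toSuper V r (d x) = (SiteOp.odd φ).act (toSuper V r x))
    (x : ⨂[ℝ] _ : Fin N, FunAlg V r) :
    toTensor V r N (oddAt i d x) = ((SiteOp.odd φ).at i).act (toTensor V r N x) := by
  induction x using PiTensorProduct.induction_on with
  | add x y hx hy => simp only [map_add, hx, hy]
  | smul_tprod c f =>
    simp only [map_smul]
    congr 1
    rw [oddAt, PiTensorProduct.map_tprod, toTensor_tprod, toTensor_tprod, EdgeOps.act_prodIncl]
    congr 1
    funext k
    by_cases hk' : k < i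
    · simp [hk', SiteOp.twist, toSuper_parity]
    by_cases hk : k = i
    · subst hk; simp [h]
    · simp [hk, hk']

theorem toTensor_edgeOp {N : ℕ} (e : Edge N) (x : ⨂[ℝ] _ : Fin N, FunAlg V r) :
    toTensor V r N (edgeOp V r e x) = (funEdgeOps V r).edge e (toTensor V r N x) := by
  obtain ⟨s, t, b⟩ := e
  rw [EdgeOps.edge_apply]
  cases b
  · simp only [edgeOp, Bool.false_eq_true, if_false, LinearMap.sum_apply, Module.End.mul_apply,
      map_sum]
    refine Finset.sum_congr rfl fun a _ => ?_
    rw [toTensor_oddAt s (dxi a) _ (toSuper_dOdd (Sum.inl a)),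
      toTensor_oddAt t (dzeta a) _ (toSuper_dOdd (Sum.inr a))]
    rfl
  · simp only [edgeOp, if_true, LinearMap.sum_apply, Module.End.mul_apply, map_sum]
    refine Finset.sum_congr rfl fun a _ => ?_
    rw [toTensor_evenAt s _ _ (toSuper_dx a), toTensor_evenAt t _ _ (toSuper_dp a)]
    rfl

theorem monomial_eq_list_prod {σ : Type} (m : σ →₀ ℕ) :
    (MvPolynomial.monomial m 1 : MvPolynomial σ ℝ) =
      ((Finsupp.toMultiset m).toList.map MvPolynomial.X).prod := by
  rw [← Multiset.prod_coe, ← Multiset.map_coe, Multiset.coe_toList]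
  induction m using Finsupp.induction_linear with
  | zero => simp
  | add f g hf hg =>
    rw [map_add, Multiset.map_add, Multiset.prod_add, ← hf, ← hg, MvPolynomial.monomial_mul,
      one_mul]
  | single a k =>
    rw [Finsupp.toMultiset_single, Multiset.map_nsmul, Multiset.prod_nsmul, Multiset.map_singleton,
      Multiset.prod_singleton, MvPolynomial.X_pow_eq_monomial]

theorem rep_monomial {N : ℕ} (m : Edge N →₀ ℕ) :
    rep V r N (MvPolynomial.monomial m 1) = repGraph V r m := by
  have := congrFun (MvPolynomial.coe_basisMonomials (Edge N) ℝ) m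
  rw [rep, ← this]
  exact Module.Basis.constr_basis _ _ _ _

theorem EdgeOps.rho_monomial {C W : Type} [CommRing C] [Algebra ℝ C] [AddCommGroup W]
    [Module ℝ W] (E : EdgeOps C W) {N : ℕ} (m : Edge N →₀ ℕ) :
    E.rho (MvPolynomial.monomial m 1) = ((Finsupp.toMultiset m).toList.map E.edge).prod := by
  rw [monomial_eq_list_prod, map_list_prod, List.map_map]
  congr 2
  funext e
  exact E.rho_X e

theorem toTensor_list_prod {N : ℕ} (L : List (Edge N)) (x : ⨂[ℝ] _ : Fin N, FunAlg V r) :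
    toTensor V r N ((L.map (edgeOp V r)).prod x) =
      (L.map (funEdgeOps V r).edge).prod (toTensor V r N x) := by
  induction L with
  | nil => rfl
  | cons e L ih =>
    rw [List.map_cons, List.prod_cons, Module.End.mul_apply, toTensor_edgeOp, ih, List.map_cons,
      List.prod_cons, Module.End.mul_apply]

theorem toSuper_repGraph {N : ℕ} (m : Edge N →₀ ℕ) (f : Fin N → FunAlg V r) :
    toSuper V r (repGraph V r m f) =
      (funEdgeOps V r).rep N (MvPolynomial.monomial m 1) fun i => toSuper V r (f i) := by
  rw [EdgeOps.rep_apply, EdgeOps.rho_monomial, ← toTensor_tprod, ← toTensor_list_prod,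
    ← toTensor_mulMap]
  rfl

/-- The concrete representation is the instance `funEdgeOps` of the abstract action, so the
compatibility with compositions applies to it. -/
theorem toSuper_rep {N : ℕ} (γ : Gra N) (f : Fin N → FunAlg V r) :
    toSuper V r (rep V r N γ f) =
      (funEdgeOps V r).rep N γ fun i => toSuper V r (f i) := by
  induction γ using MvPolynomial.induction_on' with
  | add p q hp hq => simp only [map_add, add_apply, hp, hq]
  | monomial m c =>
    have hc : MvPolynomial.monomial m c = c • (MvPolynomial.monomial m 1 : Gra N) := by
      rw [MvPolynomial.smul_monomial, smul_eq_mul, mul_one]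
    rw [hc, map_smul, map_smul, smul_apply, smul_apply, map_smul, rep_monomial, toSuper_repGraph]

end Representation

/-! ## Degrees of functions -/

section ExteriorDegree

variable {W W' : Type} [AddCommGroup W] [Module ℝ W] [AddCommGroup W'] [Module ℝ W']

theorem exteriorPower_induction {p : ℕ → ExteriorAlgebra ℝ W → Prop}
    (algebraMap : ∀ c, p 0 (algebraMap ℝ _ c)) (add : ∀ j x y, p j x → p j y → p j (x + y))
    (ι_mul : ∀ j x v, x ∈ ⋀[ℝ]^j W → p j x → p (j + 1) (ExteriorAlgebra.ι ℝ v * x))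
    (j : ℕ) (x : ExteriorAlgebra ℝ W) (hx : x ∈ ⋀[ℝ]^j W) : p j x := by
  induction j generalizing x with
  | zero =>
    obtain ⟨c, rfl⟩ := Submodule.mem_one.1 (by simpa [ExteriorAlgebra.exteriorPower] using hx)
    exact algebraMap c
  | succ j ih =>
    rw [ExteriorAlgebra.exteriorPower, pow_succ'] at hx
    refine Submodule.mul_induction_on hx (fun v hv y hy => ?_) (add _)
    obtain ⟨v, rfl⟩ := hv
    exact ι_mul j y v hy (ih y hy)

theorem ι_mul_mem_exteriorPower {j : ℕ} {x : ExteriorAlgebra ℝ W} (v : W) (hx : x ∈ ⋀[ℝ]^j W) :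
    ExteriorAlgebra.ι ℝ v * x ∈ ⋀[ℝ]^(j + 1) W := by
  rw [ExteriorAlgebra.exteriorPower, pow_succ']
  exact Submodule.mul_mem_mul ⟨v, rfl⟩ hx

theorem algebraMap_mem_exteriorPower (c : ℝ) :
    algebraMap ℝ (ExteriorAlgebra ℝ W) c ∈ ⋀[ℝ]^0 W := by
  rw [ExteriorAlgebra.exteriorPower, pow_zero]
  exact Submodule.mem_one.2 ⟨c, rfl⟩

theorem invol_of_mem_exteriorPower (j : ℕ) (x : ExteriorAlgebra ℝ W) (hx : x ∈ ⋀[ℝ]^j W) :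
    invol x = (j : ℤ).negOnePow • x := by
  refine exteriorPower_induction (p := fun j x => invol x = (j : ℤ).negOnePow • x)
    (fun c => by rw [AlgHom.commutes]; simp) (fun j x y hx hy => by rw [map_add, hx, hy, smul_add])
    (fun j x v _ hx => ?_) j x hx
  rw [map_mul, invol_ι, hx, Nat.cast_succ, Int.negOnePow_succ, mul_smul_comm, neg_mul, smul_neg,
    Units.neg_smul]

theorem contr_mem_exteriorPower (φ : Module.Dual ℝ W) (j : ℕ) (x : ExteriorAlgebra ℝ W)
    (hx : x ∈ ⋀[ℝ]^j W) : contr φ x = 0 ∨ ∃ i, i + 1 = j ∧ contr φ x ∈ ⋀[ℝ]^i W := by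
  -- The subtraction `j - 1` is truncated, so the vanishing in degree `0` is carried along as a
  -- separate clause.
  have h := exteriorPower_induction (W := W) (p := fun j x => (j = 0 → contr φ x = 0) ∧
      contr φ x ∈ ⋀[ℝ]^(j - 1) W) (fun c => by rw [contr_algebraMap]; simp)
    (fun j x y hx hy => ⟨fun h => by rw [map_add, hx.1 h, hy.1 h, add_zero],
      by rw [map_add]; exact add_mem hx.2 hy.2⟩)
    (fun j x v hx h => ⟨by simp, ?_⟩) j x hx
  · cases j with
    | zero => exact Or.inl (h.1 rfl)
    | succ j => exact Or.inr ⟨j, rfl, h.2⟩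
  · rw [contr_ι_mul]
    refine sub_mem (Submodule.smul_mem _ _ hx) ?_
    cases j with
    | zero => rw [h.1 rfl, mul_zero]; exact zero_mem _
    | succ j => exact ι_mul_mem_exteriorPower v h.2

theorem map_mem_exteriorPower (f : W →ₗ[ℝ] W') (j : ℕ) (x : ExteriorAlgebra ℝ W)
    (hx : x ∈ ⋀[ℝ]^j W) : ExteriorAlgebra.map f x ∈ ⋀[ℝ]^j W' := by
  refine exteriorPower_induction (p := fun j x => ExteriorAlgebra.map f x ∈ ⋀[ℝ]^j W')
    (fun c => by rw [AlgHom.commutes]; exact algebraMap_mem_exteriorPower c)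
    (fun j x y hx hy => by rw [map_add]; exact add_mem hx hy) (fun j x v _ hx => ?_) j x hx
  rw [map_mul, ExteriorAlgebra.map_apply_ι]
  exact ι_mul_mem_exteriorPower _ hx

variable (W) in
/-- The projection to the component of degree `j` of the exterior algebra. -/
def exteriorProj (j : ℕ) : ExteriorAlgebra ℝ W →ₗ[ℝ] ExteriorAlgebra ℝ W :=
  GradedAlgebra.proj (fun i => ⋀[ℝ]^i W) j

theorem exteriorProj_mem (j : ℕ) (x : ExteriorAlgebra ℝ W) :
    exteriorProj W j x ∈ ⋀[ℝ]^j W :=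
  SetLike.coe_mem _

theorem exteriorProj_of_mem (j k : ℕ) (x : ExteriorAlgebra ℝ W) (hx : x ∈ ⋀[ℝ]^k W) :
    exteriorProj W j x = if k = j then x else 0 := by
  split_ifs with h
  · subst h
    exact DirectSum.decompose_of_mem_same (fun i => ⋀[ℝ]^i W) hx
  · exact DirectSum.decompose_of_mem_ne (fun i => ⋀[ℝ]^i W) hx h

theorem exterior_induction_homogeneous {p : ExteriorAlgebra ℝ W → Prop} (zero : p 0)
    (add : ∀ x y, p x → p y → p (x + y)) (mem : ∀ j, ∀ x ∈ ⋀[ℝ]^j W, p x)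
    (x : ExteriorAlgebra ℝ W) : p x :=
  DirectSum.Decomposition.inductionOn (fun i => ⋀[ℝ]^i W) zero (fun {i} m => mem i m.1 m.2) add x

theorem exteriorProj_map (f : W →ₗ[ℝ] W') (j : ℕ) (x : ExteriorAlgebra ℝ W) :
    exteriorProj W' j (ExteriorAlgebra.map f x) = ExteriorAlgebra.map f (exteriorProj W j x) := by
  induction x using exterior_induction_homogeneous with
  | zero => simp
  | add x y hx hy => simp only [map_add, hx, hy]
  | mem k x hx =>
    rw [exteriorProj_of_mem j k x hx, exteriorProj_of_mem j k _ (map_mem_exteriorPower f k x hx)]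
    split_ifs <;> simp

theorem exists_sum_exteriorProj (x : ExteriorAlgebra ℝ W) :
    ∃ n, ∀ m ≥ n, ∑ j ∈ Finset.range m, exteriorProj W j x = x := by
  induction x using exterior_induction_homogeneous with
  | zero => exact ⟨0, fun m _ => by simp⟩
  | add x y hx hy =>
    obtain ⟨n, hn⟩ := hx
    obtain ⟨n', hn'⟩ := hy
    refine ⟨max n n', fun m hm => ?_⟩
    simp only [map_add, Finset.sum_add_distrib]
    rw [hn m (le_trans (le_max_left _ _) hm), hn' m (le_trans (le_max_right _ _) hm)]
  | mem k x hx =>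
    refine ⟨k + 1, fun m hm => ?_⟩
    simp only [exteriorProj_of_mem _ k x hx, Finset.sum_ite_eq, Finset.mem_range]
    rw [if_pos (by omega)]

end ExteriorDegree

/-! ### Homogeneous components of polynomials -/

section PolynomialDegree

theorem exists_sum_homogeneousComponent {σ : Type} (q : MvPolynomial σ ℝ) :
    ∃ n, ∀ m ≥ n, ∑ i ∈ Finset.range m, MvPolynomial.homogeneousComponent i q = q := by
  refine ⟨q.totalDegree + 1, fun m hm => ?_⟩
  conv_rhs => rw [← MvPolynomial.sum_homogeneousComponent q]
  refine (Finset.sum_subset (Finset.range_mono hm) fun i _ hi => ?_).symm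
  exact MvPolynomial.homogeneousComponent_eq_zero i q (by simpa using hi)

theorem homogeneousComponent_aeval_zero {σ : Type} (i : ℕ) (q : MvPolynomial σ ℝ) :
    MvPolynomial.homogeneousComponent i (MvPolynomial.aeval (fun _ => (0 : MvPolynomial σ ℝ)) q) =
      MvPolynomial.aeval (fun _ => (0 : MvPolynomial σ ℝ))
        (MvPolynomial.homogeneousComponent i q) := by
  have h0 : ∀ q : MvPolynomial σ ℝ, MvPolynomial.aeval (fun _ => (0 : MvPolynomial σ ℝ)) q =
    MvPolynomial.C (MvPolynomial.coeff 0 q) := fun q => MvPolynomial.aeval_zero' q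
  rw [h0, h0, MvPolynomial.homogeneousComponent_of_mem (n := 0)
    (MvPolynomial.isHomogeneous_C _ _), MvPolynomial.coeff_homogeneousComponent]
  by_cases h : i = 0 <;> simp [h, eq_comm]

end PolynomialDegree

/-! ### The grading of the algebra of functions -/

section Degree

variable {n : ℕ} {V : TopologicalSpace.Opens (EuclideanSpace ℝ (Fin n))} {r : ℕ}

theorem tmul_mem_funComp {i j : ℕ} {k : ℤ} (f : SmoothFun V) {q : MvPolynomial (Fin n) ℝ}
    {w : ExteriorAlgebra ℝ (OddSpan r)} (hq : q.IsHomogeneous i) (hw : w ∈ ⋀[ℝ]^j (OddSpan r))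
    (hk : 2 * (i : ℤ) + j = k) : (f ⊗ₜ (q ⊗ₜ w) : FunAlg V r) ∈ funComp V r k :=
  Submodule.subset_span ⟨i, j, f, q, w, hq, hw, hk, rfl⟩

theorem map_mem_funComp {k l : ℤ} (D : FunAlg V r →ₗ[ℝ] FunAlg V r)
    (h : ∀ (i j : ℕ) (f : SmoothFun V) (q : MvPolynomial (Fin n) ℝ)
      (w : ExteriorAlgebra ℝ (OddSpan r)), q.IsHomogeneous i → w ∈ ⋀[ℝ]^j (OddSpan r) →
      2 * (i : ℤ) + j = k → D (f ⊗ₜ (q ⊗ₜ w) : FunAlg V r) ∈ funComp V r l)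
    {x : FunAlg V r} (hx : x ∈ funComp V r k) : D x ∈ funComp V r l := by
  refine (Submodule.span_le (p := (funComp V r l).comap D)).2 ?_ hx
  rintro _ ⟨i, j, f, q, w, hq, hw, hk, rfl⟩
  exact h i j f q w hq hw hk

theorem dx_mem (μ : Fin n) {k : ℤ} {x : FunAlg V r} (hx : x ∈ funComp V r k) :
    dx μ x ∈ funComp V r k :=
  map_mem_funComp _ (fun _ _ f _ _ hq hw hk => tmul_mem_funComp (smoothPartial μ f) hq hw hk) hx

theorem dp_mem (μ : Fin n) {k : ℤ} {x : FunAlg V r} (hx : x ∈ funComp V r k) :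
    dp μ x ∈ funComp V r (k - 2) := by
  refine map_mem_funComp _ (fun i j f q w hq hw hk => ?_) hx
  change (f ⊗ₜ (MvPolynomial.pderiv μ q ⊗ₜ w) : FunAlg V r) ∈ _
  cases i with
  | zero =>
    have h0 : MvPolynomial.pderiv μ q = 0 := by
      rw [MvPolynomial.totalDegree_eq_zero_iff_eq_C.1
        (Nat.le_zero.1 hq.totalDegree_le), MvPolynomial.pderiv_C]
    rw [h0, TensorProduct.zero_tmul, TensorProduct.tmul_zero]
    exact zero_mem _
  | succ i =>
    exact tmul_mem_funComp f (i := i) hq.pderiv hw (by push_cast at hk; linarith)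

theorem dOdd_mem (s : Fin r ⊕ Fin r) {k : ℤ} {x : FunAlg V r} (hx : x ∈ funComp V r k) :
    dOdd s x ∈ funComp V r (k - 1) := by
  refine map_mem_funComp _ (fun i j f q w hq hw hk => ?_) hx
  change (f ⊗ₜ (q ⊗ₜ contr (LinearMap.proj s : OddSpan r →ₗ[ℝ] ℝ) w) : FunAlg V r) ∈ _
  obtain h | ⟨j, rfl, h⟩ := contr_mem_exteriorPower (LinearMap.proj s : OddSpan r →ₗ[ℝ] ℝ) j w hw
  · rw [h, TensorProduct.tmul_zero, TensorProduct.tmul_zero]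
    exact zero_mem _
  · exact tmul_mem_funComp f hq h (by push_cast at hk ⊢; linarith)

theorem parity_of_mem {k : ℤ} {x : FunAlg V r} (hx : x ∈ funComp V r k) :
    parity x = k.negOnePow • x := by
  have h : funComp V r k ≤ LinearMap.ker (parity - (k.negOnePow : ℤˣ) • LinearMap.id :
      FunAlg V r →ₗ[ℝ] FunAlg V r) := by
    refine Submodule.span_le.2 ?_
    rintro _ ⟨i, j, f, q, w, hq, hw, rfl, rfl⟩
    refine sub_eq_zero (G := FunAlg V r).2 ?_
    change (f ⊗ₜ (q ⊗ₜ invol w) : FunAlg V r) =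
      (2 * (i : ℤ) + j).negOnePow • (f ⊗ₜ (q ⊗ₜ w) : FunAlg V r)
    rw [invol_of_mem_exteriorPower j w hw, Int.negOnePow_add, Int.negOnePow_two_mul, one_mul,
      Units.smul_def, Units.smul_def]
    exact congrArg (fun z => f ⊗ₜ[ℝ] z) (TensorProduct.tmul_smul _ _ _) |>.trans
      (TensorProduct.tmul_smul _ _ _)
  exact sub_eq_zero (G := FunAlg V r).1 (h hx)

theorem parity_mem_funComp {k : ℤ} {x : FunAlg V r} (hx : x ∈ funComp V r k) :
    parity x ∈ funComp V r k := by
  rw [parity_of_mem hx, Units.smul_def, ← Int.cast_smul_eq_zsmul ℝ]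
  exact Submodule.smul_mem _ _ hx

theorem one_mem_funComp : (1 : FunAlg V r) ∈ funComp V r 0 :=
  tmul_mem_funComp 1 (MvPolynomial.isHomogeneous_one _ _) (j := 0)
    (by rw [← map_one (algebraMap ℝ _)]; exact algebraMap_mem_exteriorPower 1) (by simp)

theorem funAlg_tmul_mul (f f' : SmoothFun V) (q q' : MvPolynomial (Fin n) ℝ)
    (w w' : ExteriorAlgebra ℝ (OddSpan r)) :
    (f ⊗ₜ (q ⊗ₜ w) : FunAlg V r) * (f' ⊗ₜ (q' ⊗ₜ w') : FunAlg V r) =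
      (f * f') ⊗ₜ ((q * q') ⊗ₜ (w * w')) :=
  (Algebra.TensorProduct.tmul_mul_tmul (R := ℝ) f f' (q ⊗ₜ[ℝ] w) (q' ⊗ₜ[ℝ] w')).trans
    (congrArg (fun z => (f * f') ⊗ₜ[ℝ] z) (Algebra.TensorProduct.tmul_mul_tmul q q' w w'))

theorem mul_mem_funComp {k l : ℤ} {x y : FunAlg V r} (hx : x ∈ funComp V r k)
    (hy : y ∈ funComp V r l) : x * y ∈ funComp V r (k + l) := by
  refine map_mem_funComp (l := k + l) (LinearMap.mulRight ℝ y) (fun i j f q w hq hw hk => ?_) hx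
  refine map_mem_funComp (l := k + l) (LinearMap.mulLeft ℝ (f ⊗ₜ (q ⊗ₜ w) : FunAlg V r))
    (fun i' j' f' q' w' hq' hw' hl => ?_) hy
  have hw2 : w * w' ∈ ⋀[ℝ]^(j + j') (OddSpan r) := by
    rw [ExteriorAlgebra.exteriorPower, pow_add]
    exact Submodule.mul_mem_mul hw hw'
  have h : ((f * f') ⊗ₜ ((q * q') ⊗ₜ (w * w')) : FunAlg V r) ∈ funComp V r (k + l) :=
    tmul_mem_funComp (f * f') (hq.mul hq') hw2 (by push_cast; linarith)
  rw [← funAlg_tmul_mul] at h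
  exact h

/-- The component of bidegree `(i, j)` of a function. -/
def funProj (i j : ℕ) : FunAlg V r →ₗ[ℝ] FunAlg V r :=
  TensorProduct.map LinearMap.id (TensorProduct.map (MvPolynomial.homogeneousComponent i)
    (exteriorProj (OddSpan r) j))

theorem funProj_mem (i j : ℕ) (x : FunAlg V r) :
    funProj i j x ∈ funComp V r (2 * (i : ℤ) + j) := by
  induction x using funAlg_induction with
  | add a b ha hb => rw [map_add]; exact add_mem ha hb
  | tmul f q w =>
    exact tmul_mem_funComp f (MvPolynomial.homogeneousComponent_isHomogeneous i q)
      (exteriorProj_mem j w) rfl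

/-- The restriction is homogeneous. Therefore a subspace cut out by restrictions contains the
homogeneous components of its elements. -/
theorem restrictTo_funProj (T : Set (Fin r ⊕ Fin r)) (i j : ℕ) (x : FunAlg V r) :
    restrictTo T (funProj i j x) = funProj i j (restrictTo T x) := by
  induction x using funAlg_induction with
  | add a b ha hb => simp only [map_add, ha, hb]
  | tmul f q w =>
    change (f ⊗ₜ (MvPolynomial.aeval (fun _ => 0) (MvPolynomial.homogeneousComponent i q) ⊗ₜ
      ExteriorAlgebra.map (killOdd T) (exteriorProj _ j w)) : FunAlg V r) =
      f ⊗ₜ (MvPolynomial.homogeneousComponent i (MvPolynomial.aeval (fun _ => 0) q) ⊗ₜ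
        (exteriorProj _ j (ExteriorAlgebra.map (killOdd T) w)))
    rw [homogeneousComponent_aeval_zero, exteriorProj_map]

/-- The bound is stated for all large `m` so that two summands can share one. -/
theorem exists_sum_funProj (x : FunAlg V r) :
    ∃ n, ∀ m ≥ n, ∑ i ∈ Finset.range m, ∑ j ∈ Finset.range m, funProj i j x = x := by
  induction x using funAlg_induction with
  | add x y hx hy =>
    obtain ⟨n, hn⟩ := hx
    obtain ⟨n', hn'⟩ := hy
    refine ⟨max n n', fun m hm => ?_⟩
    simp only [map_add, Finset.sum_add_distrib]
    rw [hn m (le_trans (le_max_left _ _) hm), hn' m (le_trans (le_max_right _ _) hm)]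
  | tmul f q w =>
    obtain ⟨n, hn⟩ := exists_sum_homogeneousComponent q
    obtain ⟨n', hn'⟩ := exists_sum_exteriorProj w
    refine ⟨max n n', fun m hm => ?_⟩
    conv_rhs => rw [← hn m (le_trans (le_max_left _ _) hm),
      ← hn' m (le_trans (le_max_right _ _) hm)]
    rw [TensorProduct.sum_tmul, TensorProduct.tmul_sum]
    refine Finset.sum_congr rfl fun i _ => ?_
    rw [TensorProduct.tmul_sum, TensorProduct.tmul_sum]
    rfl

/-! ## Degrees and supports of the values of graphs -/

/-- Properties of pure tensors are tracked through spans, because the operator of an edge is a sum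
of product maps and does not preserve pure tensors. -/
theorem funMap_tprod_mem {N : ℕ} {X Y : Set (Fin N → FunAlg V r)}
    (D : Fin N → FunAlg V r →ₗ[ℝ] FunAlg V r) (h : ∀ x ∈ X, (fun i => D i (x i)) ∈ Y)
    {x : ⨂[ℝ] _ : Fin N, FunAlg V r} (hx : x ∈ Submodule.span ℝ (PiTensorProduct.tprod ℝ '' X)) :
    PiTensorProduct.map D x ∈ Submodule.span ℝ (PiTensorProduct.tprod ℝ '' Y) := by
  refine (Submodule.span_le (p := (Submodule.span ℝ (PiTensorProduct.tprod ℝ '' Y)).comap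
    (PiTensorProduct.map D))).2 ?_ hx
  rintro _ ⟨x, hx, rfl⟩
  rw [SetLike.mem_coe, Submodule.mem_comap]
  rw [PiTensorProduct.map_tprod]
  exact Submodule.subset_span ⟨_, h x hx, rfl⟩

/-- The products of homogeneous functions of total degree `d`. -/
def tensorDegree (V : TopologicalSpace.Opens (EuclideanSpace ℝ (Fin n))) (r N : ℕ) (d : ℤ) :
    Set (Fin N → FunAlg V r) :=
  {x | ∃ d' : Fin N → ℤ, ∑ i, d' i = d ∧ ∀ i, x i ∈ funComp V r (d' i)}

theorem evenAt_mem_tensorDegree {N : ℕ} {d : ℤ} (i : Fin N) (D : FunAlg V r →ₗ[ℝ] FunAlg V r)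
    (a : ℤ) (hD : ∀ k, ∀ x ∈ funComp V r k, D x ∈ funComp V r (k - a))
    {x : ⨂[ℝ] _ : Fin N, FunAlg V r}
    (hx : x ∈ Submodule.span ℝ (PiTensorProduct.tprod ℝ '' tensorDegree V r N d)) :
    evenAt i D x ∈ Submodule.span ℝ (PiTensorProduct.tprod ℝ '' tensorDegree V r N (d - a)) := by
  refine funMap_tprod_mem _ ?_ hx
  rintro x ⟨d', hd, hx⟩
  refine ⟨d' - Pi.single i a, by simp [hd], fun j => ?_⟩
  by_cases h : j = i
  · subst h; simpa using hD _ _ (hx j)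
  · simpa [h] using hx j

theorem oddAt_mem_tensorDegree {N : ℕ} {d : ℤ} (i : Fin N) (D : FunAlg V r →ₗ[ℝ] FunAlg V r)
    (a : ℤ) (hD : ∀ k, ∀ x ∈ funComp V r k, D x ∈ funComp V r (k - a))
    {x : ⨂[ℝ] _ : Fin N, FunAlg V r}
    (hx : x ∈ Submodule.span ℝ (PiTensorProduct.tprod ℝ '' tensorDegree V r N d)) :
    oddAt i D x ∈ Submodule.span ℝ (PiTensorProduct.tprod ℝ '' tensorDegree V r N (d - a)) := by
  refine funMap_tprod_mem _ ?_ hx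
  rintro x ⟨d', hd, hx⟩
  refine ⟨d' - Pi.single i a, by simp [hd], fun j => ?_⟩
  by_cases h' : j < i
  · simpa [h', h'.ne] using parity_mem_funComp (hx j)
  by_cases h : j = i
  · subst h; simpa using hD _ _ (hx j)
  · simpa [h, h'] using hx j

/-- The degree drops by `0 + 2` for the pair of `x` and `p`, and by `1 + 1` for the pair of `ξ` and
`ζ`. -/
theorem edgeOp_mem_tensorDegree {N : ℕ} {d : ℤ} (e : Edge N) {x : ⨂[ℝ] _ : Fin N, FunAlg V r}
    (hx : x ∈ Submodule.span ℝ (PiTensorProduct.tprod ℝ '' tensorDegree V r N d)) :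
    edgeOp V r e x ∈ Submodule.span ℝ (PiTensorProduct.tprod ℝ '' tensorDegree V r N (d - 2)) := by
  rw [edgeOp]
  split_ifs
  · rw [LinearMap.sum_apply]
    refine sum_mem fun μ _ => ?_
    rw [← sub_zero (d - 2)]
    exact evenAt_mem_tensorDegree _ _ 0 (fun k x hx => by rw [sub_zero]; exact dx_mem μ hx)
      (evenAt_mem_tensorDegree _ _ 2 (fun k x hx => dp_mem μ hx) hx)
  · rw [LinearMap.sum_apply]
    refine sum_mem fun a _ => ?_
    rw [show d - 2 = d - 1 - 1 by ring]
    exact oddAt_mem_tensorDegree _ _ 1 (fun k x hx => dOdd_mem _ hx)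
      (oddAt_mem_tensorDegree _ _ 1 (fun k x hx => dOdd_mem _ hx) hx)

theorem list_prod_mem_funComp {N : ℕ} (d : Fin N → ℤ) (x : Fin N → FunAlg V r)
    (hx : ∀ i, x i ∈ funComp V r (d i)) : (List.ofFn x).prod ∈ funComp V r (∑ i, d i) := by
  induction N with
  | zero => simpa using one_mem_funComp
  | succ N ih =>
    rw [List.ofFn_succ, List.prod_cons, Fin.sum_univ_succ]
    exact mul_mem_funComp (hx 0) (ih _ _ fun i => hx i.succ)

theorem mulMap_mem_funComp {N : ℕ} {d : ℤ} {x : ⨂[ℝ] _ : Fin N, FunAlg V r}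
    (hx : x ∈ Submodule.span ℝ (PiTensorProduct.tprod ℝ '' tensorDegree V r N d)) :
    mulMap V r N x ∈ funComp V r d := by
  refine (Submodule.span_le (p := (funComp V r d).comap (mulMap V r N))).2 ?_ hx
  rintro _ ⟨x, ⟨d', rfl, hx'⟩, rfl⟩
  rw [SetLike.mem_coe, Submodule.mem_comap, mulMap, PiTensorProduct.lift.tprod, MultilinearMap.mkPiAlgebraFin_apply]
  exact list_prod_mem_funComp d' x hx'

theorem repGraph_mem_funComp {N : ℕ} (m : Edge N →₀ ℕ) (d : Fin N → ℤ) (x : Fin N → FunAlg V r)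
    (hx : ∀ i, x i ∈ funComp V r (d i)) :
    repGraph V r m x ∈ funComp V r (∑ i, d i - 2 * m.degree) := by
  have h : ∀ L : List (Edge N), (L.map (edgeOp V r)).prod (PiTensorProduct.tprod ℝ x) ∈
      Submodule.span ℝ (PiTensorProduct.tprod ℝ '' tensorDegree V r N
        (∑ i, d i - 2 * L.length)) := by
    intro L
    induction L with
    | nil => exact Submodule.subset_span ⟨x, ⟨d, by simp, hx⟩, rfl⟩
    | cons e L ih =>
      have := edgeOp_mem_tensorDegree e ih
      rw [List.map_cons, List.prod_cons, List.length_cons, Module.End.mul_apply]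
      convert this using 4
      push_cast; ring
  have := mulMap_mem_funComp (h (Finsupp.toMultiset m).toList)
  rw [Multiset.length_toList, Finsupp.card_toMultiset] at this
  exact this

/-- Families of functions one of which, in the place `i`, vanishes under `restrictTo T`. -/
def tensorKernel (V : TopologicalSpace.Opens (EuclideanSpace ℝ (Fin n)))
    (T : Set (Fin r ⊕ Fin r)) {N : ℕ} (i : Fin N) : Set (Fin N → FunAlg V r) :=
  {x | restrictTo T (x i) = 0}

theorem evenAt_mem_tensorKernel {T : Set (Fin r ⊕ Fin r)} {N : ℕ} {i : Fin N} (j : Fin N)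
    (D : FunAlg V r →ₗ[ℝ] FunAlg V r)
    (hD : i = j → ∀ x, restrictTo T x = 0 → restrictTo T (D x) = 0)
    {x : ⨂[ℝ] _ : Fin N, FunAlg V r}
    (hx : x ∈ Submodule.span ℝ (PiTensorProduct.tprod ℝ '' tensorKernel V T i)) :
    evenAt j D x ∈ Submodule.span ℝ (PiTensorProduct.tprod ℝ '' tensorKernel V T i) := by
  refine funMap_tprod_mem _ (fun x hx => ?_) hx
  have hx : restrictTo T (x i) = 0 := hx
  change restrictTo T _ = 0
  by_cases h : i = j
  · simpa [h] using hD h _ hx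
  · simpa [h] using hx

theorem oddAt_mem_tensorKernel {T : Set (Fin r ⊕ Fin r)} {N : ℕ} {i : Fin N} (j : Fin N)
    (D : FunAlg V r →ₗ[ℝ] FunAlg V r)
    (hD : i = j → ∀ x, restrictTo T x = 0 → restrictTo T (D x) = 0)
    {x : ⨂[ℝ] _ : Fin N, FunAlg V r}
    (hx : x ∈ Submodule.span ℝ (PiTensorProduct.tprod ℝ '' tensorKernel V T i)) :
    oddAt j D x ∈ Submodule.span ℝ (PiTensorProduct.tprod ℝ '' tensorKernel V T i) := by
  refine funMap_tprod_mem _ (fun x hx => ?_) hx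
  have hx : restrictTo T (x i) = 0 := hx
  change restrictTo T _ = 0
  by_cases h' : i < j
  · simp [h', restrictTo_parity, hx]
  by_cases h : i = j
  · simpa [h] using hD h _ hx
  · simpa [h, h'] using hx

/-- The odd coordinates that are not set to zero in the condition attached to a colour. -/
def Colour.odd (r : ℕ) : Colour → Set (Fin r ⊕ Fin r)
  | .black => Set.range Sum.inl
  | .red => Set.range Sum.inr

/-- Derivatives in the coordinates set to zero by the restriction act only at the head of the arrow
of colour `c`. Those acting at its tail, in `x` or in a surviving odd coordinate, commute with the
restriction. -/
theorem edgeOp_mem_tensorKernel (c : Colour) {N : ℕ} {i : Fin N} (e : Edge N) (he : e.head c ≠ i)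
    {x : ⨂[ℝ] _ : Fin N, FunAlg V r}
    (hx : x ∈ Submodule.span ℝ (PiTensorProduct.tprod ℝ '' tensorKernel V (c.odd r) i)) :
    edgeOp V r e x ∈
      Submodule.span ℝ (PiTensorProduct.tprod ℝ '' tensorKernel V (c.odd r) i) := by
  obtain ⟨s, t, b⟩ := e
  cases b
  · rw [edgeOp, if_neg Bool.false_ne_true, LinearMap.sum_apply]
    refine sum_mem fun a _ => ?_
    cases c with
    | black =>
      refine oddAt_mem_tensorKernel _ _ (fun _ y hy => ?_)
        (oddAt_mem_tensorKernel _ _ (fun h => absurd h.symm he) hx)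
      rw [dxi, restrictTo_dOdd (Colour.odd r .black) (s := Sum.inl a) ⟨a, rfl⟩, hy, map_zero]
    | red =>
      refine oddAt_mem_tensorKernel _ _ (fun h => absurd h.symm he)
        (oddAt_mem_tensorKernel _ _ (fun _ y hy => ?_) hx)
      rw [dzeta, restrictTo_dOdd (Colour.odd r .red) (s := Sum.inr a) ⟨a, rfl⟩, hy, map_zero]
  · rw [edgeOp, if_pos rfl, LinearMap.sum_apply]
    refine sum_mem fun μ _ => ?_
    refine evenAt_mem_tensorKernel _ _ (fun _ y hy => by rw [restrictTo_dx, hy, map_zero])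
      (evenAt_mem_tensorKernel _ _ (fun h => absurd h.symm ?_) hx)
    cases c <;> exact he

theorem restrictTo_mulMap {T : Set (Fin r ⊕ Fin r)} {N : ℕ} {i : Fin N}
    {x : ⨂[ℝ] _ : Fin N, FunAlg V r}
    (hx : x ∈ Submodule.span ℝ (PiTensorProduct.tprod ℝ '' tensorKernel V T i)) :
    restrictTo T (mulMap V r N x) = 0 := by
  refine (Submodule.span_le (p := (LinearMap.ker (restrictTo T).toLinearMap).comap
    (mulMap V r N))).2 ?_ hx
  rintro _ ⟨x, hx', rfl⟩
  have hx' : restrictTo T (x i) = 0 := hx'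
  change restrictTo T (mulMap V r N _) = 0
  rw [mulMap, PiTensorProduct.lift.tprod, MultilinearMap.mkPiAlgebraFin_apply, map_list_prod]
  refine List.prod_eq_zero ?_
  rw [List.map_ofFn, List.mem_ofFn]
  exact ⟨i, hx'⟩

/-- An oriented graph has a vertex without incoming arrows. -/
theorem IsOriented.exists_source {c : Colour} {N : ℕ} {m : Edge (N + 1) →₀ ℕ}
    (h : IsOriented c m) : ∃ i, ∀ e ∈ m.support, e.head c ≠ i := by
  set R : Fin (N + 1) → Fin (N + 1) → Prop := fun a b =>
    ∃ e ∈ m.support, e.tail c = a ∧ e.head c = b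
  have : IsTrans (Fin (N + 1)) (Relation.TransGen R) := ⟨fun _ _ _ => Relation.TransGen.trans⟩
  have : Std.Irrefl (Relation.TransGen R) := ⟨h⟩
  -- Without cycles, reachability is a strict order on a finite set, and a minimal vertex has no
  -- incoming arrow.
  have hw : WellFounded (Relation.TransGen R) := Finite.wellFounded_of_trans_of_irrefl _
  obtain ⟨i, -, hi⟩ := hw.has_min Set.univ ⟨0, trivial⟩
  exact ⟨i, fun e he hei => hi (e.tail c) trivial (Relation.TransGen.single ⟨e, he, rfl, hei⟩)⟩

/-- The factor at a vertex without incoming arrows of colour `c` stays in the kernel of the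
restriction under all edges, and the restriction is multiplicative. -/
theorem restrictTo_repGraph {c : Colour} {N : ℕ} {m : Edge (N + 1) →₀ ℕ} (h : IsOriented c m)
    (x : Fin (N + 1) → FunAlg V r) (hx : ∀ i, restrictTo (c.odd r) (x i) = 0) :
    restrictTo (c.odd r) (repGraph V r m x) = 0 := by
  obtain ⟨i, hi⟩ := h.exists_source
  have key : ∀ L : List (Edge (N + 1)), (∀ e ∈ L, e ∈ m.support) →
      (L.map (edgeOp V r)).prod (PiTensorProduct.tprod ℝ x) ∈
        Submodule.span ℝ (PiTensorProduct.tprod ℝ '' tensorKernel V (c.odd r) i) := by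
    intro L hL
    induction L with
    | nil => exact Submodule.subset_span ⟨x, hx i, rfl⟩
    | cons e L ih =>
      rw [List.map_cons, List.prod_cons, Module.End.mul_apply]
      exact edgeOp_mem_tensorKernel c e (hi e (hL e (by simp)))
        (ih fun e he => hL e (by simp [he]))
  refine restrictTo_mulMap (key _ fun e he => ?_)
  rwa [Multiset.mem_toList, Finsupp.mem_toMultiset] at he

/-! ## The gradings of the subalgebras -/

theorem PoissonSubspace.isParityGrading (B : PoissonSubspace V r) (o : Set Colour)
    (hB : ∀ x, x ∈ B.space ↔ ∀ c ∈ o, restrictTo (c.odd r) x = 0) :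
    IsParityGrading (fun k => (funComp V r (k + 2)).comap B.space.subtype)
      (parity.restrict B.parity_mem) where
  parity k x hx := by
    refine Subtype.ext ?_
    have := parity_of_mem (Submodule.mem_comap.1 hx)
    rw [Int.negOnePow_add, Int.negOnePow_even 2 even_two, mul_one] at this
    exact this
  span := by
    refine eq_top_iff.2 fun x _ => ?_
    have hm : ∀ i j, funProj i j (x : FunAlg V r) ∈ B.space := fun i j => (hB _).2 fun c hc => by
      rw [restrictTo_funProj, (hB _).1 x.2 c hc, map_zero]
    obtain ⟨m, hx⟩ := exists_sum_funProj (x : FunAlg V r)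
    have e : x = ∑ i ∈ Finset.range m, ∑ j ∈ Finset.range m,
        (⟨funProj i j (x : FunAlg V r), hm i j⟩ : B.space) := by
      refine Subtype.ext ?_
      conv_lhs => rw [← hx m le_rfl]
      simp
    rw [e]
    refine sum_mem fun i _ => sum_mem fun j _ => ?_
    -- The shift by `2` is the suspension of `B[2]`.
    refine Submodule.mem_iSup_of_mem (2 * (i : ℤ) + j - 2) ?_
    rw [Submodule.mem_comap, sub_add_cancel]
    exact funProj_mem i j _

end Degree

/-! ## A faithful representation of the graph operad -/

section Model

variable {n : ℕ}

/-- The coefficients of the faithful representation: polynomials in `t_1, …, t_n` whose coefficients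
are linear combinations of graphs. -/
abbrev ModelCoeff (n : ℕ) : Type := MvPolynomial (Fin n) (Gra n)

/-- The derivation `b t_a ∂/∂t_a`. -/
def scaledEuler (b : Gra n) (a : Fin n) : Derivation (Gra n) (ModelCoeff n) (ModelCoeff n) :=
  MvPolynomial.mkDerivation (Gra n) fun i =>
    if a = i then (MvPolynomial.C b * MvPolynomial.X i : ModelCoeff n) else 0

theorem scaledEuler_X (b : Gra n) (a i : Fin n) :
    scaledEuler b a (MvPolynomial.X i) = if a = i then MvPolynomial.C b * MvPolynomial.X i else 0 :=
  MvPolynomial.mkDerivation_X _ _ _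

/-- The coefficients `b` are constants for these derivations, and the Euler fields `t_a ∂/∂t_a`
commute. -/
theorem scaledEuler_comm (b b' : Gra n) (a a' : Fin n) (q : ModelCoeff n) :
    scaledEuler b a (scaledEuler b' a' q) = scaledEuler b' a' (scaledEuler b a q) := by
  refine derivation_comm_of_X _ _ (fun i => ?_) q
  have hC : ∀ (b c : Gra n) (a : Fin n) (q : ModelCoeff n),
      scaledEuler b a (MvPolynomial.C c * q) = MvPolynomial.C c * scaledEuler b a q := by
    intro b c a q
    rw [MvPolynomial.C_mul', Derivation.map_smul, MvPolynomial.C_mul']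
  rw [scaledEuler_X, scaledEuler_X]
  split_ifs with h h' h'
  · rw [hC, hC, scaledEuler_X, scaledEuler_X, if_pos h, if_pos h']; ring
  · rw [map_zero, hC, scaledEuler_X, if_neg h', mul_zero]
  · rw [map_zero, hC, scaledEuler_X, if_neg h, mul_zero]
  · rw [map_zero, map_zero]

/-- The derivation `b t_a ∂/∂t_a` as an operator attached to an end of an edge. -/
def eulerOp (b : Gra n) (a : Fin n) : SiteOp (ModelCoeff n) PUnit :=
  .even ((scaledEuler b a).restrictScalars ℝ)

theorem eulerOp_act (b : Gra n) (a : Fin n) (q : ModelCoeff n) (w : ExteriorAlgebra ℝ PUnit) :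
    (eulerOp b a).act (q ⊗ₜ w) = scaledEuler b a q ⊗ₜ w := rfl

theorem eulerOp_isOdd (b : Gra n) (a : Fin n) : (eulerOp b a).isOdd = false := rfl

theorem eulerOp_compatible (b b' : Gra n) (a a' : Fin n) :
    (eulerOp b a).Compatible (eulerOp b' a') := scaledEuler_comm b b' a a'

/-- The operators attached to the edges in the faithful representation. -/
def modelOps (n : ℕ) : EdgeOps (ModelCoeff n) PUnit where
  K _ := Fin n × Fin n
  fintype _ := inferInstance
  fst s k := eulerOp (MvPolynomial.X ⟨k.1, k.2, s⟩) k.1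
  snd _ k := eulerOp 1 k.2
  isOdd_eq s k := (eulerOp_isOdd (MvPolynomial.X ⟨k.1, k.2, s⟩) k.1).trans
    (eulerOp_isOdd 1 k.2).symm
  fst_fst s k s' k' := eulerOp_compatible (MvPolynomial.X ⟨k.1, k.2, s⟩) (MvPolynomial.X ⟨k'.1, k'.2, s'⟩) k.1 k'.1
  fst_snd s k _ k' := eulerOp_compatible (MvPolynomial.X ⟨k.1, k.2, s⟩) (1) k.1 k'.2
  snd_fst _ k s' k' := eulerOp_compatible (1) (MvPolynomial.X ⟨k'.1, k'.2, s'⟩) k.2 k'.1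
  snd_snd _ k _ k' := eulerOp_compatible (1) (1) k.2 k'.2

/-- The space of odd coordinates is zero, so everything is even. -/
theorem sparity_model {C : Type} [CommRing C] [Algebra ℝ C] (x : SuperAlg C PUnit) :
    sparity x = x := by
  induction x using superAlg_induction with
  | add x y hx hy => rw [map_add, hx, hy]
  | tmul b w =>
    rw [sparity_tmul]
    congr 1
    induction w using exterior_induction with
    | algebraMap c => rw [AlgHom.commutes]
    | add x y hx hy => rw [map_add, hx, hy]
    | ι_mul x v hx => rw [map_mul, invol_ι, Subsingleton.elim v 0, map_zero, neg_zero, zero_mul,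
        zero_mul]

/-- `x` is an eigenvector, with eigenvalues `l a`, of all `t_a ∂/∂t_a`. -/
def IsEulerEigen (l : Fin n → Gra n) (x : ModelCoeff n) : Prop :=
  ∀ b a, scaledEuler b a x = MvPolynomial.C (b * l a) * x

theorem IsEulerEigen.C_mul {l : Fin n → Gra n} {x : ModelCoeff n} (hx : IsEulerEigen l x)
    (b : Gra n) : IsEulerEigen l (MvPolynomial.C b * x) := fun c a => by
  rw [MvPolynomial.C_mul', Derivation.map_smul, hx, mul_smul_comm]

theorem IsEulerEigen.mul {l l' : Fin n → Gra n} {x x' : ModelCoeff n} (hx : IsEulerEigen l x)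
    (hx' : IsEulerEigen l' x') : IsEulerEigen (l + l') (x * x') := fun b a => by
  rw [Derivation.leibniz, hx, hx', smul_eq_mul, smul_eq_mul, Pi.add_apply, mul_add, map_add]
  ring

theorem isEulerEigen_X (i : Fin n) :
    IsEulerEigen (Pi.single i 1) (MvPolynomial.X i : ModelCoeff n) := fun b a => by
  rw [scaledEuler_X, Pi.single_apply]
  split_ifs <;> simp

/-- The substitution giving the action of graphs on eigenvectors. -/
def eigenAeval {N : ℕ} (l : Fin N → Fin n → Gra n) : Gra N →ₐ[ℝ] Gra n :=
  MvPolynomial.aeval fun e => ∑ k : Fin n × Fin n,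
    MvPolynomial.X ⟨k.1, k.2, e.aligned⟩ * l e.src k.1 * l e.tgt k.2

theorem act_prodIncl_scaledEuler {N : ℕ} {l : Fin N → Fin n → Gra n} {x : Fin N → ModelCoeff n}
    (hx : ∀ i, IsEulerEigen (l i) (x i)) (b : Gra n) (a : Fin n) (i : Fin N) :
    ((eulerOp b a).at i).act
        (EdgeOps.prodIncl (ModelCoeff n) PUnit N fun j => x j ⊗ₜ 1) =
      EdgeOps.prodIncl (ModelCoeff n) PUnit N fun j =>
        (MvPolynomial.C (if j = i then b * l i a else 1) * x j) ⊗ₜ 1 := by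
  rw [EdgeOps.act_prodIncl]
  congr 1
  funext j
  by_cases h : j = i
  · subst h
    simp only [lt_irrefl, if_false, if_true, eulerOp_act, hx j b a]
  · simp only [h, if_false, map_one, one_mul]
    split_ifs <;> rfl

theorem IsEulerEigen.scale {N : ℕ} {l : Fin N → Fin n → Gra n} {x : Fin N → ModelCoeff n}
    (hx : ∀ i, IsEulerEigen (l i) (x i)) (b : Fin N → Gra n) (i : Fin N) :
    IsEulerEigen (l i) (MvPolynomial.C (b i) * x i) := (hx i).C_mul (b i)

/-- On joint eigenvectors of the Euler fields each edge acts as multiplication by a constant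
determined by the eigenvalues at its ends, so a graph acts by substituting these constants for its
edges. -/
theorem modelOps_rep {N : ℕ} (γ : Gra N) (l : Fin N → Fin n → Gra n) (x : Fin N → ModelCoeff n)
    (hx : ∀ i, IsEulerEigen (l i) (x i)) :
    (modelOps n).rep N γ (fun i => x i ⊗ₜ 1) =
      (MvPolynomial.C (eigenAeval l γ) * ∏ i, x i) ⊗ₜ 1 := by
  induction γ using MvPolynomial.induction_on generalizing x with
  | C r =>
    have h1 : (modelOps n).rep N 1 (fun i => x i ⊗ₜ 1) = (∏ i, x i) ⊗ₜ 1 := by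
      rw [EdgeOps.rep_apply, map_one, Module.End.one_apply, EdgeOps.prodIncl_apply, map_list_prod,
        List.map_ofFn, ← List.prod_ofFn]
      have : (mulAll (Fin N) (ModelCoeff n) PUnit) ∘
          (fun i => incl (ModelCoeff n) PUnit i (x i ⊗ₜ 1)) =
            (Algebra.TensorProduct.includeLeft (R := ℝ) (S := ℝ)
              (B := ExteriorAlgebra ℝ PUnit)) ∘ x :=
        funext fun i => mulAll_incl i _
      rw [this, ← List.map_ofFn, ← map_list_prod]
      rfl
    rw [← MvPolynomial.algebraMap_eq, Algebra.algebraMap_eq_smul_one, map_smul,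
      smul_apply, h1, map_smul, map_one, TensorProduct.smul_tmul', Algebra.smul_def r (1 : Gra n),
      mul_one, ← MvPolynomial.algebraMap_eq, ← Algebra.smul_def, algebraMap_smul]
  | add p q hp hq =>
    rw [map_add, add_apply, hp x hx, hq x hx, map_add, map_add, add_mul, TensorProduct.add_tmul]
  | mul_X p e hp =>
    have h : (modelOps n).rep N (p * MvPolynomial.X e) (fun i => x i ⊗ₜ 1) =
        ∑ k : Fin n × Fin n, (modelOps n).rep N p (fun i =>
          (MvPolynomial.C (if i = e.src then MvPolynomial.X ⟨k.1, k.2, e.aligned⟩ * l e.src k.1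
            else 1) * (MvPolynomial.C (if i = e.tgt then 1 * l e.tgt k.2 else 1) * x i)) ⊗ₜ 1) := by
      rw [EdgeOps.rep_apply, map_mul, Module.End.mul_apply, EdgeOps.rho_X, EdgeOps.edge_apply,
        map_sum, map_sum]
      refine Finset.sum_congr rfl fun k _ => ?_
      rw [EdgeOps.rep_apply, ← act_prodIncl_scaledEuler (IsEulerEigen.scale hx _),
        ← act_prodIncl_scaledEuler hx]
      rfl
    rw [h, map_mul, eigenAeval, MvPolynomial.aeval_X, ← eigenAeval, Finset.mul_sum, map_sum, Finset.sum_mul,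
      TensorProduct.sum_tmul]
    refine Finset.sum_congr rfl fun k _ => ?_
    rw [hp _ (IsEulerEigen.scale (IsEulerEigen.scale hx _) _), Finset.prod_mul_distrib,
      Finset.prod_mul_distrib, ← map_prod, ← map_prod, Finset.prod_ite_eq', Finset.prod_ite_eq',
      if_pos (Finset.mem_univ _), if_pos (Finset.mem_univ _)]
    congr 1
    simp only [map_mul, one_mul, eigenAeval]
    ring

theorem tmul_one_injective {C : Type} [CommRing C] [Algebra ℝ C] {x y : C}
    (h : (x ⊗ₜ[ℝ] 1 : SuperAlg C PUnit) = y ⊗ₜ 1) : x = y := by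
  have := congrArg (TensorProduct.rid ℝ C ∘ TensorProduct.map LinearMap.id
    (ExteriorAlgebra.algebraMapInv (R := ℝ) (M := PUnit)).toLinearMap) h
  simpa using this

/-- The variable `t_i` has eigenvalue `1` for its own Euler field and `0` for the others, so in the
sum for an edge only the term of its actual ends survives. -/
theorem eigenAeval_single (γ : Gra n) :
    eigenAeval (fun i : Fin n => (Pi.single i 1 : Fin n → Gra n)) γ = γ := by
  have : eigenAeval (fun i : Fin n => (Pi.single i 1 : Fin n → Gra n)) = AlgHom.id ℝ _ := by
    refine MvPolynomial.algHom_ext fun e => ?_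
    rw [eigenAeval, MvPolynomial.aeval_X, Finset.sum_eq_single (e.src, e.tgt)]
    · simp
    · intro k _ hk
      by_cases h1 : k.1 = e.src
      · have h2 : k.2 ≠ e.tgt := fun h2 => hk (Prod.ext h1 h2)
        rw [Pi.single_eq_of_ne h2, mul_zero]
      · rw [Pi.single_eq_of_ne h1, mul_zero, zero_mul]
    · exact fun h => absurd (Finset.mem_univ _) h
  rw [this, AlgHom.id_apply]

/-- The generators on which the faithful representation is evaluated. -/
def modelVar (i : Fin n) : SuperAlg (ModelCoeff n) PUnit := (MvPolynomial.X i) ⊗ₜ 1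

theorem modelOps_rep_var (γ : Gra n) : (modelOps n).rep n γ modelVar =
    (MvPolynomial.C γ * ∏ i, MvPolynomial.X i) ⊗ₜ 1 := by
  have := modelOps_rep γ _ _ (fun i : Fin n => isEulerEigen_X i)
  rwa [eigenAeval_single] at this

theorem eq_zero_of_modelOps_rep {γ : Gra n} (h : (modelOps n).rep n γ modelVar = 0) : γ = 0 := by
  rw [modelOps_rep_var, ← TensorProduct.zero_tmul _ (1 : ExteriorAlgebra ℝ PUnit)] at h
  have := tmul_one_injective h
  have hX : (∏ i : Fin n, (MvPolynomial.X i : ModelCoeff n)) ≠ 0 :=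
    Finset.prod_ne_zero_iff.2 fun i _ => MvPolynomial.X_ne_zero i
  exact MvPolynomial.C_eq_zero.1 ((mul_eq_zero.1 this).resolve_right hX)

/-- Faithfulness in the arity equal to the number of variables: the value on `t_1, …, t_n` has `γ`
as its coefficient. -/
theorem modelOps_rep_injective : Function.Injective ((modelOps n).rep n) := by
  rw [← LinearMap.ker_eq_bot, LinearMap.ker_eq_bot']
  exact fun γ h => eq_zero_of_modelOps_rep (by rw [h]; rfl)

end Model

/-! ## The Lie bracket of graphs -/

section GraphBracket

theorem insertGraph_zero_left {N : ℕ} (S : Finset (Fin N)) (γ' : Gra S.card) :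
    insertGraph S 0 γ' = 0 := by rw [insertGraph, map_zero, zero_mul]

theorem insertGraph_zero_right {N : ℕ} (S : Finset (Fin N)) (γ : Gra (Sᶜ.card + 1)) :
    insertGraph S γ 0 = 0 := by rw [insertGraph, map_zero, mul_zero]

/-- The composition of graphs as a bilinear map. -/
def graphCompBilin : (∀ N, Gra N) →ₗ[ℝ] (∀ N, Gra N) →ₗ[ℝ] ∀ N, Gra N :=
  LinearMap.mk₂ ℝ graphComp
    (fun γ γ₁ γ' => by
      funext N
      simp only [graphComp, Pi.add_apply, ← Finset.sum_add_distrib, ← smul_add, insertGraph,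
        map_add, add_mul])
    (fun c γ γ' => by
      funext N
      simp only [graphComp, Pi.smul_apply, Finset.smul_sum, smul_comm c, insertGraph,
        map_smul, smul_mul_assoc])
    (fun γ γ' γ₁ => by
      funext N
      simp only [graphComp, Pi.add_apply, ← Finset.sum_add_distrib, ← smul_add, insertGraph,
        map_add, mul_add])
    (fun c γ γ' => by
      funext N
      simp only [graphComp, Pi.smul_apply, Finset.smul_sum, smul_comm c, insertGraph,
        map_smul, mul_smul_comm])

theorem graphBracket_add_left (i j : ℤ) (γ γ₁ γ' : ∀ N, Gra N) :
    graphBracket i j (γ + γ₁) γ' = graphBracket i j γ γ' + graphBracket i j γ₁ γ' := by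
  have h1 := LinearMap.congr_fun (map_add graphCompBilin γ γ₁) γ'
  have h2 := map_add (graphCompBilin γ') γ γ₁
  change graphComp _ _ = graphComp _ _ + graphComp _ _ at h1 h2
  simp only [graphBracket, h1, h2, smul_add]
  abel

theorem graphBracket_smul_left (i j : ℤ) (c : ℝ) (γ γ' : ∀ N, Gra N) :
    graphBracket i j (c • γ) γ' = c • graphBracket i j γ γ' := by
  have h1 := LinearMap.congr_fun (map_smul graphCompBilin c γ) γ'
  have h2 := map_smul (graphCompBilin γ') c γ
  change graphComp _ _ = c • graphComp _ _ at h1 h2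
  simp only [graphBracket, h1, h2, smul_sub, smul_comm c]

theorem graphBracket_antisymm (i j : ℤ) (γ γ' : ∀ N, Gra N) :
    graphBracket i j γ γ' = -((i * j).negOnePow • graphBracket j i γ' γ) := by
  simp only [graphBracket, smul_sub, ← mul_smul, mul_comm j i, Int.units_mul_self, one_smul,
    neg_sub]

/-- The components of a family of graphs of degree `D`, with an even number of degrees coming from
the edges, and antisymmetric under permutations of the vertices. -/
structure IsGraphCochain (D : ℤ) (γ : ∀ N, Gra N) : Prop where
  even : ∀ N, γ N ≠ 0 → Even (D - ((N : ℤ) - 1))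
  relabel : ∀ (N : ℕ) (σ : Equiv.Perm (Fin N)), relabel σ (γ N) = Equiv.Perm.sign σ • γ N

theorem even_graphComp {i j : ℤ} {γ γ' : ∀ N, Gra N}
    (h : ∀ N, γ N ≠ 0 → Even (i - ((N : ℤ) - 1)))
    (h' : ∀ N, γ' N ≠ 0 → Even (j - ((N : ℤ) - 1))) (N : ℕ) (hN : graphComp γ γ' N ≠ 0) :
    Even (i + j - ((N : ℤ) - 1)) := by
  obtain ⟨S, -, hS⟩ := Finset.exists_ne_zero_of_sum_ne_zero hN
  have h1 := h (Sᶜ.card + 1) fun h0 => hS (by rw [h0, insertGraph_zero_left, smul_zero])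
  have h2 := h' S.card fun h0 => hS (by rw [h0, insertGraph_zero_right, smul_zero])
  have h3 : Sᶜ.card + S.card = N := by
    rw [add_comm, Finset.card_add_card_compl, Fintype.card_fin]
  obtain ⟨u, hu⟩ := h1
  obtain ⟨v, hv⟩ := h2
  exact ⟨u + v, by push_cast at hu hv; omega⟩

theorem even_graphBracket {i j : ℤ} {γ γ' : ∀ N, Gra N}
    (h : ∀ N, γ N ≠ 0 → Even (i - ((N : ℤ) - 1)))
    (h' : ∀ N, γ' N ≠ 0 → Even (j - ((N : ℤ) - 1))) (N : ℕ) (hN : graphBracket i j γ γ' N ≠ 0) :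
    Even (i + j - ((N : ℤ) - 1)) := by
  by_cases h1 : graphComp γ γ' N = 0
  · refine add_comm i j ▸ even_graphComp h' h N fun h2 => hN ?_
    rw [graphBracket, Pi.sub_apply, Pi.smul_apply, h1, h2, smul_zero, sub_zero]
  · exact even_graphComp h h' N h1

variable {C W : Type} [CommRing C] [Algebra ℝ C] [AddCommGroup W] [Module ℝ W]

/-- The family of operations defined by a family of graphs. -/
def EdgeOps.repFamily (E : EdgeOps C W) : (∀ N, Gra N) →ₗ[ℝ] Cochain (SuperAlg C W) :=
  LinearMap.pi fun N => E.rep N ∘ₗ LinearMap.proj N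

theorem EdgeOps.repFamily_apply (E : EdgeOps C W) (γ : ∀ N, Gra N) (N : ℕ) :
    E.repFamily γ N = E.rep N (γ N) := rfl

theorem EdgeOps.repFamily_graphBracket (E : EdgeOps C W) {i j : ℤ} {γ γ' : ∀ N, Gra N}
    (h : ∀ N, γ N ≠ 0 → Even (i - ((N : ℤ) - 1)))
    (h' : ∀ N, γ' N ≠ 0 → Even (j - ((N : ℤ) - 1))) :
    E.repFamily (graphBracket i j γ γ') =
      nrBracket (sparity (B := C) (U := W)).toLinearMap i j (E.repFamily γ) (E.repFamily γ') := by
  have h1 : E.repFamily (graphComp γ γ') = nrComp (sparity (B := C) (U := W)).toLinearMap j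
    (E.repFamily γ) (E.repFamily γ') := E.rep_graphComp j γ γ' h'
  have h2 : E.repFamily (graphComp γ' γ) = nrComp (sparity (B := C) (U := W)).toLinearMap i
    (E.repFamily γ') (E.repFamily γ) := E.rep_graphComp i γ' γ h
  rw [graphBracket, map_sub, Units.smul_def, map_zsmul, h1, h2, ← Units.smul_def, nrBracket]

theorem hasParity_of_negOnePow {x : SuperAlg C W} {a : ℤ} (h : sparity x = a.negOnePow • x) :
    EdgeOps.HasParity x (decide (Odd a)) := by
  rw [EdgeOps.HasParity, h]
  by_cases ha : Odd a
  · simp [Int.negOnePow_odd a ha, ha]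
  · simp [Int.negOnePow_even a (Int.not_odd_iff_even.1 ha), ha]

theorem EdgeOps.rep_comp_swap_of_relabel (E : EdgeOps C W) {N : ℕ} {γ : Gra N}
    (hγ : ∀ σ : Equiv.Perm (Fin N), LieBialgebroid.relabel σ γ = Equiv.Perm.sign σ • γ)
    (i j : Fin N) (hij : (i : ℕ) + 1 = j) (x : Fin N → SuperAlg C W) {a b : ℤ}
    (hi : sparity (x i) = a.negOnePow • x i) (hj : sparity (x j) = b.negOnePow • x j) :
    E.rep N γ (x ∘ Equiv.swap i j) = -((a * b).negOnePow • E.rep N γ x) := by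
  have hne : i ≠ j := fun h => by rw [h] at hij; omega
  have e : E.rep N (-γ) x = -E.rep N γ x := by rw [map_neg, neg_apply]
  rw [E.rep_comp_swap γ i j hij x (hasParity_of_negOnePow hi) (hasParity_of_negOnePow hj), hγ,
    Equiv.Perm.sign_swap hne, Units.neg_smul, one_smul, e, smul_neg]
  congr 2
  by_cases h : Odd (a * b)
  · rw [Int.negOnePow_odd _ h, if_pos (by simpa using Int.odd_mul.1 h)]
  · rw [Int.negOnePow_even _ (Int.not_odd_iff_even.1 h),
      if_neg (by simpa [-not_and] using fun h' => h (Int.odd_mul.2 h'))]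

/-- The grading of a vector space concentrated in even degrees, with the same space in all of
them. -/
def evenGrading (g : Type) [AddCommGroup g] [Module ℝ g] (k : ℤ) : Submodule ℝ g :=
  if Even k then ⊤ else ⊥

theorem isParityGrading_evenGrading :
    IsParityGrading (evenGrading (SuperAlg C PUnit))
      (sparity (B := C) (U := PUnit)).toLinearMap where
  parity k x hx := by
    by_cases hk : Even k
    · rw [Int.negOnePow_even k hk, one_smul]
      exact sparity_model x
    · rw [evenGrading, if_neg hk, Submodule.mem_bot] at hx
      rw [hx, map_zero, smul_zero]
  span := eq_top_iff.2 (le_iSup_of_le 0 (by rw [evenGrading, if_pos (by simp)]))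

/-- The arguments are purely even while the operations may have any even degree. The grading with
the same space in all even degrees accommodates this; the theory of cochains uses only that the
components span and that the parity is right, not that the sum is direct. -/
theorem EdgeOps.repFamily_mem_ceComp (E : EdgeOps C PUnit) {D : ℤ} {γ : ∀ N, Gra N}
    (hγ : IsGraphCochain D γ) :
    E.repFamily γ ∈ ceComp (evenGrading (SuperAlg C PUnit)) D := by
  refine ⟨fun N d x hx => ?_, fun N i j hij a b x hi hj =>
    E.rep_comp_swap_of_relabel (hγ.relabel N) i j hij x
      (isParityGrading_evenGrading.parity a _ hi) (isParityGrading_evenGrading.parity b _ hj)⟩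
  by_cases h0 : γ N = 0
  · rw [E.repFamily_apply, h0, map_zero]; exact zero_mem _
  by_cases hd : ∀ i, Even (d i)
  · rw [evenGrading, if_pos]
    · exact Submodule.mem_top
    · exact (Finset.sum_induction _ Even (fun _ _ => Even.add) (by simp) fun i _ => hd i).add
        (hγ.even N h0)
  · obtain ⟨i, hi⟩ := not_forall.1 hd
    have h := hx i
    rw [evenGrading, if_neg hi, Submodule.mem_bot] at h
    rw [MultilinearMap.map_coord_zero _ i h]
    exact zero_mem _

theorem relabel_trans {M N K : ℕ} (f : Fin M → Fin N) (h : Fin N → Fin K) (γ : Gra M) :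
    relabel h (relabel f γ) = relabel (h ∘ f) γ := by
  rw [relabel, relabel, relabel, MvPolynomial.rename_rename]
  rfl

theorem relabel_id {N : ℕ} (γ : Gra N) : relabel id γ = γ := by
  rw [relabel]
  exact MvPolynomial.rename_id_apply γ

/-- Adjacent transpositions generate the symmetric group. -/
theorem relabel_eq_sign_smul {N : ℕ} {γ : Gra N}
    (h : ∀ i j : Fin N, (i : ℕ) + 1 = j → relabel (Equiv.swap i j) γ = -γ)
    (σ : Equiv.Perm (Fin N)) : relabel σ γ = Equiv.Perm.sign σ • γ := by
  cases N with
  | zero => rw [Subsingleton.elim σ 1, map_one, one_smul]; exact relabel_id γ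
  | succ N =>
    have hσ : σ ∈ Submonoid.closure
        (Set.range fun i : Fin N => Equiv.swap i.castSucc i.succ) := by
      rw [Equiv.Perm.mclosure_swap_castSucc_succ]; trivial
    induction hσ using Submonoid.closure_induction with
    | mem σ hσ =>
      obtain ⟨i, rfl⟩ := hσ
      rw [h _ _ (by simp), Equiv.Perm.sign_swap (Fin.castSucc_lt_succ).ne, Units.neg_smul, one_smul]
    | one => rw [map_one, one_smul]; exact relabel_id γ
    | mul σ τ _ _ hσ hτ =>
      rw [Equiv.Perm.coe_mul, ← relabel_trans, hτ, map_mul, Units.smul_def, map_zsmul, hσ,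
        ← Units.smul_def, ← mul_smul, mul_comm]

/-- Antisymmetry under relabelling is read off from the antisymmetry of the bracket of cochains in
the faithful model, where a swap of two even arguments costs only the signature. -/
theorem IsGraphCochain.bracket {i j : ℤ} {γ γ' : ∀ N, Gra N} (h : IsGraphCochain i γ)
    (h' : IsGraphCochain j γ') : IsGraphCochain (i + j) (graphBracket i j γ γ') := by
  refine ⟨even_graphBracket h.even h'.even, fun N => relabel_eq_sign_smul fun k l hkl => ?_⟩
  have hm := nrBracket_mem isParityGrading_evenGrading ((modelOps N).repFamily_mem_ceComp h)
    ((modelOps N).repFamily_mem_ceComp h')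
  rw [← (modelOps N).repFamily_graphBracket h.even h'.even] at hm
  have h0 : ∀ y : SuperAlg (ModelCoeff N) PUnit, y ∈ evenGrading _ 0 := fun y => by
    rw [evenGrading, if_pos (by simp)]; trivial
  have hp : ∀ y : SuperAlg (ModelCoeff N) PUnit, EdgeOps.HasParity y false := fun y => sparity_model y
  refine modelOps_rep_injective (MultilinearMap.ext fun x => ?_)
  have e := hm.2 N k l hkl 0 0 x (h0 _) (h0 _)
  rw [EdgeOps.repFamily_apply, EdgeOps.rep_comp_swap _ _ k l hkl x (hp _) (hp _)] at e
  simpa using e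

/-- In arity `N` the model with `N` variables is faithful, and it maps the identity to the Jacobi
identity for cochains. -/
theorem graphBracket_jacobi {i j k : ℤ} {γ γ' γ'' : ∀ N, Gra N} (h : IsGraphCochain i γ)
    (h' : IsGraphCochain j γ') (h'' : IsGraphCochain k γ'') :
    graphBracket i (j + k) γ (graphBracket j k γ' γ'') =
      graphBracket (i + j) k (graphBracket i j γ γ') γ'' +
        (i * j).negOnePow • graphBracket j (i + k) γ' (graphBracket i k γ γ'') := by
  funext N
  refine modelOps_rep_injective ?_
  have := nrBracket_jacobi isParityGrading_evenGrading ((modelOps N).repFamily_mem_ceComp h)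
    ((modelOps N).repFamily_mem_ceComp h') ((modelOps N).repFamily_mem_ceComp h'')
  simp only [← (modelOps N).repFamily_graphBracket h.even h'.even,
    ← (modelOps N).repFamily_graphBracket h.even h''.even,
    ← (modelOps N).repFamily_graphBracket h'.even h''.even,
    ← (modelOps N).repFamily_graphBracket h.even (h'.bracket h'').even,
    ← (modelOps N).repFamily_graphBracket (h.bracket h').even h''.even,
    ← (modelOps N).repFamily_graphBracket h'.even (h.bracket h'').even, Units.smul_def] at this
  rw [← map_zsmul, ← map_add] at this
  rw [Units.smul_def]
  exact congrFun this N

end GraphBracket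

/-! ## Substitution of graphs into graphs -/

section Substitution

/-- The edge obtained by applying a map to the vertices. -/
def Edge.map {M N : ℕ} (f : Fin M → Fin N) (e : Edge M) : Edge N := ⟨f e.src, f e.tgt, e.aligned⟩

theorem Edge.head_map {M N : ℕ} (f : Fin M → Fin N) (e : Edge M) (c : Colour) :
    (e.map f).head c = f (e.head c) := by
  obtain ⟨s, t, b⟩ := e
  cases c <;> cases b <;> rfl

theorem Edge.tail_map {M N : ℕ} (f : Fin M → Fin N) (e : Edge M) (c : Colour) :
    (e.map f).tail c = f (e.tail c) := by
  obtain ⟨s, t, b⟩ := e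
  cases c <;> cases b <;> rfl

theorem coeff_mul_ne_zero {σ : Type} {p q : MvPolynomial σ ℝ} {m : σ →₀ ℕ}
    (h : (p * q).coeff m ≠ 0) : ∃ m₁ m₂, m = m₁ + m₂ ∧ p.coeff m₁ ≠ 0 ∧ q.coeff m₂ ≠ 0 := by
  classical
  rw [MvPolynomial.coeff_mul] at h
  obtain ⟨x, hx, h⟩ := Finset.exists_ne_zero_of_sum_ne_zero h
  exact ⟨x.1, x.2, (Finset.HasAntidiagonal.mem_antidiagonal.1 hx).symm, left_ne_zero_of_mul h,
    right_ne_zero_of_mul h⟩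

/-- Contracting vertices along `π` undoes every reconnection: each graph in the blow-up of `u`
projects back to `u`. -/
theorem coeff_blowUp_monomial {M N : ℕ} (π : Fin N → Fin M) (u : Edge M →₀ ℕ) (m : Edge N →₀ ℕ)
    (h : (blowUp π (MvPolynomial.monomial u 1)).coeff m ≠ 0) : m.mapDomain (Edge.map π) = u := by
  classical
  have add : ∀ u v : Edge M →₀ ℕ,
      (∀ m, (blowUp π (MvPolynomial.monomial u 1)).coeff m ≠ 0 → m.mapDomain (Edge.map π) = u) →
      (∀ m, (blowUp π (MvPolynomial.monomial v 1)).coeff m ≠ 0 → m.mapDomain (Edge.map π) = v) →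
      ∀ m, (blowUp π (MvPolynomial.monomial (u + v) 1)).coeff m ≠ 0 →
        m.mapDomain (Edge.map π) = u + v := by
    intro u v hu hv m hm
    rw [← one_mul (1 : ℝ), ← MvPolynomial.monomial_mul, map_mul] at hm
    obtain ⟨m₁, m₂, rfl, h₁, h₂⟩ := coeff_mul_ne_zero hm
    rw [Finsupp.mapDomain_add, hu _ h₁, hv _ h₂]
  have zero : ∀ m, (blowUp π (MvPolynomial.monomial 0 1)).coeff m ≠ 0 →
      m.mapDomain (Edge.map π) = 0 := by
    intro m hm
    have h1 : blowUp π (MvPolynomial.monomial 0 1) = 1 := map_one _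
    rw [h1, MvPolynomial.coeff_one] at hm
    rw [← (ite_ne_right_iff.1 hm).1, Finsupp.mapDomain_zero]
  induction u using Finsupp.induction_linear generalizing m with
  | zero => exact zero m h
  | add u v hu hv => exact add u v hu hv m h
  | single e k =>
    induction k generalizing m with
    | zero =>
      rw [Finsupp.single_zero] at h ⊢
      exact zero m h
    | succ k ih =>
      rw [Finsupp.single_add] at h ⊢
      refine add _ _ ih (fun m hm => ?_) m h
      have h1 : blowUp π (MvPolynomial.monomial (Finsupp.single e 1) 1) =
        ∑ a with π a = e.src, ∑ b with π b = e.tgt, MvPolynomial.X ⟨a, b, e.aligned⟩ :=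
          MvPolynomial.aeval_X _ e
      rw [h1, MvPolynomial.coeff_sum] at hm
      obtain ⟨a, ha, hm⟩ := Finset.exists_ne_zero_of_sum_ne_zero hm
      rw [MvPolynomial.coeff_sum] at hm
      obtain ⟨b, hb, hm⟩ := Finset.exists_ne_zero_of_sum_ne_zero hm
      rw [MvPolynomial.coeff_X] at hm
      rw [← (ite_ne_right_iff.1 hm).1, Finsupp.mapDomain_single, Edge.map]
      rw [(Finset.mem_filter.1 ha).2, (Finset.mem_filter.1 hb).2]

theorem coeff_blowUp {M N : ℕ} (π : Fin N → Fin M) (γ : Gra M) (m : Edge N →₀ ℕ)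
    (h : (blowUp π γ).coeff m ≠ 0) : γ.coeff (m.mapDomain (Edge.map π)) ≠ 0 := by
  rw [γ.as_sum, map_sum, MvPolynomial.coeff_sum] at h
  obtain ⟨u, hu, h⟩ := Finset.exists_ne_zero_of_sum_ne_zero h
  have e : MvPolynomial.monomial u (γ.coeff u) =
      γ.coeff u • (MvPolynomial.monomial u 1 : Gra M) := by
    rw [MvPolynomial.smul_monomial, smul_eq_mul, mul_one]
  rw [e, map_smul, MvPolynomial.coeff_smul] at h
  rw [coeff_blowUp_monomial π u m (right_ne_zero_of_mul h)]
  exact MvPolynomial.mem_support_iff.1 hu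

theorem mem_support_mapDomain {σ τ : Type} (f : σ → τ) (m : σ →₀ ℕ) (y : τ) :
    y ∈ (m.mapDomain f).support ↔ ∃ x ∈ m.support, f x = y := by
  classical
  rw [← Finsupp.mem_toMultiset, ← Finsupp.toMultiset_map, Multiset.mem_map]
  simp only [Finsupp.mem_toMultiset]

/-- The graph `m` is obtained from `m₁.mapDomain π` by substituting `u` for a vertex. -/
structure IsSubstitution {M N K : ℕ} (π : Fin N → Fin M) (ι : Fin K → Fin N) : Prop where
  injective : Function.Injective ι
  surjective : Function.Surjective π
  const : ∀ s t, π (ι s) = π (ι t)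
  fibre : ∀ v w, π v = π w → v = w ∨ ∃ s t, v = ι s ∧ w = ι t

/-- Each fibre of `π` is a point or lies in the connected inserted graph, so paths of the contracted
graph can be lifted, joining consecutive edges inside fibres. -/
theorem IsSubstitution.connected {M N K : ℕ} {π : Fin N → Fin M} {ι : Fin K → Fin N}
    (h : IsSubstitution π ι) {m : Edge N →₀ ℕ} {u : Edge K →₀ ℕ}
    (hm : IsConnectedGraph (m.mapDomain (Edge.map π))) (hu : IsConnectedGraph u) :
    IsConnectedGraph (m + u.mapDomain (Edge.map ι)) := by
  classical
  set R : Fin N → Fin N → Prop := fun a b =>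
    ∃ e ∈ (m + u.mapDomain (Edge.map ι)).support, e.src = a ∧ e.tgt = b with hR
  have hsub : ∀ e, e ∈ m.support ∨ e ∈ (u.mapDomain (Edge.map ι)).support →
      e ∈ (m + u.mapDomain (Edge.map ι)).support := by
    intro e he
    simp only [Finsupp.mem_support_iff, Finsupp.add_apply] at he ⊢
    omega
  have hι : ∀ s t, Relation.EqvGen R (ι s) (ι t) := by
    intro s t
    have := hu s t
    induction this with
    | rel a b hab =>
      obtain ⟨e, he, rfl, rfl⟩ := hab
      exact .rel _ _ ⟨e.map ι, hsub _ (.inr ((mem_support_mapDomain _ _ _).2 ⟨e, he, rfl⟩)),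
        rfl, rfl⟩
    | refl a => exact .refl _
    | symm a b _ ih => exact .symm _ _ ih
    | trans a b c _ _ ih ih' => exact .trans _ _ _ ih ih'
  have hfib : ∀ v w, π v = π w → Relation.EqvGen R v w := by
    intro v w hvw
    obtain rfl | ⟨s, t, rfl, rfl⟩ := h.fibre v w hvw
    · exact .refl _
    · exact hι s t
  have key : ∀ a b, Relation.EqvGen (fun a b => ∃ e ∈ (m.mapDomain (Edge.map π)).support,
      e.src = a ∧ e.tgt = b) a b → ∀ v w, π v = a → π w = b → Relation.EqvGen R v w := by
    intro a b hab
    induction hab with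
    | rel a b hab =>
      intro v w hv hw
      obtain ⟨e, he, rfl, rfl⟩ := hab
      obtain ⟨e, he', rfl⟩ := (mem_support_mapDomain _ _ _).1 he
      exact .trans _ _ _ (hfib v e.src hv) (.trans _ _ _
        (.rel _ _ ⟨e, hsub _ (.inl he'), rfl, rfl⟩) (hfib e.tgt w hw.symm))
    | refl a => exact fun v w hv hw => hfib v w (hv.trans hw.symm)
    | symm a b _ ih => exact fun v w hv hw => .symm _ _ (ih w v hw hv)
    | trans a b c _ _ ih ih' =>
      intro v w hv hw
      obtain ⟨x, hx⟩ := h.surjective b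
      exact .trans _ _ _ (ih v x hv hx) (ih' x w hx hw)
  exact fun v w => key _ _ (hm (π v) (π w)) v w rfl rfl

/-- A directed path either projects to a nontrivial path of the contracted graph or uses only edges
of the inserted graph. A cycle would therefore give a cycle in one of the two. -/
theorem IsSubstitution.oriented {M N K : ℕ} {π : Fin N → Fin M} {ι : Fin K → Fin N}
    (h : IsSubstitution π ι) {c : Colour} {m : Edge N →₀ ℕ} {u : Edge K →₀ ℕ}
    (hm : IsOriented c (m.mapDomain (Edge.map π))) (hu : IsOriented c u) :
    IsOriented c (m + u.mapDomain (Edge.map ι)) := by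
  classical
  intro v hv
  have key : ∀ a b, Relation.TransGen (fun a b => ∃ e ∈ (m + u.mapDomain (Edge.map ι)).support,
      e.tail c = a ∧ e.head c = b) a b →
      Relation.TransGen (fun a b => ∃ e ∈ (m.mapDomain (Edge.map π)).support,
        e.tail c = a ∧ e.head c = b) (π a) (π b) ∨
      ∃ s t, a = ι s ∧ b = ι t ∧ Relation.TransGen (fun a b => ∃ e ∈ u.support,
        e.tail c = a ∧ e.head c = b) s t := by
    have step : ∀ a b, (∃ e ∈ (m + u.mapDomain (Edge.map ι)).support,
        e.tail c = a ∧ e.head c = b) →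
        (∃ e ∈ (m.mapDomain (Edge.map π)).support, e.tail c = π a ∧ e.head c = π b) ∨
        ∃ s t, a = ι s ∧ b = ι t ∧ ∃ e ∈ u.support, e.tail c = s ∧ e.head c = t := by
      rintro a b ⟨e, he, rfl, rfl⟩
      rcases Finset.mem_union.1 (Finsupp.support_add he) with he | he
      · exact .inl ⟨e.map π, (mem_support_mapDomain _ _ _).2 ⟨e, he, rfl⟩, e.tail_map π c,
          e.head_map π c⟩
      · obtain ⟨e, he', rfl⟩ := (mem_support_mapDomain _ _ _).1 he
        exact .inr ⟨_, _, e.tail_map ι c, e.head_map ι c, e, he', rfl, rfl⟩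
    intro a b hab
    induction hab with
    | single hab =>
      rcases step _ _ hab with hab | ⟨s, t, rfl, rfl, hst⟩
      · exact .inl (.single hab)
      · exact .inr ⟨s, t, rfl, rfl, .single hst⟩
    | tail _ hbc ih =>
      rcases ih with ih | ⟨s, t, rfl, rfl, ih⟩ <;>
        rcases step _ _ hbc with hbc | ⟨s', t', h1, rfl, hst⟩
      · exact .inl (ih.tail hbc)
      -- An inner edge after an outer path: its two ends are contracted to the same vertex, so the
      -- projected path is unchanged.
      · rw [h1, h.const s' t'] at ih
        exact .inl ih
      -- An outer edge after an inner path: the inner path is contracted to a point and the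
      -- projection is the single outer edge.
      · rw [h.const t s] at hbc
        exact .inl (.single hbc)
      · rw [← h.injective h1] at hst
        exact .inr ⟨s, t', rfl, rfl, ih.tail hst⟩
  rcases key v v hv with hv | ⟨s, t, rfl, h2, hst⟩
  · exact hm _ hv
  · rw [← h.injective h2] at hst
    exact hu _ hst

/-- The map that contracts the vertices in `S` to one vertex. -/
def contractMap {N : ℕ} (S : Finset (Fin N)) (a : Fin N) : Fin (Sᶜ.card + 1) :=
  Sum.elim (fun _ => 0) Fin.succ ((finSumEquivOfFinset rfl rfl).symm a :
    Fin S.card ⊕ Fin Sᶜ.card)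

/-- For empty `S` nothing would map to the vertex `0`, so surjectivity fails. That case is excluded
in the complex by the vanishing of arity `0`. -/
theorem isSubstitution_contractMap {N : ℕ} (S : Finset (Fin N)) (hS : S.card ≠ 0) :
    IsSubstitution (contractMap S) fun i => S.orderEmbOfFin rfl i := by
  have h1 : ∀ i, contractMap S (S.orderEmbOfFin rfl i) = 0 := fun i => by
    rw [contractMap, ← finSumEquivOfFinset_inl rfl rfl, Equiv.symm_apply_apply]
    rfl
  have h2 : ∀ i, contractMap S (Sᶜ.orderEmbOfFin rfl i) = i.succ := fun i => by
    rw [contractMap, ← finSumEquivOfFinset_inr rfl rfl, Equiv.symm_apply_apply]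
    rfl
  have h3 : ∀ v, (∃ s, v = S.orderEmbOfFin rfl s) ∨ ∃ s, v = Sᶜ.orderEmbOfFin rfl s := by
    intro v
    obtain ⟨s | s, rfl⟩ := (finSumEquivOfFinset (s := S) rfl rfl).surjective v
    · exact .inl ⟨s, finSumEquivOfFinset_inl rfl rfl s⟩
    · exact .inr ⟨s, finSumEquivOfFinset_inr rfl rfl s⟩
  refine ⟨(S.orderEmbOfFin rfl).injective, fun a => ?_, fun s t => by rw [h1, h1],
    fun v w hvw => ?_⟩
  · refine Fin.cases ⟨_, h1 ⟨0, Nat.pos_of_ne_zero hS⟩⟩ (fun a => ⟨_, h2 a⟩) a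
  · rcases h3 v with ⟨s, rfl⟩ | ⟨s, rfl⟩ <;> rcases h3 w with ⟨t, rfl⟩ | ⟨t, rfl⟩
    · exact .inr ⟨s, t, rfl, rfl⟩
    · rw [h1, h2] at hvw
      exact absurd hvw (Fin.succ_ne_zero _).symm
    · rw [h1, h2] at hvw
      exact absurd hvw (Fin.succ_ne_zero _)
    · rw [h2, h2] at hvw
      rw [Fin.succ_injective _ hvw]
      exact .inl rfl

theorem coeff_insertGraph {N : ℕ} (S : Finset (Fin N)) (γ : Gra (Sᶜ.card + 1)) (γ' : Gra S.card)
    (m : Edge N →₀ ℕ) (h : (insertGraph S γ γ').coeff m ≠ 0) :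
    ∃ m₁ u, m = m₁ + u.mapDomain (Edge.map fun i => S.orderEmbOfFin rfl i) ∧
      γ.coeff (m₁.mapDomain (Edge.map (contractMap S))) ≠ 0 ∧ γ'.coeff u ≠ 0 := by
  obtain ⟨m₁, m₂, rfl, h₁, h₂⟩ := coeff_mul_ne_zero h
  obtain ⟨u, rfl, hu⟩ := MvPolynomial.coeff_rename_ne_zero _ _ _ h₂
  exact ⟨m₁, u, rfl, coeff_blowUp _ _ _ h₁, hu⟩

end Substitution

/-! ### The graph complex is closed under the bracket and contains `upsilon` -/

section Complex

variable {o : Set Colour}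

theorem isGraphCochain_of_mem {D : ℤ} {γ : ∀ N, Gra N} (h : γ ∈ fcGCComp o D) :
    IsGraphCochain D γ := by
  refine ⟨fun N hN => ?_, h.2.2.1⟩
  obtain ⟨m, hm⟩ := MvPolynomial.ne_zero_iff.1 hN
  have := (h.2.2.2 N m hm).2.2
  -- Since `D = 3(N - 1) - 2k`, the internal degree `D - (N - 1)` is `2(N - 1 - k)`.
  exact ⟨(N : ℤ) - 1 - m.degree, by omega⟩

theorem graphComp_zero {γ γ' : ∀ N, Gra N} (h : γ' 0 = 0) : graphComp γ γ' 0 = 0 := by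
  refine Finset.sum_eq_zero fun S _ => ?_
  have hS : γ' S.card = 0 := by
    have : S.card = 0 := by rw [Finset.eq_empty_of_isEmpty S, Finset.card_empty]
    rw [this, h]
  rw [hS, insertGraph_zero_right, smul_zero]

theorem finite_graphComp {γ γ' : ∀ N, Gra N} (h : {N | γ N ≠ 0}.Finite)
    (h' : {N | γ' N ≠ 0}.Finite) : {N | graphComp γ γ' N ≠ 0}.Finite := by
  -- Substitution into an `a`-vertex graph removes one vertex and adds `b`.
  refine (Set.Finite.image2 (fun a b => a - 1 + b) h h').subset fun N hN => ?_
  obtain ⟨S, -, hS⟩ := Finset.exists_ne_zero_of_sum_ne_zero hN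
  refine ⟨Sᶜ.card + 1, fun h0 => hS (by rw [h0, insertGraph_zero_left, smul_zero]), S.card,
    fun h0 => hS (by rw [h0, insertGraph_zero_right, smul_zero]), ?_⟩
  have := Finset.card_add_card_compl S
  rw [Fintype.card_fin] at this
  change Sᶜ.card + 1 - 1 + S.card = N
  omega

/-- Each graph that occurs is a substitution. Edge numbers add, and so do the vertex numbers minus
one, which makes the degree additive. -/
theorem coeff_graphComp {i j : ℤ} {γ γ' : ∀ N, Gra N} (h : γ ∈ fcGCComp o i)
    (h' : γ' ∈ fcGCComp o j) (N : ℕ) (m : Edge N →₀ ℕ) (hm : (graphComp γ γ' N).coeff m ≠ 0) :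
    IsConnectedGraph m ∧ (∀ c ∈ o, IsOriented c m) ∧ 3 * ((N : ℤ) - 1) - 2 * m.degree = i + j := by
  rw [graphComp, MvPolynomial.coeff_sum] at hm
  obtain ⟨S, -, hS⟩ := Finset.exists_ne_zero_of_sum_ne_zero hm
  rw [Units.smul_def, MvPolynomial.coeff_smul] at hS
  obtain ⟨m₁, u, rfl, h₁, h₂⟩ := coeff_insertGraph S _ _ m fun h0 => hS (by rw [h0, smul_zero])
  have hS0 : S.card ≠ 0 := by
    intro h0
    apply h₂
    have : γ' S.card = 0 := by rw [h0, h'.1]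
    rw [this, MvPolynomial.coeff_zero]
  have hsub := isSubstitution_contractMap S hS0
  obtain ⟨c1, c2, c3⟩ := h.2.2.2 _ _ h₁
  obtain ⟨d1, d2, d3⟩ := h'.2.2.2 _ _ h₂
  refine ⟨hsub.connected c1 d1, fun c hc => hsub.oriented (c2 c hc) (d2 c hc), ?_⟩
  have h3 : Sᶜ.card + S.card = N := by
    rw [add_comm, Finset.card_add_card_compl, Fintype.card_fin]
  rw [Finsupp.degree_mapDomain] at c3
  rw [map_add, Finsupp.degree_mapDomain]
  push_cast at c3 ⊢
  omega

theorem graphBracket_mem {i j : ℤ} {γ γ' : ∀ N, Gra N} (h : γ ∈ fcGCComp o i)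
    (h' : γ' ∈ fcGCComp o j) : graphBracket i j γ γ' ∈ fcGCComp o (i + j) := by
  refine ⟨?_, ?_, ((isGraphCochain_of_mem h).bracket (isGraphCochain_of_mem h')).relabel,
    fun N m hm => ?_⟩
  · rw [graphBracket, Pi.sub_apply, Pi.smul_apply, graphComp_zero h'.1, graphComp_zero h.1,
      smul_zero, sub_zero]
  · refine ((finite_graphComp h.2.1 h'.2.1).union (finite_graphComp h'.2.1 h.2.1)).subset
      fun N hN => ?_
    by_contra hn
    simp only [Set.mem_union, Set.mem_ofPred_eq, not_or, not_not] at hn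
    exact hN (by rw [graphBracket, Pi.sub_apply, Pi.smul_apply, hn.1, hn.2, smul_zero, sub_zero])
  · by_cases h0 : (graphComp γ γ' N).coeff m = 0
    · rw [add_comm i j]
      refine coeff_graphComp h' h N m fun h1 => hm ?_
      rw [graphBracket, Pi.sub_apply, Pi.smul_apply, MvPolynomial.coeff_sub, Units.smul_def,
        MvPolynomial.coeff_smul, h0, h1, smul_zero, sub_zero]
    · exact coeff_graphComp h h' N m h0

theorem upsilon_of_ne {N : ℕ} (h : N ≠ 2) : upsilon N = 0 := by
  unfold upsilon
  split
  · exact absurd rfl h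
  · rfl

/-- A single edge between two distinct vertices is connected and acyclic in both colours, and its
degree is `3 - 2 = 1`; this works for every choice of `o`. -/
theorem upsilon_mem : upsilon ∈ fcGCComp o 1 := by
  refine ⟨rfl, (Set.finite_singleton 2).subset fun N hN => ?_, fun N =>
    relabel_eq_sign_smul fun i j hij => ?_, fun N m hm => ?_⟩
  · by_contra h
    exact hN (upsilon_of_ne h)
  · by_cases h : N = 2
    · subst h
      obtain rfl : i = 0 := by omega
      obtain rfl : j = 1 := by omega
      simp only [upsilon, map_sum, map_sub, relabel, MvPolynomial.rename_X,
        Equiv.swap_apply_left, Equiv.swap_apply_right, ← Finset.sum_neg_distrib, neg_sub]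
    · rw [upsilon_of_ne h, map_zero, neg_zero]
  · by_cases h : N = 2
    · subst h
      have hm : ∃ a b : Fin 2, a ≠ b ∧ ∃ s : Bool, m = Finsupp.single ⟨a, b, s⟩ 1 := by
        rw [upsilon, MvPolynomial.coeff_sum] at hm
        obtain ⟨s, -, hs⟩ := Finset.exists_ne_zero_of_sum_ne_zero hm
        rw [MvPolynomial.coeff_sub] at hs
        classical
        rw [MvPolynomial.coeff_X, MvPolynomial.coeff_X] at hs
        by_cases h1 : Finsupp.single ⟨0, 1, s⟩ 1 = m
        · exact ⟨0, 1, by simp, s, h1.symm⟩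
        · by_cases h2 : Finsupp.single ⟨1, 0, s⟩ 1 = m
          · exact ⟨1, 0, by simp, s, h2.symm⟩
          · rw [if_neg h1, if_neg h2, sub_zero] at hs
            exact absurd rfl hs
      obtain ⟨a, b, hab, s, rfl⟩ := hm
      have hsupp : ∀ e : Edge 2, e ∈ (Finsupp.single (⟨a, b, s⟩ : Edge 2) 1).support ↔
          e = ⟨a, b, s⟩ := fun e => by
        classical
        rw [Finsupp.mem_support_iff, Finsupp.single_apply]
        simp [eq_comm]
      refine ⟨fun v w => ?_, fun c _ v hv => ?_, by rw [Finsupp.degree_single]; norm_num⟩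
      · have h1 : Relation.EqvGen (fun x y => ∃ e ∈ (Finsupp.single (⟨a, b, s⟩ : Edge 2) 1).support,
          e.src = x ∧ e.tgt = y) a b := .rel _ _ ⟨_, (hsupp _).2 rfl, rfl, rfl⟩
        have : ∀ v : Fin 2, v = a ∨ v = b := by omega
        rcases this v with rfl | rfl <;> rcases this w with rfl | rfl
        · exact .refl _
        · exact h1
        · exact .symm _ _ h1
        · exact .refl _
      · simp only [hsupp, exists_eq_left] at hv
        set e : Edge 2 := ⟨a, b, s⟩
        have he : e.tail c ≠ e.head c := by
          cases c
          · exact hab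
          · cases s
            · exact hab.symm
            · exact hab
        have key : ∀ x y, Relation.TransGen (fun a b => e.tail c = a ∧ e.head c = b) x y →
            e.tail c = x ∧ e.head c = y := by
          intro x y hxy
          induction hxy with
          | single h => exact h
          | tail _ h ih => exact ⟨ih.1, h.2⟩
        have := key v v hv
        exact he (this.1.trans this.2.symm)
    · rw [upsilon_of_ne h] at hm
      exact absurd (MvPolynomial.coeff_zero m) hm

end Complex

/-! ## The Maurer–Cartan element -/

section MaurerCartan

variable {n : ℕ}

/-- The Poisson structure with constant coefficients defined by the Maurer–Cartan element. -/
def eulerPoisson (l l' : Fin n → Gra n) : Gra n :=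
  ∑ s : Bool, ∑ k : Fin n × Fin n,
    MvPolynomial.X ⟨k.1, k.2, s⟩ * (l k.1 * l' k.2 - l' k.1 * l k.2)

theorem eulerPoisson_swap (l l' : Fin n → Gra n) : eulerPoisson l' l = -eulerPoisson l l' := by
  simp only [eulerPoisson, ← Finset.sum_neg_distrib]
  refine Finset.sum_congr rfl fun s _ => Finset.sum_congr rfl fun k _ => ?_
  ring

theorem eulerPoisson_add (l l' l'' : Fin n → Gra n) :
    eulerPoisson (l + l') l'' = eulerPoisson l l'' + eulerPoisson l' l'' := by
  simp only [eulerPoisson, ← Finset.sum_add_distrib]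
  refine Finset.sum_congr rfl fun s _ => Finset.sum_congr rfl fun k _ => ?_
  rw [Pi.add_apply, Pi.add_apply]
  ring

/-- The bracket of two eigenvectors is their product scaled by a skew bilinear form of the
eigenvalues, hence again an eigenvector. -/
theorem modelOps_rep_upsilon {l l' : Fin n → Gra n} {x x' : ModelCoeff n}
    (hx : IsEulerEigen l x) (hx' : IsEulerEigen l' x') :
    (modelOps n).rep 2 (upsilon 2) ![x ⊗ₜ 1, x' ⊗ₜ 1] =
      (MvPolynomial.C (eulerPoisson l l') * (x * x')) ⊗ₜ 1 := by
  have h := modelOps_rep (upsilon 2) ![l, l'] ![x, x'] (by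
    intro i; fin_cases i
    · exact hx
    · exact hx')
  have h1 : (fun i => (![x, x'] i ⊗ₜ 1 : SuperAlg (ModelCoeff n) PUnit)) =
      ![x ⊗ₜ 1, x' ⊗ₜ 1] := by
    funext i; fin_cases i <;> rfl
  have h2 : eigenAeval ![l, l'] (upsilon 2) = eulerPoisson l l' := by
    rw [upsilon, map_sum, eulerPoisson]
    refine Finset.sum_congr rfl fun s _ => ?_
    rw [map_sub, eigenAeval, MvPolynomial.aeval_X, MvPolynomial.aeval_X, ← Finset.sum_sub_distrib]
    refine Finset.sum_congr rfl fun k _ => ?_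
    simp only [Matrix.cons_val_zero, Matrix.cons_val_one]
    ring
  rw [h1, h2, Fin.prod_univ_two] at h
  exact h

theorem evalList_pair {g : Type} [AddCommGroup g] [Module ℝ g] {G : ℤ → Submodule ℝ g}
    (F : Cochain g) (a b : Tagged G) : evalList F [a, b] = F 2 ![tagVal a, tagVal b] := by
  change F 2 _ = F 2 _
  congr 1
  funext i
  fin_cases i <;> rfl

theorem evalHead_singleton {g : Type} [AddCommGroup g] [Module ℝ g] {G : ℤ → Submodule ℝ g}
    (F : Cochain g) (y : g) (b : Tagged G) : evalHead F [b] y = F 2 ![y, tagVal b] := by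
  change F 2 _ = F 2 _
  congr 1
  funext i
  fin_cases i <;> rfl

theorem evalList_eq_zero {g : Type} [AddCommGroup g] [Module ℝ g] {G : ℤ → Submodule ℝ g}
    {F : Cochain g} (L : List (Tagged G)) (h : F L.length = 0) : evalList F L = 0 := by
  rw [evalList, h]; rfl

/-- With `ω` the form `eulerPoisson`, the three terms are signed multiples of the product by `ω(l,
l') ω(l + l', l'')`; they cancel because `ω` is additive and skew. -/
theorem modelOps_jacobi (x : Fin 3 → ModelCoeff n) (l : Fin 3 → Fin n → Gra n)
    (hx : ∀ i, IsEulerEigen (l i) (x i)) :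
    nrComp (sparity (B := ModelCoeff n) (U := PUnit)).toLinearMap 1
      ((modelOps n).repFamily upsilon) ((modelOps n).repFamily upsilon) 3
        (fun i => x i ⊗ₜ 1) = 0 := by
  set F := (modelOps n).repFamily upsilon with hF
  have hF0 : ∀ N, N ≠ 2 → F N = 0 := fun N hN => by
    rw [hF, EdgeOps.repFamily_apply, upsilon_of_ne hN, map_zero]
  have h0 : ∀ y : SuperAlg (ModelCoeff n) PUnit, y ∈ evenGrading _ 0 := fun y => by
    rw [evenGrading, if_pos (by simp)]; trivial
  have e := evalList_ofFn (G := evenGrading (SuperAlg (ModelCoeff n) PUnit))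
    (nrComp (sparity (B := ModelCoeff n) (U := PUnit)).toLinearMap 1 F F)
    (fun i : Fin 3 => ⟨0, x i ⊗ₜ 1, h0 _⟩)
  have ht : ∀ y : SuperAlg (ModelCoeff n) PUnit,
      tagVal (⟨0, y, h0 y⟩ : Tagged (evenGrading (SuperAlg (ModelCoeff n) PUnit))) = y :=
    fun _ => rfl
  have hs : ∀ y z : SuperAlg (ModelCoeff n) PUnit,
      tagSign (⟨0, y, h0 y⟩ : Tagged (evenGrading (SuperAlg (ModelCoeff n) PUnit))) ⟨0, z, h0 z⟩ =
        -1 := fun _ _ => by simp [tagSign]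
  have hF2 : ∀ {l l' : Fin n → Gra n} {x x' : ModelCoeff n}, IsEulerEigen l x →
      IsEulerEigen l' x' → F 2 ![x ⊗ₜ 1, x' ⊗ₜ 1] =
        (MvPolynomial.C (eulerPoisson l l') * (x * x')) ⊗ₜ 1 :=
    fun h h' => modelOps_rep_upsilon h h'
  simp only [ht] at e
  rw [← e, evalList_nrComp isParityGrading_evenGrading, List.ofFn_succ, List.ofFn_succ,
    List.ofFn_succ, List.ofFn_zero]
  simp only [shuffleSum_cons, shuffleSum_nil, listSign_cons, listSign_nil, hs]
  -- The operation is purely binary, so of the eight unshuffles only the three with two elements in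
  -- the inner block survive.
  rw [evalList_eq_zero (F := F) [_, _, _] (hF0 3 (by norm_num)),
    evalList_eq_zero (F := F) [] (hF0 0 (by norm_num)),
    evalList_eq_zero (F := F) [_] (hF0 1 (by norm_num)),
    evalList_eq_zero (F := F) [_] (hF0 1 (by norm_num)),
    evalList_eq_zero (F := F) [_] (hF0 1 (by norm_num))]
  simp only [map_zero, smul_zero, add_zero, zero_add, evalHead_singleton, evalList_pair, ht]
  rw [hF2 (hx _) (hx _), hF2 (hx _) (hx _), hF2 (hx _) (hx _),
    hF2 (((hx _).mul (hx _)).C_mul _) (hx _), hF2 (((hx _).mul (hx _)).C_mul _) (hx _),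
    hF2 (((hx _).mul (hx _)).C_mul _) (hx _)]
  simp only [eulerPoisson_add, List.length_cons, List.length_nil]
  have hn : (((0 + 1 : ℕ) : ℤ) * (1 - (((0 + 1 + 1 : ℕ) : ℤ) - 1))).negOnePow = 1 := by norm_num
  rw [eulerPoisson_swap (l 0) (l (Fin.succ 0)), eulerPoisson_swap (l 0) (l (Fin.succ 0).succ),
    eulerPoisson_swap (l (Fin.succ 0)) (l (Fin.succ 0).succ)]
  simp only [hn, mul_one, neg_mul_neg, one_smul, Units.neg_smul]
  rw [← TensorProduct.neg_tmul, ← TensorProduct.add_tmul, ← TensorProduct.add_tmul,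
    ← TensorProduct.zero_tmul _ (1 : ExteriorAlgebra ℝ PUnit)]
  congr 1
  simp only [map_add, map_neg]
  ring

/-- Only arity `3` can be nonzero, and there the faithful model reduces the claim to
`modelOps_jacobi`. -/
theorem graphComp_upsilon : graphComp upsilon upsilon = 0 := by
  funext N
  by_cases hN : N = 3
  · subst hN
    refine eq_zero_of_modelOps_rep ?_
    have h := (modelOps 3).rep_graphComp 1 upsilon upsilon
      (isGraphCochain_of_mem (upsilon_mem (o := ∅))).even
    have h3 := modelOps_jacobi (fun i : Fin 3 => (MvPolynomial.X i : ModelCoeff 3)) _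
      fun i => isEulerEigen_X i
    exact (DFunLike.congr_fun (congrFun h 3) _).trans h3
  · refine Finset.sum_eq_zero fun S _ => ?_
    by_cases hS : S.card = 2
    · have : Sᶜ.card + 1 ≠ 2 := by
        have := Finset.card_add_card_compl S
        rw [Fintype.card_fin] at this
        omega
      rw [upsilon_of_ne this, insertGraph_zero_left, smul_zero]
    · rw [upsilon_of_ne hS, insertGraph_zero_right, smul_zero]

theorem graphBracket_upsilon : graphBracket 1 1 upsilon upsilon = 0 := by
  rw [graphBracket, graphComp_upsilon, smul_zero, sub_zero]

end MaurerCartan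

/-! ## Dg Lie algebras from Maurer–Cartan elements -/

section DGLie

/-- With `[θ, θ] = 0` and `θ` of degree `1`, the Jacobi identity for `θ, θ, x` makes `[θ, [θ, x]]`
equal to its own negative, and the one for `θ, x, y` is the Leibniz rule. -/
theorem DGLieData.isDGLie_of_maurerCartan {X : Type} [AddCommGroup X] [Module ℝ X]
    (L : DGLieData X) (θ : X) (hθ : θ ∈ L.comp 1) (hθθ : L.bracket 1 1 θ θ = 0)
    (hdiff : ∀ i x, L.diff i x = L.bracket 1 i θ x)
    (bracket_mem : ∀ i j, ∀ x ∈ L.comp i, ∀ y ∈ L.comp j, L.bracket i j x y ∈ L.comp (i + j))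
    (bracket_add : ∀ i j x x' y, L.bracket i j (x + x') y = L.bracket i j x y + L.bracket i j x' y)
    (bracket_smul : ∀ i j (c : ℝ) x y, L.bracket i j (c • x) y = c • L.bracket i j x y)
    (antisymm : ∀ i j x y, L.bracket i j x y = -((i * j).negOnePow • L.bracket j i y x))
    (jacobi : ∀ i j k : ℤ, ∀ x ∈ L.comp i, ∀ y ∈ L.comp j, ∀ z ∈ L.comp k,
      L.bracket i (j + k) x (L.bracket j k y z) =
        L.bracket (i + j) k (L.bracket i j x y) z +
          (i * j).negOnePow • L.bracket j (i + k) y (L.bracket i k x z)) : L.IsDGLie where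
  bracket_mem := bracket_mem
  bracket_add i j x _ x' _ y _ := bracket_add i j x x' y
  bracket_smul i j c x _ y _ := bracket_smul i j c x y
  antisymm i j x _ y _ := antisymm i j x y
  jacobi := jacobi
  diff_mem i x hx := by rw [hdiff, add_comm]; exact bracket_mem 1 i θ hθ x hx
  diff_add i x _ x' _ := by
    rw [hdiff, hdiff, hdiff, antisymm, bracket_add, antisymm 1 i θ x, antisymm 1 i θ x', smul_add,
      neg_add]
  diff_smul i c x _ := by
    rw [hdiff, hdiff, antisymm, bracket_smul, antisymm 1 i θ x, smul_neg, smul_comm]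
  diff_diff i x hx := by
    have h := jacobi 1 1 i θ hθ θ hθ x hx
    have h0 : L.bracket (1 + 1) i 0 x = 0 := by
      have := bracket_smul (1 + 1) i 0 0 x
      rwa [zero_smul, zero_smul] at this
    rw [hθθ, h0, zero_add, mul_one, Int.negOnePow_one, Units.neg_smul, one_smul] at h
    rw [hdiff, hdiff, add_comm i 1]
    have h2 : (2 : ℝ) • L.bracket 1 (1 + i) θ (L.bracket 1 i θ x) = 0 := by
      rw [two_smul]
      nth_rewrite 1 [h]
      exact neg_add_cancel _
    exact (smul_eq_zero.1 h2).resolve_left two_ne_zero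
  leibniz i j x hx y hy := by
    have h := jacobi 1 i j θ hθ x hx y hy
    rw [one_mul] at h
    rw [hdiff, hdiff, hdiff, h, add_comm i 1, add_comm j 1]

theorem isDGLie_fcGC (o : Set Colour) : (fcGC o).IsDGLie :=
  DGLieData.isDGLie_of_maurerCartan _ upsilon upsilon_mem graphBracket_upsilon (fun _ _ => rfl)
    (fun _ _ _ hx _ hy => graphBracket_mem hx hy) graphBracket_add_left graphBracket_smul_left
    graphBracket_antisymm (fun _ _ _ _ hx _ hy _ hz => graphBracket_jacobi
      (isGraphCochain_of_mem hx) (isGraphCochain_of_mem hy) (isGraphCochain_of_mem hz))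

theorem isDGLie_chevalleyEilenberg {g : Type} [AddCommGroup g] [Module ℝ g]
    {G : ℤ → Submodule ℝ g} {P : g →ₗ[ℝ] g} (hG : IsParityGrading G P) (b : g →ₗ[ℝ] g →ₗ[ℝ] g)
    (hb : bilinCochain b ∈ ceComp G 1)
    (hbb : nrBracket P 1 1 (bilinCochain b) (bilinCochain b) = 0) :
    (chevalleyEilenberg G P b).IsDGLie :=
  DGLieData.isDGLie_of_maurerCartan _ (bilinCochain b) hb hbb (fun _ _ => rfl)
    (fun _ _ _ hx _ hy => nrBracket_mem hG hx hy) (fun _ _ => nrBracket_add_left)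
    (fun _ _ => nrBracket_smul_left) (fun _ _ => nrBracket_antisymm)
    (fun _ _ _ _ hx _ hy _ hz => nrBracket_jacobi hG hx hy hz)

end DGLie

/-! ## Cochains on a subspace -/

section Intertwine

variable {g g' : Type} [AddCommGroup g] [Module ℝ g] [AddCommGroup g'] [Module ℝ g']

/-- The map `i` intertwines two cochains. -/
def Intertwines (i : g →ₗ[ℝ] g') (F : Cochain g) (F' : Cochain g') : Prop :=
  ∀ (N : ℕ) (x : Fin N → g), i (F N x) = F' N fun k => i (x k)

theorem Intertwines.eq {i : g →ₗ[ℝ] g'} (hi : Function.Injective i) {F H : Cochain g}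
    {F' : Cochain g'} (hF : Intertwines i F F') (hH : Intertwines i H F') : F = H := by
  funext N
  exact MultilinearMap.ext fun x => hi ((hF N x).trans (hH N x).symm)

/-- Naturality of the composition under parity-preserving maps. For an injective map it lets
identities on a subspace be checked in the ambient algebra. -/
theorem Intertwines.nrComp {i : g →ₗ[ℝ] g'} {P : g →ₗ[ℝ] g} {P' : g' →ₗ[ℝ] g'}
    (hP : ∀ x, i (P x) = P' (i x)) {F H : Cochain g} {F' H' : Cochain g'}
    (hF : Intertwines i F F') (hH : Intertwines i H H') (j : ℤ) :
    Intertwines i (nrComp P j F H) (nrComp P' j F' H') := by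
  intro N x
  have hp : ∀ b x, i (parityPart P b x) = parityPart P' b (i x) := fun b x => by
    cases b <;> simp [parityPart, hP]
  simp only [LieBialgebroid.nrComp, sum_apply, smul_apply, MultilinearMap.compLinearMap_apply,
    map_sum, Units.smul_def, map_zsmul, insertAt_apply]
  refine Finset.sum_congr rfl fun S _ => Finset.sum_congr rfl fun e _ => ?_
  rw [hF]
  congr 2
  funext k
  refine Fin.cases ?_ (fun k => ?_) k
  · simp only [Fin.cons_zero]
    exact (hH _ _).trans (by simp only [hp])
  · simp only [Fin.cons_succ, hp]

theorem Intertwines.nrBracket {i : g →ₗ[ℝ] g'} {P : g →ₗ[ℝ] g} {P' : g' →ₗ[ℝ] g'}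
    (hP : ∀ x, i (P x) = P' (i x)) {F H : Cochain g} {F' H' : Cochain g'}
    (hF : Intertwines i F F') (hH : Intertwines i H H') (k l : ℤ) :
    Intertwines i (nrBracket P k l F H) (nrBracket P' k l F' H') := by
  intro N x
  simp only [LieBialgebroid.nrBracket, Pi.sub_apply, Pi.smul_apply, sub_apply, smul_apply, map_sub,
    Units.smul_def, map_zsmul]
  rw [hF.nrComp hP hH l N x, hH.nrComp hP hF k N x]

end Intertwine

/-! ## The representation on functions as a morphism -/

section Representation

variable {n : ℕ} {V : TopologicalSpace.Opens (EuclideanSpace ℝ (Fin n))} {r : ℕ}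

theorem invol_contr {W : Type} [AddCommGroup W] [Module ℝ W] (φ : Module.Dual ℝ W)
    (x : ExteriorAlgebra ℝ W) : invol (contr φ x) = -contr φ (invol x) := by
  induction x using exterior_induction with
  | algebraMap c => rw [AlgHom.commutes, contr_algebraMap, map_zero, neg_zero]
  | add x y hx hy => rw [map_add, map_add, map_add, map_add, hx, hy, neg_add]
  | ι_mul x v hx =>
    have e : invol (ExteriorAlgebra.ι ℝ v * x) = -(ExteriorAlgebra.ι ℝ v * invol x) := by
      rw [map_mul, invol_ι, neg_mul]
    have e' : invol (ExteriorAlgebra.ι ℝ v * contr φ x) =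
        -(ExteriorAlgebra.ι ℝ v * invol (contr φ x)) := by
      rw [map_mul, invol_ι, neg_mul]
    rw [e, map_neg, neg_neg, contr_ι_mul, contr_ι_mul, map_sub, map_smul, e', hx, mul_neg,
      neg_neg]

theorem parity_dOdd (s : Fin r ⊕ Fin r) (x : FunAlg V r) :
    parity (dOdd s x) = -dOdd s (parity x) := by
  induction x using funAlg_induction with
  | add a b ha hb => rw [map_add, map_add, map_add, map_add, ha, hb, neg_add]
  | tmul f q w =>
    change f ⊗ₜ[ℝ] (q ⊗ₜ[ℝ] invol (contr (LinearMap.proj s : OddSpan r →ₗ[ℝ] ℝ) w)) =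
      -(f ⊗ₜ[ℝ] (q ⊗ₜ[ℝ] contr (LinearMap.proj s : OddSpan r →ₗ[ℝ] ℝ) (invol w)))
    rw [invol_contr, TensorProduct.tmul_neg, TensorProduct.tmul_neg]

theorem rep_X {N : ℕ} (e : Edge N) (f : Fin N → FunAlg V r) :
    rep V r N (MvPolynomial.X e) f =
      mulMap V r N (edgeOp V r e (PiTensorProduct.tprod ℝ f)) := by
  rw [MvPolynomial.X, rep_monomial, repGraph, Finsupp.toMultiset_single, one_smul,
    Multiset.toList_singleton, List.map_singleton, List.prod_singleton]
  rfl

theorem mulMap_tprod_two (f : Fin 2 → FunAlg V r) :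
    mulMap V r 2 (PiTensorProduct.tprod ℝ f) = f 0 * f 1 := by
  rw [mulMap, PiTensorProduct.lift.tprod, MultilinearMap.mkPiAlgebraFin_apply]
  simp [List.ofFn_succ]

theorem rep_upsilon (f : Fin 2 → FunAlg V r) : rep V r 2 (upsilon 2) f = poisson (f 0) (f 1) := by
  rw [upsilon, Fintype.sum_bool, map_add, map_sub, map_sub, add_apply, sub_apply, sub_apply,
    rep_X, rep_X, rep_X, rep_X]
  simp only [edgeOp, if_true, Bool.false_eq_true, if_false, LinearMap.sum_apply,
    Module.End.mul_apply, evenAt, oddAt, PiTensorProduct.map_tprod, map_sum, mulMap_tprod_two]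
  change _ = (∑ μ : Fin n, (dx μ (f 0) * dp μ (f 1) - dp μ (f 0) * dx μ (f 1))) +
      ∑ a : Fin r, (dxi a (parity (f 0)) * dzeta a (f 1) + dzeta a (parity (f 0)) * dxi a (f 1))
  rw [← Finset.sum_sub_distrib, ← Finset.sum_sub_distrib]
  congr 1
  refine Finset.sum_congr rfl fun a _ => ?_
  -- For the edge from the second vertex to the first, the `ξ`-derivative passes the first factor
  -- after `∂/∂ζ` has changed its parity. This sign cancels the minus in `upsilon`, so both odd
  -- terms of the bracket carry a plus.
  have h : parity (dzeta a (f 0)) = -dzeta a (parity (f 0)) := parity_dOdd _ _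
  simp [h]

theorem rep_mem_of_forall {p : Submodule ℝ (FunAlg V r)} {N : ℕ} (γ : Gra N)
    (f : Fin N → FunAlg V r) (h : ∀ m, γ.coeff m ≠ 0 → repGraph V r m f ∈ p) :
    rep V r N γ f ∈ p := by
  rw [γ.as_sum, map_sum, sum_apply]
  refine sum_mem fun m hm => ?_
  have e : MvPolynomial.monomial m (γ.coeff m) =
      γ.coeff m • (MvPolynomial.monomial m 1 : Gra N) := by
    rw [MvPolynomial.smul_monomial, smul_eq_mul, mul_one]
  rw [e, map_smul, smul_apply, rep_monomial]
  exact Submodule.smul_mem _ _ (h m (MvPolynomial.mem_support_iff.1 hm))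

variable {o : Set Colour} {B : PoissonSubspace V r}

theorem rep_mem_space (hB : ∀ x, x ∈ B.space ↔ ∀ c ∈ o, restrictTo (c.odd r) x = 0) {D : ℤ}
    {γ : ∀ N, Gra N} (hγ : γ ∈ fcGCComp o D) (N : ℕ) (f : Fin N → B.space) :
    rep V r N (γ N) (fun i => f i) ∈ B.space := by
  cases N with
  -- In arity `0` the empty graph would produce constants, which the restrictions do not kill in
  -- general; the complex excludes it.
  | zero => rw [hγ.1, map_zero]; exact zero_mem _
  | succ N =>
    refine rep_mem_of_forall _ _ fun m hm => (hB _).2 fun c hc => ?_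
    exact restrictTo_repGraph ((hγ.2.2.2 _ m hm).2.1 c hc) _ fun i => (hB _).1 (f i).2 c hc

/-- The operations on the subspace `B` defined by a family of graphs. -/
def repOn (hB : ∀ x, x ∈ B.space ↔ ∀ c ∈ o, restrictTo (c.odd r) x = 0) (D : ℤ) :
    fcGCComp o D →ₗ[ℝ] Cochain B.space where
  toFun γ N := ((rep V r N (γ.1 N)).compLinearMap fun _ => B.space.subtype).codRestrict B.space
    fun f => rep_mem_space hB γ.2 N f
  map_add' γ γ' := by
    funext N
    refine MultilinearMap.ext fun f => Subtype.ext ?_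
    change rep V r N (γ.1 N + γ'.1 N) _ = _
    rw [map_add]
    rfl
  map_smul' c γ := by
    funext N
    refine MultilinearMap.ext fun f => Subtype.ext ?_
    change rep V r N (c • γ.1 N) _ = _
    rw [map_smul]
    rfl

/-- The inclusion of `B` into the functions, seen as a super algebra. -/
def PoissonSubspace.incl (B : PoissonSubspace V r) :
    B.space →ₗ[ℝ] SuperAlg (EvenFun V) (OddSpan r) :=
  (toSuper V r).toLinearMap ∘ₗ B.space.subtype

theorem PoissonSubspace.incl_apply (B : PoissonSubspace V r) (x : B.space) :
    B.incl x = toSuper V r x := rfl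

theorem PoissonSubspace.incl_injective (B : PoissonSubspace V r) : Function.Injective B.incl :=
  (toSuper V r).injective.comp Subtype.val_injective

theorem PoissonSubspace.incl_parity (B : PoissonSubspace V r) (x : B.space) :
    B.incl (parity.restrict B.parity_mem x) =
      (sparity (B := EvenFun V) (U := OddSpan r)).toLinearMap (B.incl x) :=
  toSuper_parity (x : FunAlg V r)

theorem intertwines_repOn (hB : ∀ x, x ∈ B.space ↔ ∀ c ∈ o, restrictTo (c.odd r) x = 0) {D : ℤ}
    (γ : fcGCComp o D) :
    Intertwines B.incl (repOn hB D γ) ((funEdgeOps V r).repFamily γ.1) := fun N x =>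
  toSuper_rep (γ.1 N) fun i => (x i : FunAlg V r)

theorem intertwines_bilinCochain (B : PoissonSubspace V r) :
    Intertwines B.incl (bilinCochain B.bracket) ((funEdgeOps V r).repFamily upsilon) := by
  intro N x
  rw [EdgeOps.repFamily_apply]
  refine Eq.trans ?_ (toSuper_rep (upsilon N) fun i => (x i : FunAlg V r))
  rw [B.incl_apply]
  congr 1
  by_cases hN : N = 2
  · subst hN
    rw [rep_upsilon]
    rfl
  · rw [upsilon_of_ne hN, map_zero]
    match N, hN with
    | 0, _ => rfl
    | 1, _ => rfl
    | (k + 3), _ => rfl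

theorem repOn_mem_ceComp (hB : ∀ x, x ∈ B.space ↔ ∀ c ∈ o, restrictTo (c.odd r) x = 0) {D : ℤ}
    (γ : fcGCComp o D) : repOn hB D γ ∈ B.ce.comp D := by
  have hG := B.isParityGrading o hB
  refine ⟨fun N d x hx => ?_, fun N i j hij a b x hi hj => B.incl_injective ?_⟩
  · rw [Submodule.mem_comap]
    refine rep_mem_of_forall _ _ fun m hm => ?_
    have h := repGraph_mem_funComp m (fun i => d i + 2) (fun i => (x i : FunAlg V r)) hx
    have hD := (γ.2.2.2.2 N m hm).2.2
    have e : ∑ i, (d i + 2) - 2 * (m.degree : ℤ) = ∑ i, d i + (D - ((N : ℤ) - 1)) + 2 := by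
      rw [Finset.sum_add_distrib, Finset.sum_const, Finset.card_univ, Fintype.card_fin,
        nsmul_eq_mul]
      linarith
    rwa [e] at h
  · have hp : ∀ (a : ℤ) (y : B.space),
        y ∈ (funComp V r (a + 2)).comap B.space.subtype →
        sparity (B.incl y) = a.negOnePow • B.incl y := fun a y hy => by
      rw [← AlgHom.toLinearMap_apply, ← B.incl_parity, hG.parity a y hy, Units.smul_def,
        map_zsmul, Units.smul_def]
    rw [intertwines_repOn hB γ, map_neg, Units.smul_def, map_zsmul, intertwines_repOn hB γ,
      ← Units.smul_def]
    exact (funEdgeOps V r).rep_comp_swap_of_relabel (γ.2.2.2.1 N) i j hij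
      (fun k => B.incl (x k)) (hp a _ hi) (hp b _ hj)

/-- Through this identification the degree and the graded antisymmetry of the Poisson bracket are
inherited from `upsilon_mem`. -/
theorem bilinCochain_bracket_eq (hB : ∀ x, x ∈ B.space ↔ ∀ c ∈ o, restrictTo (c.odd r) x = 0) :
    bilinCochain B.bracket = repOn hB 1 ⟨upsilon, upsilon_mem⟩ :=
  (intertwines_bilinCochain B).eq B.incl_injective (intertwines_repOn hB ⟨upsilon, upsilon_mem⟩)

/-- The Poisson bracket squares to zero for the Nijenhuis–Richardson bracket because it is the image
of `upsilon`, which does so among graphs. -/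
theorem isDGLie_ce (hB : ∀ x, x ∈ B.space ↔ ∀ c ∈ o, restrictTo (c.odd r) x = 0) :
    B.ce.IsDGLie := by
  refine isDGLie_chevalleyEilenberg (B.isParityGrading o hB) _ ?_ ?_
  · rw [bilinCochain_bracket_eq hB]
    exact repOn_mem_ceComp hB _
  · have h := (intertwines_bilinCochain B).nrBracket B.incl_parity (intertwines_bilinCochain B) 1 1
    have hu := (isGraphCochain_of_mem (upsilon_mem (o := ∅))).even
    rw [← EdgeOps.repFamily_graphBracket _ hu hu, graphBracket_upsilon, map_zero] at h
    exact h.eq B.incl_injective fun N x => map_zero _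

theorem mem_lieQuasi (x : FunAlg V r) :
    x ∈ (lieQuasi V r).space ↔ restrictTo (Colour.black.odd r) x = 0 := Iff.rfl

theorem mem_quasiLie (x : FunAlg V r) :
    x ∈ (quasiLie V r).space ↔ restrictTo (Colour.red.odd r) x = 0 := Iff.rfl

theorem mem_lieFun (x : FunAlg V r) : x ∈ (lieFun V r).space ↔
    restrictTo (Colour.black.odd r) x = 0 ∧ restrictTo (Colour.red.odd r) x = 0 := Iff.rfl

/-- The representation on functions induces a morphism to the Chevalley–Eilenberg dg Lie algebra of
any subspace of functions that is defined by the vanishing of restrictions. -/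
theorem repInduces (o : Set Colour) (B : PoissonSubspace V r)
    (hB : ∀ x, x ∈ B.space ↔ ∀ c ∈ o, restrictTo (c.odd r) x = 0) : RepInduces o B := by
  refine ⟨isDGLie_fcGC o, isDGLie_ce hB,
    fun D => (repOn hB D).codRestrict _ (repOn_mem_ceComp hB), fun D γ N f => rfl, ?_, ?_⟩
  · intro i j x y z hz
    -- Both sides are restrictions to `B` of operations on the full super algebra, where they agree
    -- by `EdgeOps.repFamily_graphBracket`.
    refine (intertwines_repOn hB z).eq B.incl_injective ?_
    rw [hz]
    change Intertwines _ (nrBracket _ i j (repOn hB i x) (repOn hB j y)) _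
    have := (intertwines_repOn hB x).nrBracket B.incl_parity (intertwines_repOn hB y) i j
    rwa [← EdgeOps.repFamily_graphBracket _ (isGraphCochain_of_mem x.2).even
      (isGraphCochain_of_mem y.2).even] at this
  · intro i x z hz
    refine (intertwines_repOn hB z).eq B.incl_injective ?_
    rw [hz]
    change Intertwines _ (nrBracket _ 1 i (bilinCochain B.bracket) (repOn hB i x)) _
    have := (intertwines_bilinCochain B).nrBracket B.incl_parity (intertwines_repOn hB x) 1 i
    rwa [← EdgeOps.repFamily_graphBracket _ (isGraphCochain_of_mem (upsilon_mem (o := ∅))).even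
      (isGraphCochain_of_mem x.2).even] at this

end Representation

end LieBialgebroid
end

theorem proposition4p7 (n r : ℕ) (V : TopologicalSpace.Opens (EuclideanSpace ℝ (Fin n))) :
    LieBialgebroid.RepInduces ∅ (LieBialgebroid.allFun V r) ∧
    LieBialgebroid.RepInduces {LieBialgebroid.Colour.black} (LieBialgebroid.lieQuasi V r) ∧
    LieBialgebroid.RepInduces {LieBialgebroid.Colour.red} (LieBialgebroid.quasiLie V r) ∧
    LieBialgebroid.RepInduces {LieBialgebroid.Colour.black, LieBialgebroid.Colour.red}
      (LieBialgebroid.lieFun V r) := by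
  refine ⟨LieBialgebroid.repInduces _ _ fun x => ?_, LieBialgebroid.repInduces _ _ fun x => ?_,
    LieBialgebroid.repInduces _ _ fun x => ?_, LieBialgebroid.repInduces _ _ fun x => ?_⟩
  · exact ⟨fun _ c hc => absurd hc (Set.notMem_empty c), fun _ => Submodule.mem_top⟩
  · rw [LieBialgebroid.mem_lieQuasi]
    simp only [Set.mem_singleton_iff, forall_eq]
  · rw [LieBialgebroid.mem_quasiLie]
    simp only [Set.mem_singleton_iff, forall_eq]
  · rw [LieBialgebroid.mem_lieFun]
    simp only [Set.mem_insert_iff, Set.mem_singleton_iff, forall_eq_or_imp, forall_eq]
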